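/- Let $X$ be a connected compact complex manifold of dimension $n$ with a hermitian metric whose associated $(1,1)$-form is $\omega$, and let $m\ge n$. Let $f:\mathbb{C}^m\to X$ be a meromorphic map, i.e. a holomorphic map $f:\mathbb{C}^m\setminus S\to X$, where $S\subset\mathbb{C}^m$ is a nowhere dense analytic subset, such that the closure of the graph of $f$ in $\mathbb{C}^m\times X$ is an analytic subset. Assume that $f$ is differentiably non-degenerate, i.e. that $df$ has maximal rank ($=n$) at the points of a dense subset of $\mathbb{C}^m\setminus S$. With $\alpha=dd^c\|z\|^2=\frac{i}{2\pi}\sum_{j=1}^m dz_j\wedge d\bar z_j$ and $B(t)=\{z\in\mathbb{C}^m:\|z\|<t\}$ put $$T_f(r;\omega)=\int_1^r\frac{dt}{t^{2m-1}}\int_{B(t)}f^*\omega\wedge\alpha^{m-1},\qquad \rho_f=\limsup_{r\to\infty}\frac{\log T_f(r;\omega)}{\log r},$$ and assume that $\rho_f<2$. Then for all integers $l_1,\dots,l_n\ge 0$ with $\sum_{k=1}^n l_k>0$, $$H^0\bigl(X,\;S^{l_1}\Omega^1_X\otimes\cdots\otimes S^{l_n}\Omega^n_X\bigr)=\{0\},$$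 where $\Omega^k_X$ is the sheaf of holomorphic $k$-forms on $X$ and $S^l$ denotes the $l$-th symmetric tensor power. -/

import Mathlib

open Set Filter Topology MeasureTheory Metric
open scoped Manifold ContDiff ENNReal

noncomputable section

/-- The complex vector space `ℂ^k` with its Euclidean norm. -/
abbrev CSpace (k : ℕ) : Type := EuclideanSpace ℂ (Fin k)

/-- `A` is a (closed) analytic subset of the complex manifold `M` : around every point of `M` it is
the common zero set of finitely many holomorphic functions. -/
def IsAnalyticSubset {E H M : Type*} [NormedAddCommGroup E] [NormedSpace ℂ E] [TopologicalSpace H]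
    [TopologicalSpace M] [ChartedSpace H M] (I : ModelWithCorners ℂ E H) (A : Set M) : Prop :=
  ∀ p : M, ∃ U : Set M, IsOpen U ∧ p ∈ U ∧ ∃ (N : ℕ) (g : Fin N → M → ℂ),
    (∀ i, MDifferentiableOn I 𝓘(ℂ, ℂ) (g i) U) ∧ A ∩ U = {z ∈ U | ∀ i, g i z = 0}

section Manifold

variable (n : ℕ) (X : Type*) [TopologicalSpace X] [ChartedSpace (CSpace n) X]

/-- For a point `y` of the target of the chart `φ` around `x₀`, the coordinate frame: the
differential at `y` of `φ⁻¹`, which carries a constant vector `v = ∑ vⱼ eⱼ` to the tangent vector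
`∑ vⱼ ∂/∂wⱼ` of `X` at `φ⁻¹ y`. -/
def coordVector (x₀ : X) (y : CSpace n) (v : CSpace n) :
    TangentSpace 𝓘(ℂ, CSpace n) ((chartAt (CSpace n) x₀).symm y) :=
  mfderiv 𝓘(ℂ, CSpace n) 𝓘(ℂ, CSpace n) (chartAt (CSpace n) x₀).symm y v

/-- A (smooth) hermitian metric on the complex manifold `X`; it is conjugate-linear in the first
variable and complex linear in the second one. -/
structure HermitianMetric where
  /-- The hermitian form on each holomorphic tangent space. -/
  form : ∀ x : X, TangentSpace 𝓘(ℂ, CSpace n) x →ₗ⋆[ℂ] TangentSpace 𝓘(ℂ, CSpace n) x →ₗ[ℂ] ℂ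
  conj_symm : ∀ x u v, starRingEnd ℂ (form x u v) = form x v u
  pos : ∀ x u, u ≠ 0 → 0 < (form x u u).re
  smooth : ∀ (x₀ : X) (v w : CSpace n),
    ContDiffOn ℝ ∞ (fun y => form ((chartAt (CSpace n) x₀).symm y)
      (coordVector n X x₀ y v) (coordVector n X x₀ y w)) (chartAt (CSpace n) x₀).target

variable {n X} in
/-- The metric form `ω = (i/2π) ∑ h_{jk} dw_j ∧ d\bar w_k` of a hermitian metric, as a real
alternating 2-form on each tangent space. -/
def HermitianMetric.metricForm (h : HermitianMetric n X) (x : X)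
    (u v : TangentSpace 𝓘(ℂ, CSpace n) x) : ℝ :=
  (h.form x u v).im / Real.pi

/-- A meromorphic map `f : ℂ^m → X` into a compact complex manifold `X`: a map which is defined and
holomorphic outside a nowhere dense analytic subset `S` of `ℂ^m`, and whose graph has an analytic
closure in `ℂ^m × X`. (The projection of that closure to `ℂ^m` is proper as `X` is compact.)
The values of `toFun` on `S` carry no meaning. -/
structure MeromorphicMap (m : ℕ) where
  toFun : CSpace m → X
  S : Set (CSpace m)
  analytic_S : IsAnalyticSubset 𝓘(ℂ, CSpace m) S
  nowhereDense_S : IsNowhereDense S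
  holomorphic : MDifferentiableOn 𝓘(ℂ, CSpace m) 𝓘(ℂ, CSpace n) toFun Sᶜ
  analytic_graph : IsAnalyticSubset (𝓘(ℂ, CSpace m).prod 𝓘(ℂ, CSpace n))
    (closure {p : CSpace m × X | p.1 ∉ S ∧ p.2 = toFun p.1})

end Manifold

/-- The form `α = dd^c ‖z‖² = (i/2π) ∑ dz_j ∧ d\bar z_j` on `ℂ^m`, i.e.
`α(u, v) = (1/π) ∑ (Re u_j Im v_j - Im u_j Re v_j)`. -/
def alphaForm (m : ℕ) (u v : CSpace m) : ℝ :=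
  (∑ j, ((u j).re * (v j).im - (u j).im * (v j).re)) / Real.pi

/-- The value of the wedge product `β₁ ∧ ⋯ ∧ β_m` of `m` alternating 2-forms at `2m` vectors. -/
def wedgeTwoForms {V : Type*} (m : ℕ) (β : Fin m → V → V → ℝ) (v : Fin m × Fin 2 → V) : ℝ :=
  (1 / 2 ^ m : ℝ) * ∑ σ : Equiv.Perm (Fin m × Fin 2),
    ((Equiv.Perm.sign σ : ℤ) : ℝ) * ∏ i, β i (v (σ (i, 0))) (v (σ (i, 1)))

/-- The positively oriented real orthonormal basis
`∂/∂x_1, ∂/∂y_1, …, ∂/∂x_m, ∂/∂y_m` of `ℂ^m`, where `z_j = x_j + i y_j`. -/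
def stdRealBasis (m : ℕ) (p : Fin m × Fin 2) : CSpace m :=
  EuclideanSpace.single p.1 (if p.2 = 0 then 1 else Complex.I)

namespace MeromorphicMap

variable {n : ℕ} {X : Type*} [TopologicalSpace X] [ChartedSpace (CSpace n) X] {m : ℕ}

/-- The differential `df` at a point. -/
def differential (f : MeromorphicMap n X m) (z : CSpace m) :
    CSpace m →L[ℂ] TangentSpace 𝓘(ℂ, CSpace n) (f.toFun z) :=
  mfderiv 𝓘(ℂ, CSpace m) 𝓘(ℂ, CSpace n) f.toFun z

/-- `f` is differentiably non-degenerate: `df` is generically of maximal rank. -/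
def DifferentiablyNondegenerate (f : MeromorphicMap n X m) : Prop :=
  Dense {z : CSpace m | z ∉ f.S ∧
    Module.finrank ℂ (LinearMap.range (f.differential z).toLinearMap) = min m n}

/-- The density of the `2m`-form `f^*ω ∧ α^{m-1}` with respect to
`dx_1 ∧ dy_1 ∧ ⋯ ∧ dx_m ∧ dy_m`, outside `S`. -/
def pullbackDensity (f : MeromorphicMap n X m) (h : HermitianMetric n X) (z : CSpace m) : ℝ :=
  wedgeTwoForms m
    (fun i => if (i : ℕ) = 0
      then fun u v => h.metricForm (f.toFun z) (f.differential z u) (f.differential z v)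
      else alphaForm m)
    (stdRealBasis m)

/-- The order function `T_f(r; ω) = ∫_1^r t^{1-2m} dt ∫_{B(t)} f^*ω ∧ α^{m-1}`, with values in
`[0, ∞]`. The form is positive, and is integrated off the null set `S`. -/
def orderFunction (f : MeromorphicMap n X m) (h : HermitianMetric n X) (r : ℝ) : ℝ≥0∞ :=
  ∫⁻ t in Ioc 1 r, ENNReal.ofReal (1 / t ^ (2 * m - 1)) *
    ∫⁻ z in ball (0 : CSpace m) t \ f.S, ENNReal.ofReal (f.pullbackDensity h z)

/-- The (upper) order `ρ_f = limsup_{r → ∞} log T_f(r; ω) / log r`. -/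
def order (f : MeromorphicMap n X m) (h : HermitianMetric n X) : EReal :=
  limsup (fun r : ℝ => ENNReal.log (f.orderFunction h r) / ((Real.log r : ℝ) : EReal)) atTop

end MeromorphicMap

section Tensors

/-- Index set of the arguments of a tensor in `S^{l_1}Λ^1 ⊗ ⋯ ⊗ S^{l_n}Λ^n` : for `k : Fin n`
there are `l k` blocks of `k + 1` arguments each (so `k : Fin n` stands for the degree `k + 1`). -/
abbrev TensorIndex (n : ℕ) (l : Fin n → ℕ) : Type :=
  (k : Fin n) × (Fin (l k) × Fin ((k : ℕ) + 1))

/-- For a complex vector space `V`, the space `S^{l_1}(Λ^1 V^*) ⊗ ⋯ ⊗ S^{l_n}(Λ^n V^*)`, realized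
as covariant tensors on `V`: multilinear forms which are alternating in the arguments of each block
and symmetric under permutation of the `l k` blocks of degree `k + 1`, for each `k`. -/
def symAltTensors (n : ℕ) (l : Fin n → ℕ) (V : Type*) [AddCommGroup V] [Module ℂ V] :
    Submodule ℂ (MultilinearMap ℂ (fun _ : TensorIndex n l => V) ℂ) where
  carrier := {T |
    (∀ (v : TensorIndex n l → V) (k : Fin n) (j : Fin (l k)) (a b : Fin ((k : ℕ) + 1)),
      a ≠ b → v ⟨k, j, a⟩ = v ⟨k, j, b⟩ → T v = 0) ∧
    (∀ (v : TensorIndex n l → V) (σ : ∀ k : Fin n, Equiv.Perm (Fin (l k))),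
      T (fun p => v ⟨p.1, σ p.1 p.2.1, p.2.2⟩) = T v)}
  zero_mem' := by simp
  add_mem' := by
    rintro S T ⟨hS, hS'⟩ ⟨hT, hT'⟩
    refine ⟨fun v k j a b hab hv => ?_, fun v σ => ?_⟩
    · simp [hS v k j a b hab hv, hT v k j a b hab hv]
    · simp only [add_apply, hS' v σ, hT' v σ]
  smul_mem' := by
    rintro c T ⟨hT, hT'⟩
    refine ⟨fun v k j a b hab hv => ?_, fun v σ => ?_⟩
    · simp [hT v k j a b hab hv]
    · simp only [smul_apply, hT' v σ]

/-- The space `H^0(X, S^{l_1}Ω^1 ⊗ ⋯ ⊗ S^{l_n}Ω^n)` of global holomorphic sections: fields of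
tensors whose coefficients in every coordinate chart are holomorphic. -/
def globalSections (n : ℕ) (X : Type*) [TopologicalSpace X] [ChartedSpace (CSpace n) X]
    (l : Fin n → ℕ) :
    Submodule ℂ (∀ x : X, symAltTensors n l (TangentSpace 𝓘(ℂ, CSpace n) x)) where
  carrier := {τ | ∀ (x₀ : X) (v : TensorIndex n l → CSpace n),
    DifferentiableOn ℂ (fun y => (τ ((chartAt (CSpace n) x₀).symm y)).1
      (fun p => coordVector n X x₀ y (v p))) (chartAt (CSpace n) x₀).target}
  zero_mem' := fun _ _ => differentiableOn_const 0
  add_mem' := fun hS hT x₀ v => (hS x₀ v).add (hT x₀ v)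
  smul_mem' := fun c _ hT x₀ v => (hT x₀ v).const_smul c

end Tensors

end

/-! ### Cauchy integrals and derivatives in several complex variables -/

section SeveralVariables

variable {E F : Type*} [NormedAddCommGroup E] [NormedSpace ℂ E]
  [NormedAddCommGroup F] [NormedSpace ℂ F]

/-! Let τ be a non-zero section and N > 0 the number of its arguments as a multilinear form. A
coefficient ξ of f^*τ in the constant frame of ℂ^m is holomorphic off S. Since τ is bounded on the
compact manifold X, |ξ|^{2/N} is at most a constant times the energy density of f
(`exists_norm_pullback_rpow_le_energy`), which in turn is dominated by the density of f^*ω ∧ α^{m-1}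
(`MeromorphicMap.energy_le_pullbackDensity`). Order less than 2 means that the energy of B(r) is
O(r^{2m-2+q}) with some q < 2. If |ξ|^{2/N} satisfies the sub-mean value inequality at a ∉ S, then
|ξ(a)|^{2/N} r^{2m} is bounded by the same quantity up to a constant, and r → ∞ gives ξ(a) = 0. By
non-degeneracy f is a submersion somewhere, so τ would vanish on an open set and hence everywhere
(`exists_pullback_ne_zero`).

The real work is the sub-mean value inequality across S, which may contain hypersurfaces. It is
proved along the complex lines through a fixed a ∉ S. Such a line meets S in isolated points, and by
Fubini almost every line carries finite area near each of its points other than a. A holomorphic map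
of finite area from a punctured disc to X extends continuously (`exists_tendsto_of_finite_area`).
The length-area method gives short circles around the puncture, and compactness of X brings
infinitely many of them close to one point p. The annulus between two of them cannot leave a chart
at p, because a curve that crosses a shell has a definite amount of area (`area_lower_bound`).
Riemann's theorem in the chart finishes.

Extension along one line says nothing about the derivatives of f transversal to it, which f^*τ
involves. So the extension is written as a Cauchy integral over a circle on which f is holomorphic;
the integral makes sense for all neighbouring directions z. The difference between f and this
integral is holomorphic in z, and the zeros of a holomorphic map form a null set up to interior
points (`volume_zeros_diff_interior`). Hence for almost all z the identity persists near z and may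
be differentiated in z (`exists_extension_pullback`). Thus ξ continues to an entire function on
almost every line, Jensen's formula gives the inequality on circles, and averaging over directions
gives it on balls. -/

theorem ContinuousOn.intervalIntegral_param {T : Type*} [TopologicalSpace T] {s : Set T}
    {K : T → ℝ → F} (hK : ContinuousOn (fun p : T × ℝ => K p.1 p.2) (s ×ˢ univ)) (a b : ℝ) :
    ContinuousOn (fun x => ∫ θ in a..b, K x θ) s := by
  rw [continuousOn_iff_continuous_domRestrict]
  refine intervalIntegral.continuous_parametric_intervalIntegral_of_continuous'
    (f := fun (x : s) θ => K x θ) ?_ a b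
  have := hK.comp_continuous (f := fun p : s × ℝ => ((p.1 : T), p.2)) (by fun_prop)
    (fun p => ⟨p.1.2, mem_univ _⟩)
  exact this

theorem ContinuousOn.circleIntegral_param {T : Type*} [TopologicalSpace T] {s : Set T}
    {K : T → ℂ → F} {c : ℂ} {R : ℝ}
    (hK : ContinuousOn (fun p : T × ℂ => K p.1 p.2) (s ×ˢ sphere c |R|)) :
    ContinuousOn (fun x => ∮ ζ in C(c, R), K x ζ) s := by
  unfold circleIntegral
  refine ContinuousOn.intervalIntegral_param
    (K := fun x θ => deriv (circleMap c R) θ • K x (circleMap c R θ)) ?_ _ _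
  refine ContinuousOn.smul ?_ ?_
  · simp only [deriv_circleMap]
    fun_prop
  · exact hK.comp (f := fun p : T × ℝ => (p.1, circleMap c R p.2)) (by fun_prop)
      (fun p hp => ⟨hp.1, circleMap_mem_sphere' c R p.2⟩)

variable [CompleteSpace F]

/-- Cauchy's formula for the derivative of the one-variable function `ζ ↦ h (x + ζ • v)` at 0.
Writing a derivative as an integral of `h` itself yields continuity and holomorphy of derivatives.
-/
theorem fderiv_apply_eq_circleIntegral {h : E → F} {V : Set E} (hV : IsOpen V)
    (hh : DifferentiableOn ℂ h V) {x v : E} {R : ℝ} (hR : 0 < R)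
    (hx : ∀ ζ : ℂ, ‖ζ‖ ≤ R → x + ζ • v ∈ V) :
    fderiv ℂ h x v =
      (2 * Real.pi * Complex.I : ℂ)⁻¹ • ∮ ζ in C(0, R), (ζ ^ 2)⁻¹ • h (x + ζ • v) := by
  have hopen : IsOpen ((fun ζ : ℂ => x + ζ • v) ⁻¹' V) := hV.preimage (by fun_prop)
  have hx0 : x ∈ V := by simpa using hx 0 (by simpa using hR.le)
  have key := Complex.two_pi_I_inv_smul_circleIntegral_sub_sq_inv_smul_of_differentiable
    (f := fun ζ : ℂ => h (x + ζ • v)) (c := 0) (w₀ := 0) (R := R) hopen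
    (fun ζ hζ => hx ζ (by simpa using hζ))
    (fun ζ hζ => ((hh.differentiableAt (hV.mem_nhds hζ)).comp ζ
      (by fun_prop : DifferentiableAt ℂ (fun ζ : ℂ => x + ζ • v) ζ)).differentiableWithinAt)
    (by simpa using hR)
  simp only [sub_zero] at key
  rw [key]
  have h1 : HasFDerivAt h (fderiv ℂ h x) (x + (0 : ℂ) • v) := by
    simpa using (hh.differentiableAt (hV.mem_nhds hx0)).hasFDerivAt
  have h2 : HasDerivAt (fun ζ : ℂ => x + ζ • v) v 0 := by
    simpa using ((hasDerivAt_id (0 : ℂ)).smul_const v).const_add x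
  exact (h1.comp_hasDerivAt (0 : ℂ) h2).deriv.symm

theorem exists_radius_add_smul_mem {V : Set E} (hV : IsOpen V) {x : E} (hx : x ∈ V) (v : E) :
    ∃ r > 0, ∃ R > 0, ball x r ⊆ V ∧ ∀ y ∈ ball x r, ∀ ζ : ℂ, ‖ζ‖ ≤ R → y + ζ • v ∈ V := by
  obtain ⟨r, hr, hrV⟩ := Metric.isOpen_iff.1 hV x hx
  refine ⟨r / 2, by positivity, r / (2 * (‖v‖ + 1)), by positivity,
    (ball_subset_ball (by linarith)).trans hrV, fun y hy ζ hζ => hrV ?_⟩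
  rw [mem_ball_iff_norm] at hy ⊢
  have h1 : ‖ζ • v‖ < r / 2 := by
    rw [norm_smul]
    calc ‖ζ‖ * ‖v‖ ≤ r / (2 * (‖v‖ + 1)) * ‖v‖ := by gcongr
      _ < r / (2 * (‖v‖ + 1)) * (‖v‖ + 1) := by gcongr; linarith
      _ = r / 2 := by field_simp
  calc ‖y + ζ • v - x‖ = ‖(y - x) + ζ • v‖ := by congr 1; abel
    _ ≤ ‖y - x‖ + ‖ζ • v‖ := norm_add_le _ _
    _ < r := by linarith

variable [FiniteDimensional ℂ E]

/-- Locally the derivative is a circle integral of `K` with a fixed radius, so joint continuity of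
`K` is inherited. In finite dimension it suffices to test the derivative on single vectors. -/
theorem continuousOn_fderiv_param {T : Type*} [TopologicalSpace T] {V : Set E} (hV : IsOpen V)
    {K : E → T → F} (hK : ContinuousOn (fun p : E × T => K p.1 p.2) (V ×ˢ univ))
    (hd : ∀ t, DifferentiableOn ℂ (fun x => K x t) V) :
    ContinuousOn (fun p : E × T => fderiv ℂ (fun x => K x p.2) p.1) (V ×ˢ univ) := by
  rw [continuousOn_clm_apply]
  rintro v ⟨x, t⟩ ⟨hx, -⟩
  obtain ⟨r, hr, R, hR, hrV, hRV⟩ := exists_radius_add_smul_mem hV hx v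
  have hc : ContinuousOn (fun p : E × T => (2 * Real.pi * Complex.I : ℂ)⁻¹ •
      ∮ ζ in C(0, R), (ζ ^ 2)⁻¹ • K (p.1 + ζ • v) p.2) (ball x r ×ˢ univ) := by
    refine ContinuousOn.const_smul (ContinuousOn.circleIntegral_param
      (K := fun (p : E × T) (ζ : ℂ) => (ζ ^ 2)⁻¹ • K (p.1 + ζ • v) p.2) ?_) _
    refine ContinuousOn.smul ?_ ?_
    · refine ContinuousOn.inv₀ (by fun_prop) ?_
      rintro ⟨p, ζ⟩ ⟨-, hζ⟩
      have : ‖ζ‖ = R := by simpa [abs_of_pos hR] using hζ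
      have : ζ ≠ 0 := by rintro rfl; simp at this; linarith
      positivity
    · refine hK.comp (f := fun q : (E × T) × ℂ => (q.1.1 + q.2 • v, q.1.2)) (by fun_prop) ?_
      rintro ⟨p, ζ⟩ ⟨hp, hζ⟩
      refine ⟨hRV _ hp.1 ζ ?_, mem_univ _⟩
      have : ‖ζ‖ = R := by simpa [abs_of_pos hR] using hζ
      exact this.le
  have hmem : ball x r ×ˢ (univ : Set T) ∈ 𝓝 (x, t) :=
    (isOpen_ball.prod isOpen_univ).mem_nhds ⟨mem_ball_self hr, mem_univ _⟩
  have hc' := hc.continuousAt hmem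
  refine (hc'.congr ?_).continuousWithinAt
  filter_upwards [hmem] with p hp
  exact (fderiv_apply_eq_circleIntegral hV (hd p.2) hR (hRV p.1 hp.1)).symm

theorem DifferentiableOn.continuousOn_fderiv_of_isOpen {h : E → F} {V : Set E} (hV : IsOpen V)
    (hh : DifferentiableOn ℂ h V) : ContinuousOn (fderiv ℂ h) V := by
  have := continuousOn_fderiv_param (T := Unit) hV (K := fun x _ => h x)
    (hh.continuousOn.comp continuousOn_fst (fun p hp => hp.1)) (fun _ => hh)
  exact this.comp (f := fun x : E => (x, ())) (by fun_prop) (fun x hx => ⟨hx, mem_univ _⟩)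

/-- Differentiation under the integral sign; the dominating constant comes from joint continuity of
the derivative and compactness of the interval. -/
theorem hasFDerivAt_intervalIntegral_of_holomorphic {V : Set E} (hV : IsOpen V)
    {K : E → ℝ → F} (hK : ContinuousOn (fun p : E × ℝ => K p.1 p.2) (V ×ˢ univ))
    (hd : ∀ t, DifferentiableOn ℂ (fun x => K x t) V) {x : E} (hx : x ∈ V) (a b : ℝ) :
    HasFDerivAt (fun x => ∫ t in a..b, K x t) (∫ t in a..b, fderiv ℂ (fun x => K x t) x) x := by
  have hc := continuousOn_fderiv_param hV hK hd
  have hKx : ∀ y ∈ V, Continuous (K y) := fun y hy =>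
    hK.comp_continuous (f := fun t : ℝ => (y, t)) (by fun_prop) (fun t => ⟨hy, mem_univ _⟩)
  have hFx : ∀ y ∈ V, Continuous (fun t => fderiv ℂ (fun x => K x t) y) := fun y hy =>
    hc.comp_continuous (f := fun t : ℝ => (y, t)) (by fun_prop) (fun t => ⟨hy, mem_univ _⟩)
  -- a neighbourhood of `x` on which the derivative is bounded
  have hloc : ∃ C : ℝ, ∀ᶠ y in 𝓝 x, ∀ t ∈ uIcc a b, ‖fderiv ℂ (fun x => K x t) y‖ ≤ C := by
    obtain ⟨C, hC⟩ := (isCompact_uIcc (a := a) (b := b)).exists_bound_of_continuousOn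
      (hFx x hx).continuousOn
    refine ⟨C + 1, isCompact_uIcc.eventually_forall_of_forall_eventually fun t ht => ?_⟩
    have hca := (hc.continuousAt ((hV.prod isOpen_univ).mem_nhds
      (show (x, t) ∈ V ×ˢ univ from ⟨hx, mem_univ _⟩))).norm
    exact (hca.eventually (gt_mem_nhds (show _ < C + 1 by linarith [hC t ht]))).mono
      fun p hp => hp.le
  obtain ⟨C, hC⟩ := hloc
  obtain ⟨s, hs, hsC⟩ := eventually_iff_exists_mem.1 (hC.and (hV.mem_nhds hx))
  refine intervalIntegral.hasFDerivAt_integral_of_dominated_of_fderiv_le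
    (F' := fun y t => fderiv ℂ (fun x => K x t) y) (s := s)
    (bound := fun _ => C) hs ?_ ?_ ?_ ?_ ?_ ?_
  · filter_upwards [hV.mem_nhds hx] with y hy
    exact (hKx y hy).aestronglyMeasurable
  · exact (hKx x hx).intervalIntegrable _ _
  · exact (hFx x hx).aestronglyMeasurable
  · exact Eventually.of_forall fun t ht y hy => (hsC y hy).1 t (uIoc_subset_uIcc ht)
  · exact intervalIntegrable_const
  · exact Eventually.of_forall fun t ht y hy =>
      ((hd t).differentiableAt (hV.mem_nhds (hsC y hy).2)).hasFDerivAt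

theorem differentiableOn_circleIntegral_of_holomorphic {V : Set E} (hV : IsOpen V)
    {K : E → ℂ → F} {c : ℂ} {R : ℝ}
    (hK : ContinuousOn (fun p : E × ℂ => K p.1 p.2) (V ×ˢ sphere c |R|))
    (hd : ∀ ζ ∈ sphere c |R|, DifferentiableOn ℂ (fun x => K x ζ) V) :
    DifferentiableOn ℂ (fun x => ∮ ζ in C(c, R), K x ζ) V := by
  intro x hx
  refine (hasFDerivAt_intervalIntegral_of_holomorphic hV
    (K := fun x θ => deriv (circleMap c R) θ • K x (circleMap c R θ)) ?_ ?_ hx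
      _ _).differentiableAt.differentiableWithinAt
  · refine ContinuousOn.smul ?_ ?_
    · simp only [deriv_circleMap]
      fun_prop
    · exact hK.comp (f := fun p : E × ℝ => (p.1, circleMap c R p.2)) (by fun_prop)
        (fun p hp => ⟨hp.1, circleMap_mem_sphere' c R p.2⟩)
  · intro t
    exact (hd _ (circleMap_mem_sphere' c R t)).const_smul _

/-- Partial derivatives of a holomorphic map of several variables are holomorphic. -/
theorem DifferentiableOn.fderiv_apply_of_isOpen {h : E → F} {V : Set E} (hV : IsOpen V)
    (hh : DifferentiableOn ℂ h V) (v : E) : DifferentiableOn ℂ (fun x => fderiv ℂ h x v) V := by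
  intro x hx
  obtain ⟨r, hr, R, hR, hrV, hRV⟩ := exists_radius_add_smul_mem hV hx v
  have hsph : ∀ ζ : ℂ, ζ ∈ sphere (0 : ℂ) |R| → ‖ζ‖ ≤ R := fun ζ hζ => by
    have : ‖ζ‖ = R := by simpa [abs_of_pos hR] using hζ
    exact this.le
  have h1 : DifferentiableOn ℂ (fun y => ∮ ζ in C(0, R), (ζ ^ 2)⁻¹ • h (y + ζ • v))
      (ball x r) := by
    refine differentiableOn_circleIntegral_of_holomorphic isOpen_ball
      (K := fun y ζ => (ζ ^ 2)⁻¹ • h (y + ζ • v)) ?_ ?_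
    · refine ContinuousOn.smul ?_ ?_
      · refine ContinuousOn.inv₀ (by fun_prop) ?_
        rintro ⟨p, ζ⟩ ⟨-, hζ⟩
        have : ‖ζ‖ = R := by simpa [abs_of_pos hR] using hζ
        have : ζ ≠ 0 := by rintro rfl; simp at this; linarith
        positivity
      · exact hh.continuousOn.comp (f := fun q : E × ℂ => q.1 + q.2 • v) (by fun_prop)
          (fun q hq => hRV _ hq.1 _ (hsph _ hq.2))
    · intro ζ hζ
      exact (hh.comp (f := fun y => y + ζ • v) (by fun_prop)
        (fun y hy => hRV _ hy _ (hsph _ hζ))).const_smul _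
  have h2 := (h1.const_smul (2 * Real.pi * Complex.I : ℂ)⁻¹).differentiableAt
    (isOpen_ball.mem_nhds (mem_ball_self hr))
  refine (h2.congr_of_eventuallyEq ?_).differentiableWithinAt
  filter_upwards [isOpen_ball.mem_nhds (mem_ball_self hr)] with y hy
  exact fderiv_apply_eq_circleIntegral hV hh hR (hRV y hy)

end SeveralVariables

/-! ### Identity principle on balls, and zero sets as null sets up to interior -/

section IdentityPrinciple

variable {E F : Type*} [NormedAddCommGroup E] [NormedSpace ℂ E]
  [NormedAddCommGroup F] [NormedSpace ℂ F] [CompleteSpace F]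

theorem DifferentiableOn.analyticOnNhd_comp_line {g : E → F} {V : Set E} (hV : IsOpen V)
    (hg : DifferentiableOn ℂ g V) (z v : E) {U : Set ℂ} (hU : IsOpen U)
    (hUV : ∀ w ∈ U, z + w • v ∈ V) : AnalyticOnNhd ℂ (fun w : ℂ => g (z + w • v)) U :=
  DifferentiableOn.analyticOnNhd (fun w hw =>
    ((hg.differentiableAt (hV.mem_nhds (hUV w hw))).comp w (by fun_prop :
      DifferentiableAt ℂ (fun w : ℂ => z + w • v) w)).differentiableWithinAt) hU

/-- A holomorphic map on a ball which vanishes near the centre vanishes. -/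
theorem DifferentiableOn.eqOn_zero_ball {g : E → F} {z : E} {r : ℝ}
    (hg : DifferentiableOn ℂ g (ball z r)) (h0 : ∀ᶠ y in 𝓝 z, g y = 0) :
    ∀ y ∈ ball z r, g y = 0 := by
  intro y hy
  rw [mem_ball_iff_norm] at hy
  have hr : 0 < r := (norm_nonneg _).trans_lt hy
  -- The line is parametrised with `z` at 0 and `y` at 1, so a disc of radius slightly above 1 is
  -- needed.
  obtain ⟨R, hR1, hR⟩ : ∃ R > 1, R * ‖y - z‖ < r := by
    have : Tendsto (fun R : ℝ => R * ‖y - z‖) (𝓝[>] 1) (𝓝 (1 * ‖y - z‖)) :=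
      ((continuous_id.mul continuous_const).tendsto 1).mono_left nhdsWithin_le_nhds
    rw [one_mul] at this
    obtain ⟨R, h1, h2⟩ := ((this.eventually (gt_mem_nhds hy)).and self_mem_nhdsWithin).exists
    exact ⟨R, h2, h1⟩
  have han := hg.analyticOnNhd_comp_line isOpen_ball z (y - z) (U := ball 0 R) isOpen_ball (by
    intro w hw
    have hw : ‖w‖ < R := by simpa using hw
    rw [mem_ball_iff_norm, add_sub_cancel_left, norm_smul]
    exact (mul_le_mul_of_nonneg_right hw.le (norm_nonneg _)).trans_lt hR)
  have hev : (fun w : ℂ => g (z + w • (y - z))) =ᶠ[𝓝 0] 0 := by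
    have ht : Tendsto (fun w : ℂ => z + w • (y - z)) (𝓝 0) (𝓝 z) := by
      have : Continuous (fun w : ℂ => z + w • (y - z)) := by fun_prop
      simpa using this.tendsto 0
    exact ht.eventually h0
  have := han.eqOn_zero_of_preconnected_of_eventuallyEq_zero
    (convex_ball (0 : ℂ) R).isPreconnected (mem_ball_self (by linarith)) hev
    (show (1 : ℂ) ∈ ball 0 R by simpa using hR1)
  simpa using this

end IdentityPrinciple

/-- The zero set of a holomorphic map is a null set up to its interior. -/
theorem volume_zeros_diff_interior {m : ℕ} {F : Type*} [NormedAddCommGroup F] [NormedSpace ℂ F]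
    [CompleteSpace F] {g : CSpace m → F} {V : Set (CSpace m)} (hV : IsOpen V)
    (hg : DifferentiableOn ℂ g V) :
    volume {z | z ∈ V ∧ g z = 0 ∧ ¬ ∀ᶠ y in 𝓝 z, g y = 0} = 0 := by
  refine measure_null_of_locally_null _ ?_
  rintro z₀ ⟨hz₀, -, hne⟩
  obtain ⟨r, hr, hrV⟩ := Metric.isOpen_iff.1 hV z₀ hz₀
  obtain ⟨z₁, hz₁, hgz₁⟩ : ∃ z₁ ∈ ball z₀ (r / 4), g z₁ ≠ 0 := by
    by_contra! hcon
    exact hne (eventually_of_mem (ball_mem_nhds z₀ (by positivity)) hcon)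
  set v := z₁ - z₀ with hv
  have hvr : ‖v‖ < r / 4 := mem_ball_iff_norm.1 hz₁
  -- for `z` near `z₀` the restriction of `g` to the line through `z` is not zero
  obtain ⟨η, hη, hηr, hηg⟩ : ∃ η > 0, η < r / 4 ∧ ∀ z ∈ ball z₀ η, g (z + v) ≠ 0 := by
    have hc : ContinuousAt (fun z => g (z + v)) z₀ := by
      refine ContinuousAt.comp (f := fun z => z + v) (x := z₀) (g := g) ?_ (by fun_prop)
      refine hg.continuousOn.continuousAt (hV.mem_nhds (hrV ?_))
      rw [mem_ball_iff_norm, add_sub_cancel_left]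
      linarith
    have : ∀ᶠ z in 𝓝 z₀, g (z + v) ≠ 0 :=
      hc.eventually_ne (by simpa [hv] using hgz₁)
    obtain ⟨η, hη, h⟩ := Metric.eventually_nhds_iff_ball.1 this
    exact ⟨min η (r / 8), by positivity, (min_le_right _ _).trans_lt (by linarith),
      fun z hz => h z (ball_subset_ball (min_le_left _ _) hz)⟩
  have hmem : ∀ z ∈ ball z₀ η, ∀ w ∈ ball (0 : ℂ) 2, z + w • v ∈ ball z₀ r := by
    intro z hz w hw
    rw [mem_ball_iff_norm] at hz ⊢
    have hw : ‖w‖ < 2 := by simpa using hw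
    calc ‖z + w • v - z₀‖ = ‖(z - z₀) + w • v‖ := by congr 1; abel
      _ ≤ ‖z - z₀‖ + ‖w‖ * ‖v‖ := (norm_add_le _ _).trans_eq (by rw [norm_smul])
      _ ≤ ‖z - z₀‖ + 2 * ‖v‖ := by gcongr
      _ < r := by linarith
  have hcont : ContinuousOn g (ball z₀ r) := (hg.mono hrV).continuousOn
  -- The open set `O` stands in for the condition `g ≠ 0`, so that the predicate below is
  -- measurable, as Fubini requires.
  obtain ⟨O, hO, hOeq⟩ := continuousOn_iff'.1 hcont {0}ᶜ isOpen_compl_singleton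
  have hZ : ∀ z ∈ ball z₀ r, (g z = 0 ↔ z ∉ O) := by
    intro z hz
    have := Set.ext_iff.1 hOeq z
    simp only [mem_inter_iff, mem_preimage, mem_compl_iff, mem_singleton_iff, hz, and_true] at this
    rw [← this, not_not]
  -- On each line in direction `v` the function is non-zero at `w = 1`, so its zeros are isolated,
  -- hence null in `w`. Exchanging quantifiers, for almost every `w` the translate of the zero set
  -- by `-w • v` is null near `z₀`, and a single small `w` suffices since Lebesgue measure is
  -- translation invariant.
  have hae : ∀ᵐ z : CSpace m, ∀ᵐ w : ℂ, z ∈ ball z₀ η → w ∈ ball (0 : ℂ) 2 → z + w • v ∈ O := by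
    refine Eventually.of_forall fun z => ?_
    by_cases hz : z ∈ ball z₀ η
    swap
    · exact Eventually.of_forall fun w h => (hz h).elim
    have han := (hg.mono hrV).analyticOnNhd_comp_line isOpen_ball z v (U := ball 0 2) isOpen_ball
      (hmem z hz)
    have hcod := han.preimage_zero_mem_codiscreteWithin (x := 1) (by simpa using hηg z hz)
      (by simp) ((convex_ball (0 : ℂ) 2).isConnected ⟨0, by simp⟩)
    have := ae_restrict_le_codiscreteWithin (μ := volume) measurableSet_ball hcod
    rw [mem_ae_iff] at this
    have h3 : ∀ᵐ w ∂(volume.restrict (ball (0 : ℂ) 2)), g (z + w • v) ≠ 0 := this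
    rw [ae_restrict_iff' measurableSet_ball] at h3
    filter_upwards [h3] with w hw _ hw2
    by_contra hcon
    exact hw hw2 ((hZ _ (hmem z hz w hw2)).2 hcon)
  rw [Measure.ae_ae_comm] at hae
  swap
  · have hlin : Continuous (fun p : CSpace m × ℂ => p.1 + p.2 • v) := by fun_prop
    have h1 : MeasurableSet {p : CSpace m × ℂ | p.1 ∈ ball z₀ η} :=
      measurable_fst measurableSet_ball
    have h2 : MeasurableSet {p : CSpace m × ℂ | p.2 ∈ ball (0 : ℂ) 2} :=
      measurable_snd measurableSet_ball
    have h3 : MeasurableSet {p : CSpace m × ℂ | p.1 + p.2 • v ∈ O} :=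
      (hO.preimage hlin).measurableSet
    exact h1.imp (h2.imp h3)
  -- choose a small translation
  obtain ⟨w, hw, hwz⟩ : ∃ w : ℂ, w ∈ ball (0 : ℂ) (min 2 (η / (2 * (‖v‖ + 1)))) ∧
      ∀ᵐ z : CSpace m, z ∈ ball z₀ η → w ∈ ball (0 : ℂ) 2 → z + w • v ∈ O := by
    have hpos : volume (ball (0 : ℂ) (min 2 (η / (2 * (‖v‖ + 1))))) ≠ 0 :=
      (measure_ball_pos _ _ (by positivity)).ne'
    have := (frequently_ae_iff.2 hpos : ∃ᵐ w : ℂ, w ∈ ball (0 : ℂ) _)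
    obtain ⟨w, h1, h2⟩ := (this.and_eventually hae).exists
    exact ⟨w, h1, h2⟩
  have hw2 : w ∈ ball (0 : ℂ) 2 := ball_subset_ball (min_le_left _ _) hw
  have hwη : ‖w • v‖ < η / 2 := by
    have hw' : ‖w‖ < η / (2 * (‖v‖ + 1)) := by
      simpa using ball_subset_ball (min_le_right _ _) hw
    rw [norm_smul]
    calc ‖w‖ * ‖v‖ ≤ η / (2 * (‖v‖ + 1)) * ‖v‖ := by gcongr
      _ < η / (2 * (‖v‖ + 1)) * (‖v‖ + 1) := by gcongr; linarith
      _ = η / 2 := by field_simp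
  refine ⟨{z | z ∈ V ∧ g z = 0 ∧ ¬ ∀ᶠ y in 𝓝 z, g y = 0} ∩ ball z₀ (η / 2),
    inter_mem self_mem_nhdsWithin
      (mem_nhdsWithin_of_mem_nhds (ball_mem_nhds _ (by positivity))), ?_⟩
  have hsub : {z | z ∈ V ∧ g z = 0 ∧ ¬ ∀ᶠ y in 𝓝 z, g y = 0} ∩ ball z₀ (η / 2) ⊆
      (fun z => z + (-(w • v))) ⁻¹' {z | ¬ (z ∈ ball z₀ η → w ∈ ball (0 : ℂ) 2 → z + w • v ∈ O)} := by
    rintro z ⟨⟨-, hz0, -⟩, hzη⟩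
    simp only [mem_preimage, mem_ofPred_eq, neg_add_cancel_right]
    intro h
    rw [mem_ball_iff_norm] at hzη
    refine (hZ z ?_).1 hz0 (h ?_ hw2)
    · rw [mem_ball_iff_norm]; linarith
    · rw [mem_ball_iff_norm]
      calc ‖z + -(w • v) - z₀‖ = ‖(z - z₀) - w • v‖ := by congr 1; abel
        _ ≤ ‖z - z₀‖ + ‖w • v‖ := norm_sub_le _ _
        _ < η := by linarith
  refine measure_mono_null hsub ?_
  rw [measure_preimage_add_right]
  exact hwz

/-! ### Sub-mean value inequality for `|g|^p` on the unit circle -/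

theorem ae_circleMap_of_eventually_punctured {P : ℂ → Prop}
    (hP : ∀ w₀, ∀ᶠ w in 𝓝[≠] w₀, P w) : ∀ᵐ θ : ℝ, P (circleMap 0 1 θ) := by
  -- The exceptional points do not accumulate anywhere, so they meet the circle in a null set of
  -- angles.
  have h1 : {w | P w} ∈ codiscrete ℂ := by
    rw [mem_codiscrete]
    intro w
    rw [disjoint_principal_right, compl_compl]
    exact hP w
  have h2 : {w | P w} ∈ codiscreteWithin (sphere (0 : ℂ) |1|) :=
    codiscreteWithin_mono (subset_univ _) h1
  have h3 := circleMap_preimage_codiscrete (c := 0) one_ne_zero h2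
  have h4 := ae_restrict_le_codiscreteWithin (μ := (volume : Measure ℝ)) MeasurableSet.univ h3
  rw [Measure.restrict_univ] at h4
  exact h4

/-- `|g|^p` is subharmonic for an entire function `g`. -/
theorem norm_rpow_le_lintegral_circleMap {g : ℂ → ℂ} (hg : Differentiable ℂ g) {p : ℝ}
    (hp : 0 < p) :
    ENNReal.ofReal (2 * Real.pi) * ENNReal.ofReal (‖g 0‖ ^ p) ≤
      ∫⁻ θ in Ioc 0 (2 * Real.pi), ENNReal.ofReal (‖g (circleMap 0 1 θ)‖ ^ p) := by
  by_cases hg0 : g 0 = 0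
  · simp [hg0, Real.zero_rpow hp.ne']
  have han : AnalyticOnNhd ℂ g univ := Complex.analyticOnNhd_univ_iff_differentiable.2 hg
  -- Jensen's formula: a zero `u` in the closed unit disc contributes `log (1 / ‖u‖) ≥ 0`.
  have hlog : Real.log ‖g 0‖ ≤ Real.circleAverage (fun x => Real.log ‖g x‖) 0 1 := by
    rw [AnalyticOnNhd.circleAverage_log_norm one_ne_zero (han.mono (subset_univ _)) hg0]
    have : 0 ≤ ∑ᶠ (u : ℂ), ((MeromorphicOn.divisor g (closedBall 0 |1|)) u : ℝ) *
        Real.log (1 * ‖0 - u‖⁻¹) := by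
      refine finsum_nonneg fun u => ?_
      by_cases hu : u ∈ closedBall (0 : ℂ) |1|
      · refine mul_nonneg (mod_cast
          MeromorphicOn.AnalyticOnNhd.divisor_nonneg (han.mono (subset_univ _)) u) ?_
        have hu1 : ‖u‖ ≤ 1 := by simpa using hu
        rw [one_mul, zero_sub, norm_neg, Real.log_inv]
        exact neg_nonneg.2 (Real.log_nonpos (norm_nonneg _) hu1)
      · rw [Function.locallyFinsuppWithin.apply_eq_zero_of_notMem _ hu]
        simp
    linarith
  have hne : ∀ᵐ θ : ℝ, g (circleMap 0 1 θ) ≠ 0 := by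
    refine ae_circleMap_of_eventually_punctured (P := fun w => g w ≠ 0) fun w₀ => ?_
    have := han.preimage_zero_mem_codiscreteWithin hg0 (mem_univ _) isConnected_univ
    have h2 := mem_codiscrete.1 this w₀
    rw [disjoint_principal_right, compl_compl] at h2
    exact h2
  set I : Set ℝ := Ioc 0 (2 * Real.pi) with hI
  have hpi : 0 < 2 * Real.pi := by positivity
  have hcont : Continuous (fun θ : ℝ => g (circleMap 0 1 θ)) :=
    hg.continuous.comp (continuous_circleMap 0 1)
  have hint1 : IntegrableOn (fun θ => p * Real.log ‖g (circleMap 0 1 θ)‖) I := by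
    have h1 : CircleIntegrable (fun x => Real.log ‖g x‖) 0 1 :=
      MeromorphicOn.circleIntegrable_log_norm
        ((han.mono (subset_univ _)).meromorphicOn)
    have h2 := (intervalIntegrable_iff_integrableOn_Ioc_of_le hpi.le).1 h1
    exact Integrable.const_mul h2 p
  have hint2 : IntegrableOn (fun θ => ‖g (circleMap 0 1 θ)‖ ^ p) I := by
    have hc : Continuous (fun θ => ‖g (circleMap 0 1 θ)‖ ^ p) :=
      hcont.norm.rpow_const (fun _ => Or.inr hp.le)
    exact (hc.integrableOn_Icc (a := 0) (b := 2 * Real.pi)).mono_set Ioc_subset_Icc_self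
  have heq : (fun θ => Real.exp (p * Real.log ‖g (circleMap 0 1 θ)‖)) =ᵐ[volume.restrict I]
      fun θ => ‖g (circleMap 0 1 θ)‖ ^ p := by
    filter_upwards [ae_restrict_of_ae hne] with θ hθ
    rw [Real.rpow_def_of_pos (norm_pos_iff.2 hθ), mul_comm]
  have : NeZero (volume.restrict I) := ⟨by
    rw [Ne, Measure.restrict_eq_zero, hI, Real.volume_Ioc]
    simpa using Real.pi_pos⟩
  -- Jensen's inequality for `exp` passes from the mean of `p * log ‖g‖` to the mean of `‖g‖ ^ p`.
  have hJ := ConvexOn.map_average_le (μ := volume.restrict I) (s := univ) (g := Real.exp)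
    (f := fun θ => p * Real.log ‖g (circleMap 0 1 θ)‖) convexOn_exp
    Real.continuous_exp.continuousOn isClosed_univ (by simp) hint1
    (hint2.congr heq.symm)
  rw [average_congr heq] at hJ
  have hvol : (volume.restrict I).real univ = 2 * Real.pi := by
    simp [hI, Measure.real, Real.pi_pos.le]
  rw [average_eq, average_eq, hvol, integral_const_mul, smul_eq_mul, smul_eq_mul] at hJ
  have havg : Real.circleAverage (fun x => Real.log ‖g x‖) 0 1 =
      (2 * Real.pi)⁻¹ * ∫ θ in I, Real.log ‖g (circleMap 0 1 θ)‖ := by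
    rw [Real.circleAverage, intervalIntegral.integral_of_le hpi.le, smul_eq_mul]
  have hfin : 2 * Real.pi * ‖g 0‖ ^ p ≤ ∫ θ in I, ‖g (circleMap 0 1 θ)‖ ^ p := by
    have h1 : ‖g 0‖ ^ p ≤ (2 * Real.pi)⁻¹ * ∫ θ in I, ‖g (circleMap 0 1 θ)‖ ^ p := by
      refine le_trans ?_ hJ
      rw [Real.rpow_def_of_pos (norm_pos_iff.2 hg0)]
      apply Real.exp_le_exp.2
      rw [havg] at hlog
      calc Real.log ‖g 0‖ * p ≤ _ * p := mul_le_mul_of_nonneg_right hlog hp.le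
        _ = _ := by ring
    calc 2 * Real.pi * ‖g 0‖ ^ p ≤ 2 * Real.pi * _ := mul_le_mul_of_nonneg_left h1 hpi.le
      _ = _ := by field_simp
  rw [← ENNReal.ofReal_mul hpi.le, ← ofReal_integral_eq_lintegral_ofReal hint2
    (Eventually.of_forall fun θ => by positivity)]
  exact ENNReal.ofReal_le_ofReal hfin

/-! ### Lower bound for the area of a holomorphic curve -/

section Monotonicity

theorem hasDerivAt_max_zero_sq (x : ℝ) :
    HasDerivAt (fun x : ℝ => (max x 0) ^ 2) (2 * max x 0) x := by
  rcases lt_trichotomy x 0 with hx | rfl | hx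
  · have h : (fun x : ℝ => (max x 0) ^ 2) =ᶠ[𝓝 x] fun _ => 0 := by
      filter_upwards [gt_mem_nhds hx] with y hy
      simp [max_eq_right hy.le]
    rw [max_eq_right hx.le, mul_zero]
    exact (hasDerivAt_const x (0 : ℝ)).congr_of_eventuallyEq h
  · rw [max_self, mul_zero, hasDerivAt_iff_isLittleO]
    have h1 : (fun y : ℝ => (max y 0) ^ 2) =O[𝓝 0] fun y : ℝ => y ^ 2 := by
      refine Asymptotics.IsBigO.of_bound 1 (Eventually.of_forall fun y => ?_)
      rw [Real.norm_of_nonneg (by positivity), Real.norm_of_nonneg (by positivity), one_mul]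
      rcases le_total y 0 with h | h
      · simp [max_eq_right h]; positivity
      · simp [max_eq_left h]
    have h2 : (fun y : ℝ => y ^ 2) =o[𝓝 0] fun y : ℝ => y := by
      simpa using Asymptotics.isLittleO_pow_id (𝕜 := ℝ) one_lt_two
    simpa using h1.trans_isLittleO h2
  · have h : (fun x : ℝ => (max x 0) ^ 2) =ᶠ[𝓝 x] fun x => x ^ 2 := by
      filter_upwards [lt_mem_nhds hx] with y hy
      rw [max_eq_left hy.le]
    rw [max_eq_left hx.le]
    simpa using (hasDerivAt_pow 2 x).congr_of_eventuallyEq h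

/-- The positive part is squared in the cut-off because this makes it C¹, which is enough for
integration by parts. -/
theorem contDiff_max_zero_sq : ContDiff ℝ 1 (fun x : ℝ => (max x 0) ^ 2) := by
  rw [contDiff_one_iff_deriv]
  refine ⟨fun x => (hasDerivAt_max_zero_sq x).differentiableAt, ?_⟩
  rw [funext fun x => (hasDerivAt_max_zero_sq x).deriv]
  fun_prop

/-- Integration by parts against the constant 1. Applied to the directions 1 and i it says that the
integral of ∂̄H vanishes. -/
theorem integral_fderiv_apply_eq_zero {H : ℂ → ℂ} (hH : ContDiff ℝ 1 H)
    (hc : HasCompactSupport H) (v : ℂ) :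
    Integrable (fun w => fderiv ℝ H w v) ∧ ∫ w, fderiv ℝ H w v = 0 := by
  have hi : Integrable (fun w => fderiv ℝ H w v) :=
    (((hH.continuous_fderiv one_ne_zero).clm_apply continuous_const).integrable_of_hasCompactSupport
      (hc.fderiv_apply ℝ v))
  refine ⟨hi, ?_⟩
  have := integral_smul_fderiv_eq_neg_fderiv_smul_of_integrable (𝕜 := ℝ) (μ := (volume : Measure ℂ))
    (f := fun _ : ℂ => (1 : ℝ)) (g := H) (v := v) (by simp) (by simpa using hi)
    (by simpa using hH.continuous.integrable_of_hasCompactSupport hc)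
    (by fun_prop) (fun x _ => hH.differentiable one_ne_zero x)
  simpa using this

/-- The radial profile of the test function in the monotonicity estimate. -/
noncomputable def monotonicityProfile (R ε s : ℝ) : ℝ := (max (1 - s / R ^ 2) 0) ^ 2 / (s + ε)

theorem hasDerivAt_monotonicityProfile {R ε s : ℝ} (hs : s + ε ≠ 0) :
    HasDerivAt (monotonicityProfile R ε)
      (-(2 * max (1 - s / R ^ 2) 0 / R ^ 2) / (s + ε) -
        (max (1 - s / R ^ 2) 0) ^ 2 / (s + ε) ^ 2) s := by
  have h1 : HasDerivAt (fun s : ℝ => 1 - s / R ^ 2) (-(1 / R ^ 2)) s := by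
    simpa using ((hasDerivAt_id s).div_const (R ^ 2)).const_sub 1
  have h2 := (hasDerivAt_max_zero_sq (1 - s / R ^ 2)).comp s h1
  have h3 := h2.div ((hasDerivAt_id s).add_const ε) hs
  refine h3.congr_deriv ?_
  simp only [Function.comp_apply, id]
  field_simp

/-- The profile ψ is decreasing, so the coefficient of `x` is non-positive and `x` may be replaced
by `s * y`. With `a` the cut-off factor, sψ' + ψ equals `a² ε / (s + ε)²` minus `2 / R²` times `s a
/ (s + ε)`, and this last quotient is at most 1. -/
theorem monotonicityProfile_add_mul_deriv_ge {R ε s : ℝ} (hR : 0 < R) (hε : 0 < ε) (hs : 0 ≤ s)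
    {x y : ℝ} (hx : x ≤ s * y) (hy : 0 ≤ y) :
    ((max (1 - s / R ^ 2) 0) ^ 2 * ε / (s + ε) ^ 2 - 2 / R ^ 2) * y ≤
      (-(2 * max (1 - s / R ^ 2) 0 / R ^ 2) / (s + ε) -
        (max (1 - s / R ^ 2) 0) ^ 2 / (s + ε) ^ 2) * x + monotonicityProfile R ε s * y := by
  unfold monotonicityProfile
  set a := max (1 - s / R ^ 2) 0 with ha
  have ha0 : 0 ≤ a := le_max_right _ _
  have ha1 : a ≤ 1 := max_le (by have : 0 ≤ s / R ^ 2 := by positivity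
                                 linarith) zero_le_one
  have hneg : -(2 * a / R ^ 2) / (s + ε) - a ^ 2 / (s + ε) ^ 2 ≤ 0 := by
    have h1 : 0 ≤ 2 * a / R ^ 2 / (s + ε) := by positivity
    have h2 : 0 ≤ a ^ 2 / (s + ε) ^ 2 := by positivity
    rw [neg_div]
    linarith
  have h1 := mul_le_mul_of_nonpos_left hx hneg
  refine le_trans ?_ (add_le_add_left h1 _)
  have h2 : s * a / (s + ε) ≤ 1 := by
    rw [div_le_one (by positivity)]
    nlinarith
  have h3 : (-(2 * a / R ^ 2) / (s + ε) - a ^ 2 / (s + ε) ^ 2) * (s * y) + a ^ 2 / (s + ε) * y =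
      (a ^ 2 * ε / (s + ε) ^ 2 - 2 / R ^ 2 * (s * a / (s + ε))) * y := by
    field_simp
    ring
  rw [h3]
  gcongr
  have : 0 ≤ 2 / R ^ 2 := by positivity
  nlinarith

/-- With s = ‖G - q‖² the inner product is ∂s/∂w, so the field is ψ(s) ∂s. Its ∂̄-derivative is ψ'
|∂s|² + ψ ∂∂̄s, where ∂∂̄s = ‖G'‖² because `G` is holomorphic. The combination `I * L 1 - L I` is 2i
∂̄. -/
theorem dbar_smul_inner_deriv {n : ℕ} {G : ℂ → CSpace n} {q : CSpace n} {w : ℂ}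
    (hG : DifferentiableAt ℂ G w) (hG' : DifferentiableAt ℂ (deriv G) w) {ψ : ℝ → ℝ} {ψ' : ℝ}
    (hψ : HasDerivAt ψ ψ' (‖G w - q‖ ^ 2)) :
    ∃ L : ℂ →L[ℝ] ℂ,
      HasFDerivAt (fun w => ψ (‖G w - q‖ ^ 2) • (inner ℂ (G w - q) (deriv G w) : ℂ)) L w ∧
      Complex.I * L 1 - L Complex.I =
        2 * Complex.I * ((ψ' * ‖(inner ℂ (G w - q) (deriv G w) : ℂ)‖ ^ 2 +
          ψ (‖G w - q‖ ^ 2) * ‖deriv G w‖ ^ 2 : ℝ) : ℂ) := by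
  have hG1 : HasFDerivAt (fun x => G x - q) ((ContinuousLinearMap.toSpanSingleton ℂ
      (deriv G w)).restrictScalars ℝ) w :=
    (hG.hasDerivAt.hasFDerivAt.restrictScalars ℝ).sub_const q
  have hG2 : HasFDerivAt (deriv G) ((ContinuousLinearMap.toSpanSingleton ℂ
      (deriv (deriv G) w)).restrictScalars ℝ) w :=
    hG'.hasDerivAt.hasFDerivAt.restrictScalars ℝ
  have hpD := hG1.inner ℂ hG2
  have hsD := (Complex.reCLM.hasFDerivAt (x := inner ℂ (G w - q) (G w - q))).comp w
    (hG1.inner ℂ hG1)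
  have hsD' := hsD.congr_of_eventuallyEq (f₁ := fun y => ‖G y - q‖ ^ 2)
    (Eventually.of_forall fun y => norm_sq_eq_re_inner (𝕜 := ℂ) (G y - q))
  have hD := (hψ.comp_hasFDerivAt w hsD').smul hpD
  refine ⟨_, hD, ?_⟩
  have hself : inner ℂ (deriv G w) (deriv G w) = ((‖deriv G w‖ ^ 2 : ℝ) : ℂ) := by
    rw [inner_self_eq_norm_sq_to_K]; norm_cast
  have hpp : ((‖(inner ℂ (G w - q) (deriv G w) : ℂ)‖ ^ 2 : ℝ) : ℂ) =
      inner ℂ (G w - q) (deriv G w) * starRingEnd ℂ (inner ℂ (G w - q) (deriv G w)) := by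
    rw [Complex.mul_conj, Complex.normSq_eq_norm_sq]
  have hconj : inner ℂ (deriv G w) (G w - q) = starRingEnd ℂ (inner ℂ (G w - q) (deriv G w)) :=
    (inner_conj_symm _ _).symm
  simp only [_root_.add_apply, _root_.smul_apply, ContinuousLinearMap.smulRight_apply,
    ContinuousLinearMap.comp_apply, fderivInnerCLM_apply, ContinuousLinearMap.prod_apply,
    ContinuousLinearMap.coe_restrictScalars', ContinuousLinearMap.toSpanSingleton_apply,
    inner_smul_left, inner_smul_right, hself, hconj, Function.comp_apply,
    Complex.reCLM_apply, Complex.ofReal_add, Complex.ofReal_mul, hpp]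
  generalize (inner ℂ (G w - q) (deriv G w) : ℂ) = P
  generalize (inner ℂ (G w - q) (deriv (deriv G) w) : ℂ) = Q
  generalize ψ (‖G w - q‖ ^ 2) = ψ₀
  generalize ‖deriv G w‖ ^ 2 = A
  apply Complex.ext <;> simp <;> ring

/-- If a holomorphic curve `G` passes through `G w₀` and is closed in the ball of radius `R`
around `G w₀`, its area is at least a universal multiple of `R²`. -/
theorem area_lower_bound {n : ℕ} {Ω : Set ℂ} (hΩ : IsOpen Ω) {G : ℂ → CSpace n}
    (hG : DifferentiableOn ℂ G Ω) {w₀ : ℂ} (hw₀ : w₀ ∈ Ω) (hd : deriv G w₀ ≠ 0) {R : ℝ}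
    (hR : 0 < R) (hK : IsCompact {w | w ∈ Ω ∧ ‖G w - G w₀‖ ≤ R}) :
    ENNReal.ofReal (R ^ 2 / 200) ≤ ∫⁻ w in Ω, ENNReal.ofReal (‖deriv G w‖ ^ 2) := by
  classical
  set q := G w₀ with hq
  set K := {w | w ∈ Ω ∧ ‖G w - q‖ ≤ R} with hKdef
  have hKΩ : K ⊆ Ω := fun w hw => hw.1
  have han : AnalyticOnNhd ℂ G Ω := hG.analyticOnNhd hΩ
  have hdan : AnalyticOnNhd ℂ (deriv G) Ω := han.deriv
  have hdc : ContinuousOn (deriv G) Ω := hdan.continuousOn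
  set b := ‖deriv G w₀‖ with hb
  have hbpos : 0 < b := norm_pos_iff.2 hd
  -- the behaviour near `w₀`
  obtain ⟨σ, hσ, hσΩ, hσs, hσd, hσR⟩ : ∃ σ > 0, ball w₀ σ ⊆ Ω ∧
      (∀ w ∈ ball w₀ σ, ‖G w - q‖ ≤ 2 * b * σ) ∧ (∀ w ∈ ball w₀ σ, b / 2 ≤ ‖deriv G w‖) ∧
      2 * b * σ ≤ R / 2 := by
    have h1 : ∀ᶠ w in 𝓝 w₀, ‖G w - q‖ ≤ 2 * b * ‖w - w₀‖ := by
      have hda : HasDerivAt G (deriv G w₀) w₀ :=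
        (hG.differentiableAt (hΩ.mem_nhds hw₀)).hasDerivAt
      have := (hasDerivAt_iff_isLittleO.1 hda).bound hbpos
      filter_upwards [this] with w hw
      have h2 : ‖(w - w₀) • deriv G w₀‖ = b * ‖w - w₀‖ := by rw [norm_smul, mul_comm]
      calc ‖G w - q‖ = ‖(G w - G w₀ - (w - w₀) • deriv G w₀) + (w - w₀) • deriv G w₀‖ := by
            rw [hq]; congr 1; abel
        _ ≤ b * ‖w - w₀‖ + b * ‖w - w₀‖ := (norm_add_le _ _).trans (add_le_add hw h2.le)
        _ = _ := by ring
    have h2 : ∀ᶠ w in 𝓝 w₀, b / 2 ≤ ‖deriv G w‖ := by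
      have := (hdc.continuousAt (hΩ.mem_nhds hw₀)).norm
      exact (this.eventually (lt_mem_nhds (show b / 2 < b by linarith))).mono fun w hw => hw.le
    obtain ⟨ρ, hρ, h⟩ := Metric.eventually_nhds_iff_ball.1
      ((h1.and h2).and (hΩ.mem_nhds hw₀))
    refine ⟨min ρ (R / (4 * b)), by positivity, fun w hw =>
      (h w (ball_subset_ball (min_le_left _ _) hw)).2, fun w hw => ?_, fun w hw =>
      (h w (ball_subset_ball (min_le_left _ _) hw)).1.2, ?_⟩
    · refine (h w (ball_subset_ball (min_le_left _ _) hw)).1.1.trans ?_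
      have := (mem_ball_iff_norm.1 hw).le
      gcongr
    · calc 2 * b * min ρ (R / (4 * b)) ≤ 2 * b * (R / (4 * b)) := by
            gcongr; exact min_le_right _ _
        _ = R / 2 := by field_simp; ring
  -- This regularises 1/s at the size that s has on the disc of radius `σ`, where s ≤ 4ε. The main
  -- term is then at least 1/(200σ²) on that disc, and its integral π/200 no longer depends on `σ`.
  set ε := b ^ 2 * σ ^ 2 with hε
  have hεpos : 0 < ε := by positivity
  let s : ℂ → ℝ := fun w => ‖G w - q‖ ^ 2
  let p : ℂ → ℂ := fun w => inner ℂ (G w - q) (deriv G w)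
  -- The cut-off vanishes where ‖G - q‖ ≥ R, so the field is supported in `K`. Compactness of `K`
  -- inside `Ω` makes its extension by zero C¹ on all of ℂ.
  let H : ℂ → ℂ := fun w =>
    if w ∈ Ω then (monotonicityProfile R ε (s w)) • p w else 0
  have hs0 : ∀ w, 0 ≤ s w := fun w => by positivity
  have hHK : ∀ w, w ∉ K → H w = 0 := by
    intro w hw
    by_cases hwΩ : w ∈ Ω
    · have h1 : R < ‖G w - q‖ := by
        by_contra hcon
        exact hw ⟨hwΩ, not_lt.1 hcon⟩
      have h2 : 1 - s w / R ^ 2 ≤ 0 := by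
        have : 1 ≤ s w / R ^ 2 := by
          rw [one_le_div (by positivity)]
          exact pow_le_pow_left₀ hR.le h1.le 2
        linarith
      simp [H, hwΩ, monotonicityProfile, max_eq_right h2]
    · simp [H, hwΩ]
  have hcs : HasCompactSupport H := HasCompactSupport.intro hK hHK
  -- `H` is differentiable
  have hGR : ContDiffOn ℝ 1 G Ω := (han.contDiffOn hΩ.uniqueDiffOn).restrict_scalars ℝ
  have hdGR : ContDiffOn ℝ 1 (deriv G) Ω := (hdan.contDiffOn hΩ.uniqueDiffOn).restrict_scalars ℝ
  have hsC : ContDiffOn ℝ 1 s Ω := (hGR.sub contDiffOn_const).norm_sq ℂ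
  have hpC : ContDiffOn ℝ 1 p Ω := (hGR.sub contDiffOn_const).inner ℂ hdGR
  have hψ : ContDiffOn ℝ 1 (fun w => monotonicityProfile R ε (s w)) Ω := by
    refine ContDiffOn.div ?_ (hsC.add contDiffOn_const) (fun w _ => by have := hs0 w; positivity)
    exact contDiff_max_zero_sq.comp_contDiffOn (contDiffOn_const.sub (hsC.div_const _))
  have hHΩ : ∀ w ∈ Ω, H =ᶠ[𝓝 w] fun w => (monotonicityProfile R ε (s w)) • p w := by
    intro w hw
    filter_upwards [hΩ.mem_nhds hw] with y hy
    simp [H, hy]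
  have hHK' : ∀ w, w ∉ Ω → H =ᶠ[𝓝 w] fun _ => 0 := by
    intro w hw
    filter_upwards [hK.isClosed.isOpen_compl.mem_nhds (fun h => hw (hKΩ h))] with y hy
    exact hHK y hy
  have hHC : ContDiff ℝ 1 H := by
    rw [contDiff_iff_contDiffAt]
    intro w
    by_cases hw : w ∈ Ω
    · exact ((hψ.smul hpC).contDiffAt (hΩ.mem_nhds hw)).congr_of_eventuallyEq (hHΩ w hw)
    · exact contDiffAt_const.congr_of_eventuallyEq (hHK' w hw)
  let D : ℂ → ℝ := fun w => if w ∈ Ω then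
    (-(2 * max (1 - s w / R ^ 2) 0 / R ^ 2) / (s w + ε) -
        (max (1 - s w / R ^ 2) 0) ^ 2 / (s w + ε) ^ 2) * ‖p w‖ ^ 2 +
      monotonicityProfile R ε (s w) * ‖deriv G w‖ ^ 2 else 0
  have hDbar : ∀ w, Complex.I * fderiv ℝ H w 1 - fderiv ℝ H w Complex.I =
      2 * Complex.I * (D w : ℂ) := by
    intro w
    by_cases hw : w ∈ Ω
    · obtain ⟨L, hL, hLe⟩ := dbar_smul_inner_deriv (q := q)
        (hG.differentiableAt (hΩ.mem_nhds hw)) (hdan w hw).differentiableAt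
        (hasDerivAt_monotonicityProfile (R := R) (ε := ε) (s := s w)
          (by have := hs0 w; positivity))
      rw [(hL.congr_of_eventuallyEq (hHΩ w hw)).fderiv, hLe]
      simp only [D, hw, if_true]
      rfl
    · rw [(hHK' w hw).fderiv_eq]
      simp [D, hw]
  -- Stokes' theorem for the compactly supported field `H`; `D` is its ∂̄-derivative.
  have hint0 : Integrable D ∧ ∫ w, D w = 0 := by
    obtain ⟨i1, e1⟩ := integral_fderiv_apply_eq_zero hHC hcs 1
    obtain ⟨i2, e2⟩ := integral_fderiv_apply_eq_zero hHC hcs Complex.I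
    have hi : Integrable (fun w => 2 * Complex.I * (D w : ℂ)) := by
      simp only [← hDbar]
      exact (i1.const_mul _).sub i2
    have hz : ∫ w, 2 * Complex.I * (D w : ℂ) = 0 := by
      simp only [← hDbar]
      rw [integral_sub (i1.const_mul _) i2, integral_const_mul, e1, e2]
      simp
    have h2I : (2 * Complex.I : ℂ) ≠ 0 := by simp
    have hi' : Integrable (fun w => (D w : ℂ)) := by
      have := hi.const_mul (2 * Complex.I)⁻¹
      simpa [← mul_assoc, h2I] using this
    rw [integral_const_mul, mul_eq_zero, or_iff_right h2I, integral_complex_ofReal] at hz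
    exact ⟨by simpa using hi'.re, by exact_mod_cast hz⟩
  -- the pointwise lower bound
  have hKm : MeasurableSet K := hK.measurableSet
  have hAint : IntegrableOn (fun w => ‖deriv G w‖ ^ 2) K :=
    ((hdc.mono hKΩ).norm.pow 2).integrableOn_compact hK
  have hlow : ∀ w, (ball w₀ σ).indicator (fun _ => 1 / (200 * σ ^ 2)) w -
      K.indicator (fun w => 2 / R ^ 2 * ‖deriv G w‖ ^ 2) w ≤ D w := by
    intro w
    by_cases hwK : w ∈ K
    · have hw : w ∈ Ω := hKΩ hwK
      have hp : ‖p w‖ ^ 2 ≤ s w * ‖deriv G w‖ ^ 2 := by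
        rw [← mul_pow]
        exact pow_le_pow_left₀ (norm_nonneg _) (norm_inner_le_norm _ _) 2
      have hge := monotonicityProfile_add_mul_deriv_ge hR hεpos (hs0 w) hp
        (by positivity : 0 ≤ ‖deriv G w‖ ^ 2)
      simp only [D, hw, if_true]
      refine le_trans ?_ hge
      rw [indicator_of_mem hwK, sub_mul]
      gcongr
      by_cases hwb : w ∈ ball w₀ σ
      · rw [indicator_of_mem hwb]
        have h1 : s w ≤ 4 * ε := by
          calc s w ≤ (2 * b * σ) ^ 2 := pow_le_pow_left₀ (norm_nonneg _) (hσs w hwb) 2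
            _ = 4 * ε := by rw [hε]; ring
        have h2 : s w ≤ R ^ 2 / 4 := by
          calc s w ≤ (2 * b * σ) ^ 2 := pow_le_pow_left₀ (norm_nonneg _) (hσs w hwb) 2
            _ ≤ (R / 2) ^ 2 := pow_le_pow_left₀ (by positivity) hσR 2
            _ = R ^ 2 / 4 := by ring
        have h3 : 3 / 4 ≤ max (1 - s w / R ^ 2) 0 := by
          refine le_max_of_le_left ?_
          have : s w / R ^ 2 ≤ 1 / 4 := by
            rw [div_le_iff₀ (by positivity)]; linarith
          linarith
        have h4 : (1 / 2 : ℝ) ≤ (max (1 - s w / R ^ 2) 0) ^ 2 := by nlinarith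
        have h5 : b ^ 2 / 4 ≤ ‖deriv G w‖ ^ 2 := by
          calc b ^ 2 / 4 = (b / 2) ^ 2 := by ring
            _ ≤ _ := pow_le_pow_left₀ (by positivity) (hσd w hwb) 2
        have hsw := hs0 w
        -- The factor 1/2 bounds the squared cut-off from below, 5ε bounds s + ε from above, and
        -- b²/4 bounds ‖G'‖² from below.
        calc 1 / (200 * σ ^ 2) = 1 / 2 * ε / (4 * ε + ε) ^ 2 * (b ^ 2 / 4) := by
              rw [hε]; field_simp; norm_num
          _ ≤ (max (1 - s w / R ^ 2) 0) ^ 2 * ε / (s w + ε) ^ 2 * ‖deriv G w‖ ^ 2 := by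
              gcongr
      · rw [indicator_of_notMem hwb]
        have hsw := hs0 w
        positivity
    · have hwb : w ∉ ball w₀ σ := by
        intro hwb
        exact hwK ⟨hσΩ hwb, (hσs w hwb).trans (by linarith)⟩
      rw [indicator_of_notMem hwK, indicator_of_notMem hwb, sub_zero]
      by_cases hw : w ∈ Ω
      · have h1 : R < ‖G w - q‖ := by
          by_contra hcon
          exact hwK ⟨hw, not_lt.1 hcon⟩
        have h2 : 1 - s w / R ^ 2 ≤ 0 := by
          have : 1 ≤ s w / R ^ 2 := by
            rw [one_le_div (by positivity)]
            exact pow_le_pow_left₀ hR.le h1.le 2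
          linarith
        simp [D, hw, monotonicityProfile, max_eq_right h2]
      · simp [D, hw]
  have hi1 : Integrable ((ball w₀ σ).indicator (fun _ => 1 / (200 * σ ^ 2) : ℂ → ℝ)) :=
    (integrable_indicator_iff measurableSet_ball).2 (integrableOn_const measure_ball_lt_top.ne)
  have hi2 : Integrable (K.indicator (fun w => 2 / R ^ 2 * ‖deriv G w‖ ^ 2)) :=
    (integrable_indicator_iff hKm).2 (hAint.const_mul _)
  have hle := integral_mono (hi1.sub hi2) hint0.1 hlow
  simp only [Pi.sub_apply] at hle
  rw [hint0.2, integral_sub hi1 hi2, integral_indicator measurableSet_ball,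
    integral_indicator hKm, setIntegral_const, integral_const_mul] at hle
  have hvol : (volume : Measure ℂ).real (ball w₀ σ) = Real.pi * σ ^ 2 := by
    rw [Measure.real, Complex.volume_ball]
    simp [mul_comm, hσ.le, ← NNReal.coe_real_pi]
  rw [hvol, smul_eq_mul] at hle
  have hfin : R ^ 2 / 200 ≤ ∫ w in K, ‖deriv G w‖ ^ 2 := by
    set J := ∫ w in K, ‖deriv G w‖ ^ 2
    have h1 : Real.pi * σ ^ 2 * (1 / (200 * σ ^ 2)) = Real.pi / 200 := by field_simp
    rw [h1] at hle
    have h2 : Real.pi / 200 ≤ 2 / R ^ 2 * J := by linarith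
    have h3 : Real.pi / 200 * R ^ 2 ≤ 2 * J := by
      calc Real.pi / 200 * R ^ 2 ≤ 2 / R ^ 2 * J * R ^ 2 := by gcongr
        _ = 2 * J := by field_simp
    nlinarith [Real.pi_gt_three, sq_nonneg R]
  calc ENNReal.ofReal (R ^ 2 / 200) ≤ ENNReal.ofReal (∫ w in K, ‖deriv G w‖ ^ 2) :=
        ENNReal.ofReal_le_ofReal hfin
    _ = ∫⁻ w in K, ENNReal.ofReal (‖deriv G w‖ ^ 2) :=
        ofReal_integral_eq_lintegral_ofReal hAint (Eventually.of_forall fun w => by positivity)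
    _ ≤ _ := lintegral_mono_set hKΩ

end Monotonicity

/-! ### The metric and differentials read in a chart -/

section Charts

variable {n : ℕ} {X : Type*} [TopologicalSpace X] [ChartedSpace (CSpace n) X]

/-- The square of the length of a tangent vector. -/
noncomputable def HermitianMetric.normSq (h : HermitianMetric n X) (x : X) (v : CSpace n) : ℝ :=
  (h.form x v v).re

theorem HermitianMetric.normSq_nonneg (h : HermitianMetric n X) (x : X) (v : CSpace n) :
    0 ≤ h.normSq x v := by
  by_cases hv : v = 0
  · subst hv
    exact (congrArg Complex.re (LinearMap.map_zero (h.form x 0))).ge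
  · exact (h.pos x v hv).le

/-- `coordVector` as a linear map between coordinate spaces. -/
noncomputable def coordMap (x₀ : X) (y : CSpace n) : CSpace n →L[ℂ] CSpace n :=
  mfderiv 𝓘(ℂ, CSpace n) 𝓘(ℂ, CSpace n) (chartAt (CSpace n) x₀).symm y

/-- The Gram matrix of the metric in a chart. -/
noncomputable def HermitianMetric.gram (h : HermitianMetric n X) (x₀ : X) (y : CSpace n)
    (j k : Fin n) : ℂ :=
  h.form ((chartAt (CSpace n) x₀).symm y)
    (coordVector n X x₀ y (EuclideanSpace.single j 1))
    (coordVector n X x₀ y (EuclideanSpace.single k 1))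

theorem euclidean_eq_sum_single {m : ℕ} (v : CSpace m) :
    v = ∑ j, v j • EuclideanSpace.single j (1 : ℂ) := by
  ext i
  simp [Pi.single_apply]

theorem HermitianMetric.normSq_coordMap (h : HermitianMetric n X) (x₀ : X) (y v : CSpace n) :
    h.normSq ((chartAt (CSpace n) x₀).symm y) (coordMap x₀ y v) =
      (∑ j, ∑ k, starRingEnd ℂ (v j) * v k * h.gram x₀ y j k).re := by
  have key : ∀ (B : CSpace n →ₗ⋆[ℂ] CSpace n →ₗ[ℂ] ℂ) (L : CSpace n →L[ℂ] CSpace n),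
      B (L v) (L v) = ∑ j, ∑ k, starRingEnd ℂ (v j) * v k *
        B (L (EuclideanSpace.single j 1)) (L (EuclideanSpace.single k 1)) := by
    intro B L
    conv_lhs => rw [euclidean_eq_sum_single v]
    simp only [map_sum, map_smul, LinearMap.map_smulₛₗ, LinearMap.sum_apply, LinearMap.smul_apply,
      smul_eq_mul, Finset.mul_sum, mul_assoc, mul_left_comm]
    rw [Finset.sum_comm]
  exact congrArg Complex.re (key (h.form ((chartAt (CSpace n) x₀).symm y)) (coordMap x₀ y))

theorem HermitianMetric.continuousOn_normSq_coordMap (h : HermitianMetric n X) (x₀ : X) :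
    ContinuousOn (fun p : CSpace n × CSpace n =>
      h.normSq ((chartAt (CSpace n) x₀).symm p.1) (coordMap x₀ p.1 p.2))
      ((chartAt (CSpace n) x₀).target ×ˢ univ) := by
  simp only [h.normSq_coordMap]
  refine Complex.continuous_re.comp_continuousOn ?_
  refine continuousOn_finsetSum _ fun j _ => continuousOn_finsetSum _ fun k _ => ?_
  refine ContinuousOn.mul ?_ ?_
  · fun_prop
  · exact (h.smooth x₀ _ _).continuousOn.comp continuousOn_fst fun p hp => hp.1

variable [IsManifold 𝓘(ℂ, CSpace n) ω X]

theorem mdifferentiable_chartAt_complex (x₀ : X) :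
    (chartAt (CSpace n) x₀).MDifferentiable 𝓘(ℂ, CSpace n) 𝓘(ℂ, CSpace n) := by
  have : IsManifold 𝓘(ℂ, CSpace n) 1 X := IsManifold.of_le (n := ω) le_top
  exact mdifferentiable_chart x₀

theorem coordMap_bijective (x₀ : X) {y : CSpace n} (hy : y ∈ (chartAt (CSpace n) x₀).target) :
    Function.Bijective (coordMap x₀ y) :=
  (mdifferentiable_chartAt_complex x₀).symm.mfderiv_bijective hy

/-- The minimum over the compact set `K ×ˢ sphere 0 1` is positive, since the chart frame is
injective; homogeneity of degree 2 extends the bound to all vectors. -/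
theorem HermitianMetric.exists_normSq_coordMap_ge (h : HermitianMetric n X) (x₀ : X)
    {K : Set (CSpace n)} (hK : IsCompact K) (hKt : K ⊆ (chartAt (CSpace n) x₀).target) :
    ∃ c > 0, ∀ y ∈ K, ∀ v,
      c * ‖v‖ ^ 2 ≤ h.normSq ((chartAt (CSpace n) x₀).symm y) (coordMap x₀ y v) := by
  have hcomp : IsCompact (K ×ˢ sphere (0 : CSpace n) 1) := hK.prod (isCompact_sphere 0 1)
  have hcont := (h.continuousOn_normSq_coordMap x₀).mono
    (prod_mono hKt (subset_univ (sphere (0 : CSpace n) 1)))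
  have hpos : ∀ p ∈ K ×ˢ sphere (0 : CSpace n) 1,
      0 < h.normSq ((chartAt (CSpace n) x₀).symm p.1) (coordMap x₀ p.1 p.2) := by
    rintro ⟨y, v⟩ ⟨hy, hv⟩
    refine h.pos _ _ fun h0 => ?_
    have h0' : coordMap x₀ y v = coordMap x₀ y 0 := by rw [map_zero]; exact h0
    have : v = 0 := (coordMap_bijective x₀ (hKt hy)).1 h0'
    rw [this] at hv
    simp at hv
  obtain ⟨c, hc, hcle⟩ : ∃ c > 0, ∀ p ∈ K ×ˢ sphere (0 : CSpace n) 1,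
      c ≤ h.normSq ((chartAt (CSpace n) x₀).symm p.1) (coordMap x₀ p.1 p.2) := by
    rcases (K ×ˢ sphere (0 : CSpace n) 1).eq_empty_or_nonempty with he | hne
    · exact ⟨1, one_pos, by simp [he]⟩
    · obtain ⟨p, hp, hmin⟩ := hcomp.exists_isMinOn hne hcont
      exact ⟨_, hpos p hp, fun p' hp' => hmin hp'⟩
  refine ⟨c, hc, fun y hy v => ?_⟩
  by_cases hv : v = 0
  · subst hv
    simpa using h.normSq_nonneg _ _
  have hv' : ‖v‖ ≠ 0 := norm_ne_zero_iff.2 hv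
  set u : CSpace n := ((‖v‖⁻¹ : ℝ) : ℂ) • v with hu
  have hun : u ∈ sphere (0 : CSpace n) 1 := by
    simp [hu, norm_smul, hv']
  have hvu : v = ((‖v‖ : ℝ) : ℂ) • u := by
    rw [hu, smul_smul, ← Complex.ofReal_mul, mul_inv_cancel₀ hv', Complex.ofReal_one, one_smul]
  have h1 := hcle (y, u) ⟨hy, hun⟩
  have h2 : h.normSq ((chartAt (CSpace n) x₀).symm y) (coordMap x₀ y v) =
      ‖v‖ ^ 2 * h.normSq ((chartAt (CSpace n) x₀).symm y) (coordMap x₀ y u) := by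
    rw [h.normSq_coordMap, h.normSq_coordMap]
    conv_lhs => rw [hvu]
    rw [← Complex.re_ofReal_mul, Finset.mul_sum]
    simp only [Finset.mul_sum]
    congr 1
    refine Finset.sum_congr rfl fun j _ => Finset.sum_congr rfl fun k _ => ?_
    simp
    ring
  rw [h2, mul_comm]
  gcongr

variable {E : Type*} [NormedAddCommGroup E] [NormedSpace ℂ E]

theorem MDifferentiableAt.differentiableAt_chart_comp {F : E → X} {w : E} {x₀ : X}
    (hF : MDifferentiableAt 𝓘(ℂ, E) 𝓘(ℂ, CSpace n) F w)
    (hw : F w ∈ (chartAt (CSpace n) x₀).source) :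
    DifferentiableAt ℂ (fun w => chartAt (CSpace n) x₀ (F w)) w :=
  (((mdifferentiable_chartAt_complex x₀).mdifferentiableAt hw).comp w hF).differentiableAt

/-- The chain rule for F = φ⁻¹ ∘ (φ ∘ F). It turns statements about the differential of a map into
`X` into statements about a map between vector spaces. -/
theorem mfderiv_eq_coordMap {F : E → X} {w : E} {x₀ : X}
    (hF : MDifferentiableAt 𝓘(ℂ, E) 𝓘(ℂ, CSpace n) F w)
    (hw : F w ∈ (chartAt (CSpace n) x₀).source) (v : E) :
    mfderiv 𝓘(ℂ, E) 𝓘(ℂ, CSpace n) F w v =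
      coordMap x₀ (chartAt (CSpace n) x₀ (F w))
        (fderiv ℂ (fun w => chartAt (CSpace n) x₀ (F w)) w v) := by
  have hev : F =ᶠ[𝓝 w] (chartAt (CSpace n) x₀).symm ∘
      (fun w => chartAt (CSpace n) x₀ (F w)) := by
    filter_upwards [hF.continuousAt.preimage_mem_nhds
      ((chartAt (CSpace n) x₀).open_source.mem_nhds hw)] with w' hw'
    exact ((chartAt (CSpace n) x₀).left_inv hw').symm
  have hd := hF.differentiableAt_chart_comp hw
  have hm : MDifferentiableAt 𝓘(ℂ, CSpace n) 𝓘(ℂ, CSpace n) (chartAt (CSpace n) x₀).symm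
      (chartAt (CSpace n) x₀ (F w)) :=
    (mdifferentiable_chartAt_complex x₀).symm.mdifferentiableAt
      ((chartAt (CSpace n) x₀).map_source hw)
  rw [hev.mfderiv_eq]
  have h2 := mfderiv_comp (I := 𝓘(ℂ, E)) (I' := 𝓘(ℂ, CSpace n)) (I'' := 𝓘(ℂ, CSpace n)) w
    (f := fun w => chartAt (CSpace n) x₀ (F w)) hm hd.mdifferentiableAt
  rw [h2, mfderiv_eq_fderiv]
  rfl

theorem HermitianMetric.normSq_mfderiv (h : HermitianMetric n X) {F : E → X} {w : E} {x₀ : X}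
    (hF : MDifferentiableAt 𝓘(ℂ, E) 𝓘(ℂ, CSpace n) F w)
    (hw : F w ∈ (chartAt (CSpace n) x₀).source) (v : E) :
    h.normSq (F w) (mfderiv 𝓘(ℂ, E) 𝓘(ℂ, CSpace n) F w v) =
      h.normSq ((chartAt (CSpace n) x₀).symm (chartAt (CSpace n) x₀ (F w)))
        (coordMap x₀ (chartAt (CSpace n) x₀ (F w))
          (fderiv ℂ (fun w => chartAt (CSpace n) x₀ (F w)) w v)) := by
  rw [(chartAt (CSpace n) x₀).left_inv hw, mfderiv_eq_coordMap hF hw]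

theorem MDifferentiableOn.differentiableOn_chart_comp {F : E → X} {Ω : Set E} (hΩ : IsOpen Ω)
    (hF : MDifferentiableOn 𝓘(ℂ, E) 𝓘(ℂ, CSpace n) F Ω) (x₀ : X) :
    IsOpen (Ω ∩ F ⁻¹' (chartAt (CSpace n) x₀).source) ∧
    DifferentiableOn ℂ (fun w => chartAt (CSpace n) x₀ (F w))
      (Ω ∩ F ⁻¹' (chartAt (CSpace n) x₀).source) :=
  ⟨hF.continuousOn.isOpen_inter_preimage hΩ (chartAt (CSpace n) x₀).open_source,
    fun _ hw => ((hF.mdifferentiableAt (hΩ.mem_nhds hw.1)).differentiableAt_chart_comp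
      hw.2).differentiableWithinAt⟩

theorem HermitianMetric.continuousOn_normSq_mfderiv [FiniteDimensional ℂ E]
    (h : HermitianMetric n X) {F : E → X} {Ω : Set E} (hΩ : IsOpen Ω)
    (hF : MDifferentiableOn 𝓘(ℂ, E) 𝓘(ℂ, CSpace n) F Ω) (v : E) :
    ContinuousOn (fun w => h.normSq (F w) (mfderiv 𝓘(ℂ, E) 𝓘(ℂ, CSpace n) F w v)) Ω := by
  intro w hw
  set x₀ := F w
  obtain ⟨hO, hd⟩ := hF.differentiableOn_chart_comp hΩ x₀
  have hwO : w ∈ Ω ∩ F ⁻¹' (chartAt (CSpace n) x₀).source := ⟨hw, mem_chart_source _ _⟩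
  have hc : ContinuousOn (fun w => h.normSq ((chartAt (CSpace n) x₀).symm
      (chartAt (CSpace n) x₀ (F w))) (coordMap x₀ (chartAt (CSpace n) x₀ (F w))
          (fderiv ℂ (fun w => chartAt (CSpace n) x₀ (F w)) w v)))
      (Ω ∩ F ⁻¹' (chartAt (CSpace n) x₀).source) :=
    (h.continuousOn_normSq_coordMap x₀).comp
      (f := fun w => (chartAt (CSpace n) x₀ (F w),
        fderiv ℂ (fun w => chartAt (CSpace n) x₀ (F w)) w v))
      (hd.continuousOn.prodMk ((hd.continuousOn_fderiv_of_isOpen hO).clm_apply continuousOn_const))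
      (fun w hw => ⟨(chartAt (CSpace n) x₀).map_source hw.2, mem_univ _⟩)
  refine ((hc.continuousAt (hO.mem_nhds hwO)).congr ?_).continuousWithinAt
  filter_upwards [hO.mem_nhds hwO] with w' hw'
  exact (h.normSq_mfderiv (hF.mdifferentiableAt (hΩ.mem_nhds hw'.1)) hw'.2 v).symm

end Charts

/-! ### The length-area method -/

section CourantLebesgue

theorem lintegral_ofReal_div_Ioo_eq_top {κ r : ℝ} (hκ : 0 < κ) (hr : 0 < r) :
    ∫⁻ x in Ioo 0 r, ENNReal.ofReal (κ / x) = ⊤ := by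
  by_contra hcon
  have hm : Measurable (fun x : ℝ => κ / x) := measurable_const.div measurable_id
  have hi : IntegrableOn (fun x : ℝ => κ / x) (Ioo 0 r) := by
    refine ⟨hm.aestronglyMeasurable, ?_⟩
    rw [hasFiniteIntegral_iff_ofReal]
    · exact lt_top_iff_ne_top.2 hcon
    · refine (ae_restrict_iff' measurableSet_Ioo).2 (Eventually.of_forall fun x hx => ?_)
      exact (div_pos hκ hx.1).le
  have hi' : IntegrableOn (fun x : ℝ => x⁻¹) (Ioo 0 r) := by
    have := hi.const_mul κ⁻¹
    refine this.congr (Eventually.of_forall fun x => ?_)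
    simp only
    field_simp
  rw [← integrableOn_Ioc_iff_integrableOn_Ioo,
    ← intervalIntegrable_iff_integrableOn_Ioc_of_le hr.le, intervalIntegrable_inv_iff] at hi'
  rcases hi' with h | h
  · exact hr.ne h
  · exact h left_mem_uIcc

theorem ContinuousOn.measurable_indicator_ofReal {α : Type*} [TopologicalSpace α]
    [MeasurableSpace α] [OpensMeasurableSpace α] {q : α → ℝ} {s : Set α} (hq : ContinuousOn q s)
    (hs : MeasurableSet s) : Measurable (s.indicator fun x => ENNReal.ofReal (q x)) := by
  classical
  rw [← Set.piecewise_eq_indicator]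
  exact ContinuousOn.measurable_piecewise (ENNReal.continuous_ofReal.comp_continuousOn hq)
    continuousOn_const hs

/-- A conformal metric of finite area on a punctured disc has arbitrarily short circles around
the puncture. -/
theorem exists_short_circle {c : ℂ} {ρ : ℝ} {q : ℂ → ℝ}
    (hq0 : ∀ w, 0 ≤ q w) (hq : ContinuousOn q (ball c ρ \ {c}))
    (hfin : ∫⁻ w in ball c ρ \ {c}, ENNReal.ofReal (q w) ≠ ⊤) {r₁ ε : ℝ} (hr₁ : 0 < r₁)
    (hr₁ρ : r₁ ≤ ρ) (hε : 0 < ε) :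
    ∃ r ∈ Ioo 0 r₁, ∫⁻ θ in Ioo (-Real.pi) Real.pi,
      ENNReal.ofReal (r * √(q (circleMap c r θ))) < ENNReal.ofReal ε := by
  by_contra! hcon
  apply hfin
  have hms : MeasurableSet (ball c ρ \ {c}) := measurableSet_ball.diff (measurableSet_singleton c)
  set f : ℂ → ℝ≥0∞ := (ball c ρ \ {c}).indicator fun w => ENNReal.ofReal (q w) with hf
  have hfm : Measurable f := hq.measurable_indicator_ofReal hms
  -- Use x ≤ λ/2 + x²/(2λ) for the integrand x of the length. Over the angular range 2π the term λ/2
  -- contributes ε/2, so if every circle has length at least ε, the other half forces the angular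
  -- area integral to be at least ελ/r. This is not integrable at r = 0.
  set lam : ℝ := ε / (2 * Real.pi) with hlam
  have hlampos : 0 < lam := by positivity
  have hinner : ∀ r ∈ Ioo 0 r₁, ENNReal.ofReal (ε * lam / r) ≤
      ∫⁻ θ in Ioo (-Real.pi) Real.pi, ENNReal.ofReal r * ENNReal.ofReal (q (circleMap c r θ)) := by
    intro r hr
    have hr0 : 0 < r := hr.1
    have hpt : ∀ θ, ENNReal.ofReal (r * √(q (circleMap c r θ))) ≤
        ENNReal.ofReal (lam / 2) + ENNReal.ofReal (r / (2 * lam)) *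
          (ENNReal.ofReal r * ENNReal.ofReal (q (circleMap c r θ))) := by
      intro θ
      have hqθ := hq0 (circleMap c r θ)
      rw [← ENNReal.ofReal_mul hr0.le, ← ENNReal.ofReal_mul (by positivity),
        ← ENNReal.ofReal_add (by positivity) (by positivity)]
      apply ENNReal.ofReal_le_ofReal
      set x := r * √(q (circleMap c r θ)) with hx
      have hx2 : r / (2 * lam) * (r * q (circleMap c r θ)) = x ^ 2 / (2 * lam) := by
        rw [hx, mul_pow, Real.sq_sqrt hqθ]; ring
      rw [hx2, ← sub_nonneg]
      have : lam / 2 + x ^ 2 / (2 * lam) - x = (x - lam) ^ 2 / (2 * lam) := by field_simp; ring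
      rw [this]
      positivity
    have h1 := (hcon r hr).trans (lintegral_mono hpt)
    rw [lintegral_add_left measurable_const, lintegral_const_mul' _ _ ENNReal.ofReal_ne_top,
      lintegral_const, Measure.restrict_apply_univ, Real.volume_Ioo,
      ← ENNReal.ofReal_mul (by positivity)] at h1
    set J := ∫⁻ θ in Ioo (-Real.pi) Real.pi,
      ENNReal.ofReal r * ENNReal.ofReal (q (circleMap c r θ)) with hJ
    have h2 : lam / 2 * (Real.pi - -Real.pi) = ε / 2 := by
      rw [hlam]; field_simp; ring
    rw [h2] at h1
    have h3 : ENNReal.ofReal (ε / 2) ≤ ENNReal.ofReal (r / (2 * lam)) * J := by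
      have : ENNReal.ofReal ε = ENNReal.ofReal (ε / 2) + ENNReal.ofReal (ε / 2) := by
        rw [← ENNReal.ofReal_add (by positivity) (by positivity), add_halves]
      rw [this] at h1
      exact (ENNReal.add_le_add_iff_left ENNReal.ofReal_ne_top).1 h1
    have h4 : ENNReal.ofReal (ε * lam / r) =
        ENNReal.ofReal (2 * lam / r) * ENNReal.ofReal (ε / 2) := by
      rw [← ENNReal.ofReal_mul (by positivity)]
      congr 1
      ring
    have h5 : ENNReal.ofReal (2 * lam / r) * ENNReal.ofReal (r / (2 * lam)) = 1 := by
      rw [← ENNReal.ofReal_mul (by positivity)]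
      have : 2 * lam / r * (r / (2 * lam)) = 1 := by field_simp
      rw [this, ENNReal.ofReal_one]
    calc ENNReal.ofReal (ε * lam / r) ≤
          ENNReal.ofReal (2 * lam / r) * (ENNReal.ofReal (r / (2 * lam)) * J) := by
            rw [h4]; gcongr
      _ = J := by rw [← mul_assoc, h5, one_mul]
  have hpolar : ∫⁻ p in Ioi (0 : ℝ) ×ˢ Ioo (-Real.pi) Real.pi,
      ENNReal.ofReal p.1 * f (circleMap c p.1 p.2) =
      ∫⁻ w in ball c ρ \ {c}, ENNReal.ofReal (q w) := by
    rw [← lintegral_indicator hms, ← hf, ← lintegral_add_left_eq_self f c,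
      ← Complex.lintegral_comp_polarCoord_symm, polarCoord_target]
    refine lintegral_congr fun p => ?_
    rw [smul_eq_mul, Complex.polarCoord_symm_apply, circleMap, Complex.exp_mul_I]
    push_cast
    rfl
  rw [← hpolar, eq_top_iff, ← lintegral_ofReal_div_Ioo_eq_top (mul_pos hε hlampos) hr₁]
  have hmf : Measurable fun p : ℝ × ℝ => ENNReal.ofReal p.1 * f (circleMap c p.1 p.2) := by
    refine (ENNReal.measurable_ofReal.comp measurable_fst).mul (hfm.comp ?_)
    have : Continuous (fun p : ℝ × ℝ => circleMap c p.1 p.2) := by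
      unfold circleMap; fun_prop
    exact this.measurable
  calc ∫⁻ r in Ioo 0 r₁, ENNReal.ofReal (ε * lam / r)
      ≤ ∫⁻ r in Ioo 0 r₁, ∫⁻ θ in Ioo (-Real.pi) Real.pi,
          ENNReal.ofReal r * f (circleMap c r θ) := by
        refine setLIntegral_mono' measurableSet_Ioo fun r hr => (hinner r hr).trans ?_
        refine lintegral_mono fun θ => ?_
        have hmem : circleMap c r θ ∈ ball c ρ \ {c} := by
          refine ⟨?_, fun h => ?_⟩
          · rw [mem_ball_iff_norm, circleMap_sub_center, norm_circleMap_zero, abs_of_pos hr.1]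
            exact hr.2.trans_le hr₁ρ
          · exact hr.1.ne' (by simpa using h)
        simp only [hf, indicator_of_mem hmem]
        exact le_rfl
    _ = ∫⁻ p in Ioo 0 r₁ ×ˢ Ioo (-Real.pi) Real.pi,
          ENNReal.ofReal p.1 * f (circleMap c p.1 p.2) := by
        rw [Measure.volume_eq_prod, ← Measure.prod_restrict, lintegral_prod _ hmf.aemeasurable]
    _ ≤ _ := lintegral_mono_set (prod_mono Ioo_subset_Ioi_self le_rfl)

/-- The image of a connected strip under polar coordinates. The case `r₁ = 0` covers punctured
discs. -/
theorem isPreconnected_annulus (c : ℂ) {r₁ r₂ : ℝ} (hr₁ : 0 ≤ r₁) :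
    IsPreconnected {w : ℂ | r₁ < ‖w - c‖ ∧ ‖w - c‖ < r₂} := by
  have himg : {w : ℂ | r₁ < ‖w - c‖ ∧ ‖w - c‖ < r₂} =
      (fun p : ℝ × ℝ => circleMap c p.1 p.2) '' (Ioo r₁ r₂ ×ˢ univ) := by
    ext w
    constructor
    · rintro ⟨h1, h2⟩
      refine ⟨(‖w - c‖, Complex.arg (w - c)), ⟨⟨h1, h2⟩, mem_univ _⟩, ?_⟩
      simp [circleMap, Complex.norm_mul_exp_arg_mul_I]
    · rintro ⟨⟨r, θ⟩, ⟨hr, -⟩, rfl⟩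
      have hr' : r₁ < r ∧ r < r₂ := hr
      have : ‖circleMap c r θ - c‖ = r := by
        rw [circleMap_sub_center, norm_circleMap_zero, abs_of_pos (hr₁.trans_lt hr'.1)]
      change r₁ < ‖circleMap c r θ - c‖ ∧ ‖circleMap c r θ - c‖ < r₂
      rwa [this]
  rw [himg]
  refine IsPreconnected.image (isPreconnected_Ioo.prod isPreconnected_univ) _ ?_
  have : Continuous (fun p : ℝ × ℝ => circleMap c p.1 p.2) := by
    unfold circleMap; fun_prop
  exact this.continuousOn

end CourantLebesgue

/-! ### Removable singularities: short circles stay in a chart -/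

section Removable

variable {n : ℕ} {X : Type*} [TopologicalSpace X] [ChartedSpace (CSpace n) X]

theorem isOpen_source_inter_preimage_ball (x₀ : X) (y : CSpace n) (r : ℝ) :
    IsOpen ((chartAt (CSpace n) x₀).source ∩ chartAt (CSpace n) x₀ ⁻¹' ball y r) :=
  (chartAt (CSpace n) x₀).isOpen_inter_preimage isOpen_ball

/-- A compact image in a Hausdorff space. The point is closedness in `X` and not only in the chart
domain, so that a curve cannot leave the set through the edge of the chart. -/
theorem isClosed_source_inter_preimage_closedBall [T2Space X] (x₀ : X) {y : CSpace n} {r : ℝ}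
    (hr : closedBall y r ⊆ (chartAt (CSpace n) x₀).target) :
    IsClosed ((chartAt (CSpace n) x₀).source ∩ chartAt (CSpace n) x₀ ⁻¹' closedBall y r) := by
  rw [← OpenPartialHomeomorph.symm_image_eq_source_inter_preimage _ hr]
  exact ((isCompact_closedBall y r).image_of_continuousOn
    ((chartAt (CSpace n) x₀).continuousOn_symm.mono hr)).isClosed

variable [IsManifold 𝓘(ℂ, CSpace n) ω X]

/-- A short circle which starts near the centre of a chart stays near the centre. -/
theorem circle_mem_chart_ball [T2Space X] (h : HermitianMetric n X) {F : ℂ → X} {Ω : Set ℂ}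
    (hΩ : IsOpen Ω) (hF : MDifferentiableOn 𝓘(ℂ, ℂ) 𝓘(ℂ, CSpace n) F Ω) (p : X) {δ κ : ℝ}
    (hδ : 0 < δ) (hδt : closedBall (chartAt (CSpace n) p p) δ ⊆ (chartAt (CSpace n) p).target)
    (hκ : 0 < κ) (hκle : ∀ y ∈ closedBall (chartAt (CSpace n) p p) δ, ∀ v,
      κ ^ 2 * ‖v‖ ^ 2 ≤ h.normSq ((chartAt (CSpace n) p).symm y) (coordMap p y v))
    {c : ℂ} {r : ℝ} (hr : 0 < r) (hrΩ : sphere c r ⊆ Ω)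
    (hstart : F (circleMap c r (-Real.pi)) ∈
      (chartAt (CSpace n) p).source ∩ chartAt (CSpace n) p ⁻¹' ball (chartAt (CSpace n) p p) (δ / 8))
    (hshort : ∫⁻ θ in Ioo (-Real.pi) Real.pi, ENNReal.ofReal (r * √(h.normSq
      (F (circleMap c r θ)) (mfderiv 𝓘(ℂ, ℂ) 𝓘(ℂ, CSpace n) F (circleMap c r θ) (1 : ℂ)))) <
        ENNReal.ofReal (κ * (δ / 16))) :
    ∀ w ∈ sphere c r, F w ∈
      (chartAt (CSpace n) p).source ∩
        chartAt (CSpace n) p ⁻¹' ball (chartAt (CSpace n) p p) (δ / 4) := by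
  set φ := chartAt (CSpace n) p with hφ
  set y₀ := φ p with hy₀
  have hcirc : ∀ θ, circleMap c r θ ∈ Ω := fun θ => hrΩ (circleMap_mem_sphere c hr.le θ)
  set γ : ℝ → X := fun θ => F (circleMap c r θ) with hγ
  have hγc : Continuous γ :=
    hF.continuousOn.comp_continuous (continuous_circleMap c r) hcirc
  -- The radius is 3δ/16 = δ/8 + δ/16: the starting distance plus the maximal displacement.
  set N : Set X := φ.source ∩ φ ⁻¹' closedBall y₀ (3 * δ / 16) with hN
  have hNc : IsClosed N := isClosed_source_inter_preimage_closedBall p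
    ((closedBall_subset_closedBall (by linarith)).trans hδt)
  -- displacement is bounded by length
  have hchord : ∀ θ ∈ Icc (-Real.pi) Real.pi,
      (∀ t ∈ Icc (-Real.pi) θ, γ t ∈ φ.source ∩ φ ⁻¹' closedBall y₀ δ) →
      ‖φ (γ θ) - φ (γ (-Real.pi))‖ ≤ δ / 16 := by
    intro θ hθ hin
    obtain ⟨hO, hd⟩ := hF.differentiableOn_chart_comp hΩ p
    set O := Ω ∩ F ⁻¹' φ.source
    set G : ℂ → CSpace n := fun w => φ (F w) with hG
    have hmaps : ∀ t ∈ Icc (-Real.pi) θ, circleMap c r t ∈ O := fun t ht => ⟨hcirc t, (hin t ht).1⟩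
    have hcd : ContDiffOn ℝ 1 (fun t => G (circleMap c r t)) (Icc (-Real.pi) θ) := by
      have h1 : ContDiffOn ℝ 1 G O :=
        ((hd.analyticOnNhd hO).contDiffOn hO.uniqueDiffOn).restrict_scalars ℝ
      exact h1.comp ((contDiff_circleMap c r).contDiffOn) hmaps
    have hderiv : ∀ t ∈ Icc (-Real.pi) θ, ‖deriv (fun t => G (circleMap c r t)) t‖ₑ ≤
        ENNReal.ofReal κ⁻¹ * ENNReal.ofReal (r * √(h.normSq
          (F (circleMap c r t)) (mfderiv 𝓘(ℂ, ℂ) 𝓘(ℂ, CSpace n) F (circleMap c r t) (1 : ℂ)))) := by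
      intro t ht
      have hGd : HasDerivAt G (deriv G (circleMap c r t)) (circleMap c r t) :=
        (hd.differentiableAt (hO.mem_nhds (hmaps t ht))).hasDerivAt
      have h1 := hGd.scomp t (hasDerivAt_circleMap c r t)
      have h2 : deriv (fun t => G (circleMap c r t)) t =
        (circleMap 0 r t * Complex.I) • deriv G (circleMap c r t) := h1.deriv
      have h3 := hκle _ (hin t ht).2 (deriv G (circleMap c r t))
      have h4 := h.normSq_mfderiv (x₀ := p) (hF.mdifferentiableAt (hΩ.mem_nhds (hcirc t)))
        (hin t ht).1 (1 : ℂ)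
      rw [fderiv_apply_one_eq_deriv] at h4
      rw [h2, ← ENNReal.ofReal_mul (by positivity), ← ofReal_norm]
      apply ENNReal.ofReal_le_ofReal
      rw [norm_smul, norm_mul, norm_circleMap_zero, Complex.norm_I, mul_one, abs_of_pos hr, h4]
      rw [mul_left_comm]
      refine mul_le_mul_of_nonneg_left ?_ hr.le
      rw [le_inv_mul_iff₀ hκ]
      refine Real.le_sqrt_of_sq_le ?_
      rw [mul_pow]
      exact h3
    have h1 := enorm_sub_le_lintegral_deriv_of_contDiffOn_Icc hcd hθ.1
    have h2 : ‖G (circleMap c r θ) - G (circleMap c r (-Real.pi))‖ₑ ≤ ENNReal.ofReal (δ / 16) := by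
      calc _ ≤ _ := h1
        _ ≤ ∫⁻ t in Icc (-Real.pi) θ, ENNReal.ofReal κ⁻¹ * ENNReal.ofReal (r * √(h.normSq
          (F (circleMap c r t)) (mfderiv 𝓘(ℂ, ℂ) 𝓘(ℂ, CSpace n) F (circleMap c r t) (1 : ℂ)))) :=
            setLIntegral_mono' measurableSet_Icc hderiv
        _ = ENNReal.ofReal κ⁻¹ * ∫⁻ t in Icc (-Real.pi) θ, ENNReal.ofReal (r * √(h.normSq
          (F (circleMap c r t)) (mfderiv 𝓘(ℂ, ℂ) 𝓘(ℂ, CSpace n) F (circleMap c r t) (1 : ℂ)))) :=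
            lintegral_const_mul' _ _ ENNReal.ofReal_ne_top
        _ ≤ ENNReal.ofReal κ⁻¹ * ENNReal.ofReal (κ * (δ / 16)) := by
            gcongr
            refine le_trans ?_ hshort.le
            rw [setLIntegral_congr (Ioo_ae_eq_Icc (a := -Real.pi) (b := Real.pi))]
            exact lintegral_mono_set (Icc_subset_Icc_right hθ.2)
        _ = ENNReal.ofReal (δ / 16) := by
            rw [← ENNReal.ofReal_mul (by positivity), ← mul_assoc, inv_mul_cancel₀ hκ.ne', one_mul]
    rw [← ofReal_norm, ENNReal.ofReal_le_ofReal_iff (by positivity)] at h2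
    exact h2
  -- The condition that the arc up to `θ` stays in `N`, rescaled to the fixed interval [0, 1] so
  -- that `s` is visibly an intersection of closed sets. Continuous induction then applies: a
  -- slightly longer arc is still in the δ-ball, where the length bound puts it back into `N`.
  set s : Set ℝ := {θ | ∀ u ∈ Icc (0 : ℝ) 1, γ (-Real.pi + u * (θ - -Real.pi)) ∈ N} with hs
  have hsiff : ∀ θ, -Real.pi ≤ θ → (θ ∈ s ↔ ∀ t ∈ Icc (-Real.pi) θ, γ t ∈ N) := by
    intro θ hθ
    constructor
    · intro h1 t ht
      rcases hθ.eq_or_lt with heq | hlt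
      · have : t = -Real.pi := le_antisymm (ht.2.trans heq.ge) ht.1
        simpa [this] using h1 0 (by simp)
      · have hpos : 0 < θ - -Real.pi := by linarith
        have := h1 ((t - -Real.pi) / (θ - -Real.pi))
          ⟨div_nonneg (by linarith [ht.1]) hpos.le, (div_le_one hpos).2 (by linarith [ht.2])⟩
        rwa [div_mul_cancel₀ _ hpos.ne', add_sub_cancel] at this
    · intro h1 u hu
      refine h1 _ ⟨?_, ?_⟩
      · nlinarith [hu.1]
      · nlinarith [hu.2]
  have hsub : Icc (-Real.pi) Real.pi ⊆ s := by
    refine IsClosed.Icc_subset_of_forall_mem_nhdsWithin ?_ ?_ ?_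
    · refine IsClosed.inter ?_ isClosed_Icc
      have : s = ⋂ u ∈ Icc (0 : ℝ) 1, (fun θ => γ (-Real.pi + u * (θ - -Real.pi))) ⁻¹' N := by
        ext θ; simp [hs]
      rw [this]
      exact isClosed_biInter fun u _ => hNc.preimage (hγc.comp (by fun_prop))
    · intro u _
      simp only [sub_self, mul_zero, add_zero]
      exact ⟨hstart.1, ball_subset_closedBall (ball_subset_ball (by linarith) hstart.2)⟩
    · rintro θ ⟨hθs, hθ⟩
      have hθN := (hsiff θ hθ.1).1 hθs
      have hopen : IsOpen (γ ⁻¹' (φ.source ∩ φ ⁻¹' ball y₀ (δ / 4))) :=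
        (isOpen_source_inter_preimage_ball p y₀ (δ / 4)).preimage hγc
      have hmem : θ ∈ γ ⁻¹' (φ.source ∩ φ ⁻¹' ball y₀ (δ / 4)) := by
        have := hθN θ ⟨hθ.1, le_rfl⟩
        exact ⟨this.1, closedBall_subset_ball (by linarith) this.2⟩
      obtain ⟨η, hη, hηsub⟩ := Metric.isOpen_iff.1 hopen θ hmem
      have hθ2 : θ < min (θ + η) Real.pi := lt_min (by linarith) hθ.2
      filter_upwards [Ioo_mem_nhdsGT hθ2] with θ' hθ'
      have hθ'π : θ' ≤ Real.pi := (hθ'.2.trans_le (min_le_right _ _)).le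
      have hin : ∀ t ∈ Icc (-Real.pi) θ', γ t ∈ φ.source ∩ φ ⁻¹' closedBall y₀ δ := by
        intro t ht
        rcases le_total t θ with htθ | htθ
        · have := hθN t ⟨ht.1, htθ⟩
          exact ⟨this.1, closedBall_subset_closedBall (by linarith) this.2⟩
        · have : t ∈ ball θ η := by
            rw [mem_ball, Real.dist_eq, abs_of_nonneg (by linarith)]
            linarith [ht.2, hθ'.2.trans_le (min_le_left (θ + η) Real.pi)]
          have := hηsub this
          exact ⟨this.1, ball_subset_closedBall (ball_subset_ball (by linarith) this.2)⟩
      refine (hsiff θ' (hθ.1.trans hθ'.1.le)).2 fun t ht => ?_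
      have h1 := hchord t ⟨ht.1, ht.2.trans hθ'π⟩ fun u hu => hin u ⟨hu.1, hu.2.trans ht.2⟩
      refine ⟨(hin t ht).1, ?_⟩
      have h2 : ‖φ (γ (-Real.pi)) - y₀‖ < δ / 8 := mem_ball_iff_norm.1 hstart.2
      rw [mem_preimage, mem_closedBall_iff_norm]
      calc ‖φ (γ t) - y₀‖ = ‖(φ (γ t) - φ (γ (-Real.pi))) + (φ (γ (-Real.pi)) - y₀)‖ := by
            congr 1; abel
        _ ≤ δ / 16 + δ / 8 := (norm_add_le _ _).trans (add_le_add h1 h2.le)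
        _ = 3 * δ / 16 := by ring
  intro w hw
  have hw' : w = circleMap c r (Complex.arg (w - c)) := by
    have : ‖w - c‖ = r := mem_sphere_iff_norm.1 hw
    rw [circleMap, ← this, Complex.norm_mul_exp_arg_mul_I]
    ring
  have harg := Complex.arg_mem_Ioc (w - c)
  have := (hsiff _ harg.1.le).1 (hsub ⟨harg.1.le, harg.2⟩) _ ⟨harg.1.le, le_rfl⟩
  rw [hw']
  exact ⟨this.1, closedBall_subset_ball (by linarith) this.2⟩

end Removable

/-! ### Removable singularities: annuli of small area and the extension theorem -/

section Removable

variable {n : ℕ} {X : Type*} [TopologicalSpace X] [ChartedSpace (CSpace n) X]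
  [IsManifold 𝓘(ℂ, CSpace n) ω X]

/-- A holomorphic annulus of small area whose boundary is near the centre of a chart stays in that
chart. -/
theorem annulus_mem_chart_ball [T2Space X] (h : HermitianMetric n X) {F : ℂ → X} {Ω : Set ℂ}
    (hΩ : IsOpen Ω) (hF : MDifferentiableOn 𝓘(ℂ, ℂ) 𝓘(ℂ, CSpace n) F Ω) (p : X) {δ κ : ℝ}
    (hδ : 0 < δ) (hδt : closedBall (chartAt (CSpace n) p p) δ ⊆ (chartAt (CSpace n) p).target)
    (hκ : 0 < κ) (hκle : ∀ y ∈ closedBall (chartAt (CSpace n) p p) δ, ∀ v,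
      κ ^ 2 * ‖v‖ ^ 2 ≤ h.normSq ((chartAt (CSpace n) p).symm y) (coordMap p y v))
    {c : ℂ} {r₁ r₂ : ℝ} (hr₁ : 0 < r₁) (hr : r₁ < r₂)
    (hrΩ : {w | r₁ ≤ ‖w - c‖ ∧ ‖w - c‖ ≤ r₂} ⊆ Ω)
    (h₁ : ∀ w ∈ sphere c r₁, F w ∈ (chartAt (CSpace n) p).source ∩
        chartAt (CSpace n) p ⁻¹' ball (chartAt (CSpace n) p p) (δ / 4))
    (h₂ : ∀ w ∈ sphere c r₂, F w ∈ (chartAt (CSpace n) p).source ∩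
        chartAt (CSpace n) p ⁻¹' ball (chartAt (CSpace n) p p) (δ / 4))
    (harea : ∫⁻ w in {w | r₁ < ‖w - c‖ ∧ ‖w - c‖ < r₂}, ENNReal.ofReal (h.normSq
      (F w) (mfderiv 𝓘(ℂ, ℂ) 𝓘(ℂ, CSpace n) F w (1 : ℂ))) <
        ENNReal.ofReal (κ ^ 2 * ((δ / 16) ^ 2 / 200))) :
    ∀ w, r₁ < ‖w - c‖ → ‖w - c‖ < r₂ → F w ∈ (chartAt (CSpace n) p).source ∩
        chartAt (CSpace n) p ⁻¹' ball (chartAt (CSpace n) p p) δ := by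
  set φ := chartAt (CSpace n) p with hφ
  set y₀ := φ p with hy₀
  set A : Set ℂ := {w | r₁ < ‖w - c‖ ∧ ‖w - c‖ < r₂} with hA
  set B : Set ℂ := {w | r₁ ≤ ‖w - c‖ ∧ ‖w - c‖ ≤ r₂} with hB
  have hnc : Continuous (fun w : ℂ => ‖w - c‖) := by fun_prop
  have hAo : IsOpen A := (isOpen_lt continuous_const hnc).inter (isOpen_lt hnc continuous_const)
  have hBc : IsClosed B := (isClosed_le continuous_const hnc).inter (isClosed_le hnc continuous_const)
  have hBcomp : IsCompact B := (isCompact_closedBall c r₂).of_isClosed_subset hBc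
    (fun w hw => mem_closedBall_iff_norm.2 hw.2)
  have hAB : A ⊆ B := fun w hw => ⟨hw.1.le, hw.2.le⟩
  have hAΩ : A ⊆ Ω := hAB.trans hrΩ
  have hFc : ContinuousOn F Ω := hF.continuousOn
  have hpre := isPreconnected_annulus c (r₂ := r₂) hr₁.le
  set G : ℂ → CSpace n := fun w => φ (F w) with hG
  obtain ⟨hO, hd⟩ := hF.differentiableOn_chart_comp hΩ p
  -- the derivative vanishes in a shell
  have hzero : ∀ w ∈ A, F w ∈ φ.source → 3 * δ / 8 < ‖G w - y₀‖ → ‖G w - y₀‖ < δ / 2 →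
      deriv G w = 0 := by
    intro w₀ hw₀ hsrc hlow hup
    by_contra hne
    set Ω₁ := A ∩ F ⁻¹' (φ.source ∩ φ ⁻¹' ball y₀ δ) with hΩ₁
    have hΩ₁o : IsOpen Ω₁ := (hFc.mono hAΩ).isOpen_inter_preimage hAo
      (isOpen_source_inter_preimage_ball p y₀ δ)
    have hGd : DifferentiableOn ℂ G Ω₁ := hd.mono fun w hw => ⟨hAΩ hw.1, hw.2.1⟩
    have hw₀1 : w₀ ∈ Ω₁ := ⟨hw₀, hsrc, mem_ball_iff_norm.2 (hup.trans (by linarith))⟩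
    have hsubt : closedBall (G w₀) (δ / 16) ⊆ φ.target := by
      refine Subset.trans (fun y hy => ?_) hδt
      rw [mem_closedBall_iff_norm] at hy ⊢
      calc ‖y - y₀‖ = ‖(y - G w₀) + (G w₀ - y₀)‖ := by congr 1; abel
        _ ≤ δ / 16 + δ / 2 := (norm_add_le _ _).trans (add_le_add hy hup.le)
        _ ≤ δ := by linarith
    -- Points within δ/16 of `G w₀` are more than δ/4 away from `y₀`, while both boundary circles
    -- are mapped within δ/4. So the set does not reach the boundary of the annulus and is compact,
    -- as `area_lower_bound` requires.
    have hKeq : {w | w ∈ Ω₁ ∧ ‖G w - G w₀‖ ≤ δ / 16} =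
        B ∩ F ⁻¹' (φ.source ∩ φ ⁻¹' closedBall (G w₀) (δ / 16)) := by
      ext w
      constructor
      · rintro ⟨⟨hwA, hws, -⟩, hwR⟩
        exact ⟨hAB hwA, hws, mem_closedBall_iff_norm.2 hwR⟩
      · rintro ⟨hwB, hws, hwR⟩
        have hwR' : ‖G w - G w₀‖ ≤ δ / 16 := mem_closedBall_iff_norm.1 hwR
        have hge : δ / 4 < ‖G w - y₀‖ := by
          have : ‖G w₀ - y₀‖ ≤ ‖G w - G w₀‖ + ‖G w - y₀‖ := by
            calc ‖G w₀ - y₀‖ = ‖-(G w - G w₀) + (G w - y₀)‖ := by congr 1; abel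
              _ ≤ _ := (norm_add_le _ _).trans_eq (by rw [norm_neg])
          linarith
        have hle : ‖G w - y₀‖ < δ := by
          calc ‖G w - y₀‖ = ‖(G w - G w₀) + (G w₀ - y₀)‖ := by congr 1; abel
            _ ≤ ‖G w - G w₀‖ + ‖G w₀ - y₀‖ := norm_add_le _ _
            _ < δ := by linarith
        refine ⟨⟨⟨hwB.1.lt_of_ne fun he => ?_, hwB.2.lt_of_ne fun he => ?_⟩, hws,
          mem_ball_iff_norm.2 hle⟩, hwR'⟩
        · have := mem_ball_iff_norm.1 (h₁ w (mem_sphere_iff_norm.2 he.symm)).2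
          exact lt_asymm hge this
        · have := mem_ball_iff_norm.1 (h₂ w (mem_sphere_iff_norm.2 he)).2
          exact lt_asymm hge this
    have hK : IsCompact {w | w ∈ Ω₁ ∧ ‖G w - G w₀‖ ≤ δ / 16} := by
      rw [hKeq]
      exact hBcomp.of_isClosed_subset ((hFc.mono hrΩ).preimage_isClosed_of_isClosed hBc
        (isClosed_source_inter_preimage_closedBall p hsubt)) inter_subset_left
    have hlb := area_lower_bound hΩ₁o hGd hw₀1 hne (by positivity) hK
    refine absurd harea (not_lt.2 ?_)
    rw [ENNReal.ofReal_mul (by positivity)]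
    calc ENNReal.ofReal (κ ^ 2) * ENNReal.ofReal ((δ / 16) ^ 2 / 200)
        ≤ ENNReal.ofReal (κ ^ 2) * ∫⁻ w in Ω₁, ENNReal.ofReal (‖deriv G w‖ ^ 2) := by gcongr
      _ = ∫⁻ w in Ω₁, ENNReal.ofReal (κ ^ 2) * ENNReal.ofReal (‖deriv G w‖ ^ 2) :=
          (lintegral_const_mul' _ _ ENNReal.ofReal_ne_top).symm
      _ ≤ ∫⁻ w in Ω₁, ENNReal.ofReal (h.normSq
            (F w) (mfderiv 𝓘(ℂ, ℂ) 𝓘(ℂ, CSpace n) F w (1 : ℂ))) := by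
          refine setLIntegral_mono' hΩ₁o.measurableSet fun w hw => ?_
          rw [← ENNReal.ofReal_mul (by positivity)]
          apply ENNReal.ofReal_le_ofReal
          rw [h.normSq_mfderiv (x₀ := p) (hF.mdifferentiableAt (hΩ.mem_nhds (hAΩ hw.1))) hw.2.1,
            fderiv_apply_one_eq_deriv]
          exact hκle _ (ball_subset_closedBall hw.2.2) _
      _ ≤ _ := lintegral_mono_set fun w hw => hw.1
  -- points near the outer boundary
  have hnear : (A ∩ F ⁻¹' (φ.source ∩ φ ⁻¹' ball y₀ (δ / 4))).Nonempty := by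
    set w₁ : ℂ := c + r₂ with hw₁
    have hw₁s : w₁ ∈ sphere c r₂ := by simp [hw₁, abs_of_pos (hr₁.trans hr)]
    have hw₁Ω : w₁ ∈ Ω := hrΩ ⟨by rw [mem_sphere_iff_norm.1 hw₁s]; exact hr.le,
      (mem_sphere_iff_norm.1 hw₁s).le⟩
    have hev : ∀ᶠ w in 𝓝 w₁, F w ∈ φ.source ∩ φ ⁻¹' ball y₀ (δ / 4) :=
      (hFc.continuousAt (hΩ.mem_nhds hw₁Ω)).eventually
        ((isOpen_source_inter_preimage_ball p y₀ (δ / 4)).mem_nhds (h₂ w₁ hw₁s))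
    have ht : Tendsto (fun t : ℝ => c + (t : ℂ)) (𝓝[<] r₂) (𝓝 w₁) := by
      have : Continuous (fun t : ℝ => c + (t : ℂ)) := by fun_prop
      exact (this.tendsto r₂).mono_left nhdsWithin_le_nhds
    obtain ⟨t, ht1, ht2⟩ := ((ht.eventually hev).and (Ioo_mem_nhdsLT hr)).exists
    have htn : ‖c + (t : ℂ) - c‖ = t := by
      rw [add_sub_cancel_left, Complex.norm_real, Real.norm_of_nonneg (hr₁.trans ht2.1).le]
    exact ⟨c + (t : ℂ), ⟨by rw [htn]; exact ht2.1, by rw [htn]; exact ht2.2⟩, ht1⟩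
  -- The middle of the shell between 3δ/8 and δ/2.
  set t := 7 * δ / 16 with ht
  have htt : closedBall y₀ t ⊆ φ.target :=
    (closedBall_subset_closedBall (by rw [ht]; linarith)).trans hδt
  have hNc := isClosed_source_inter_preimage_closedBall (n := n) p htt
  have hNo := isOpen_source_inter_preimage_ball (n := n) p y₀ t
  have hUo : IsOpen (A ∩ F ⁻¹' (φ.source ∩ φ ⁻¹' ball y₀ t)) :=
    (hFc.mono hAΩ).isOpen_inter_preimage hAo hNo
  have hVo : IsOpen (A ∩ F ⁻¹' (φ.source ∩ φ ⁻¹' closedBall y₀ t)ᶜ) :=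
    (hFc.mono hAΩ).isOpen_inter_preimage hAo hNc.isOpen_compl
  -- no point of the annulus is mapped to the sphere of radius `t`
  have hempty : ∀ w ∈ A, F w ∈ φ.source → ‖G w - y₀‖ ≠ t := by
    intro w₀ hw₀ hs₀ he₀
    -- In the shell `G` is locally constant, so `T` is open, and its complement in the annulus is
    -- open as well. By connectedness `T` would be the whole annulus, against the points near the
    -- outer circle.
    set T : Set ℂ := {w | w ∈ A ∧ F w ∈ φ.source ∧ ‖G w - y₀‖ = t} with hT
    have hTo : IsOpen T := by
      rw [isOpen_iff_mem_nhds]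
      rintro w ⟨hwA, hws, hwt⟩
      have hGc : ContinuousAt (fun w => ‖G w - y₀‖) w :=
        ((hd.continuousOn.continuousAt (hO.mem_nhds ⟨hAΩ hwA, hws⟩)).sub continuousAt_const).norm
      have hev : ∀ᶠ w' in 𝓝 w, (w' ∈ A ∧ w' ∈ Ω ∩ F ⁻¹' φ.source) ∧
          3 * δ / 8 < ‖G w' - y₀‖ ∧ ‖G w' - y₀‖ < δ / 2 := by
        have hw1 : ∀ᶠ w' in 𝓝 w, w' ∈ A := hAo.mem_nhds hwA
        have hw2 : ∀ᶠ w' in 𝓝 w, w' ∈ Ω ∩ F ⁻¹' φ.source := hO.mem_nhds ⟨hAΩ hwA, hws⟩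
        refine (hw1.and hw2).and ?_
        exact (hGc.eventually (lt_mem_nhds (by simp only [hwt, ht]; linarith))).and
          (hGc.eventually (gt_mem_nhds (by simp only [hwt, ht]; linarith)))
      obtain ⟨η, hη, hball⟩ := Metric.eventually_nhds_iff_ball.1 hev
      refine Filter.mem_of_superset (ball_mem_nhds w hη) fun w' hw' => ?_
      have hconst := isOpen_ball.is_const_of_deriv_eq_zero (convex_ball w η).isPreconnected
        (hd.mono fun u hu => (hball u hu).1.2)
        (fun u hu => hzero u (hball u hu).1.1 (hball u hu).1.2.2 (hball u hu).2.1
          (hball u hu).2.2) hw' (mem_ball_self hη)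
      refine ⟨(hball w' hw').1.1, (hball w' hw').1.2.2, ?_⟩
      change ‖φ (F w') - y₀‖ = t
      rw [hconst]
      exact hwt
    have hcover : A ⊆ T ∪ ((A ∩ F ⁻¹' (φ.source ∩ φ ⁻¹' ball y₀ t)) ∪
        (A ∩ F ⁻¹' (φ.source ∩ φ ⁻¹' closedBall y₀ t)ᶜ)) := by
      intro w hw
      by_cases hin : F w ∈ φ.source ∩ φ ⁻¹' closedBall y₀ t
      · rcases (mem_closedBall_iff_norm.1 hin.2).lt_or_eq with hlt | heq
        · exact Or.inr (Or.inl ⟨hw, hin.1, mem_ball_iff_norm.2 hlt⟩)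
        · exact Or.inl ⟨hw, hin.1, heq⟩
      · exact Or.inr (Or.inr ⟨hw, hin⟩)
    have hdisj : Disjoint T ((A ∩ F ⁻¹' (φ.source ∩ φ ⁻¹' ball y₀ t)) ∪
        (A ∩ F ⁻¹' (φ.source ∩ φ ⁻¹' closedBall y₀ t)ᶜ)) := by
      rw [Set.disjoint_left]
      rintro w ⟨-, hws, hwt⟩ (⟨-, -, hb⟩ | ⟨-, hb⟩)
      · exact (mem_ball_iff_norm.1 hb).ne hwt
      · exact hb ⟨hws, mem_closedBall_iff_norm.2 hwt.le⟩
    have hAT := IsPreconnected.subset_left_of_subset_union hTo (hUo.union hVo) hdisj hcover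
      ⟨w₀, hw₀, hw₀, hs₀, he₀⟩ hpre
    obtain ⟨w, hwA, hwb⟩ := hnear
    have h3 := (hAT hwA).2.2
    have h4 := mem_ball_iff_norm.1 hwb.2
    have h5 : ‖G w - y₀‖ < δ / 4 := h4
    rw [h3, ht] at h5
    linarith
  -- Now that the sphere of radius `t` is avoided, the open ball and the complement of the closed
  -- ball split the connected annulus.
  have hcover : A ⊆ (A ∩ F ⁻¹' (φ.source ∩ φ ⁻¹' ball y₀ t)) ∪
      (A ∩ F ⁻¹' (φ.source ∩ φ ⁻¹' closedBall y₀ t)ᶜ) := by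
    intro w hw
    by_cases hin : F w ∈ φ.source ∩ φ ⁻¹' closedBall y₀ t
    · exact Or.inl ⟨hw, hin.1, mem_ball_iff_norm.2
        ((mem_closedBall_iff_norm.1 hin.2).lt_of_ne (hempty w hw hin.1))⟩
    · exact Or.inr ⟨hw, hin⟩
  have hdisj : Disjoint (A ∩ F ⁻¹' (φ.source ∩ φ ⁻¹' ball y₀ t))
      (A ∩ F ⁻¹' (φ.source ∩ φ ⁻¹' closedBall y₀ t)ᶜ) := by
    rw [Set.disjoint_left]
    rintro w ⟨-, hws, hb⟩ ⟨-, hb'⟩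
    exact hb' ⟨hws, ball_subset_closedBall hb⟩
  have hfin := IsPreconnected.subset_left_of_subset_union hUo hVo hdisj hcover (by
    obtain ⟨w, hwA, hws, hwb⟩ := hnear
    exact ⟨w, hwA, hwA, hws, ball_subset_ball (by rw [ht]; linarith) hwb⟩) hpre
  intro w hw1 hw2
  have := (hfin ⟨hw1, hw2⟩).2
  exact ⟨this.1, ball_subset_ball (by rw [ht]; linarith) this.2⟩

theorem HermitianMetric.exists_chart_ball (h : HermitianMetric n X) (p : X) :
    ∃ δ > 0, closedBall (chartAt (CSpace n) p p) δ ⊆ (chartAt (CSpace n) p).target ∧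
      ∃ κ > 0, ∀ y ∈ closedBall (chartAt (CSpace n) p p) δ, ∀ v,
        κ ^ 2 * ‖v‖ ^ 2 ≤ h.normSq ((chartAt (CSpace n) p).symm y) (coordMap p y v) := by
  obtain ⟨δ, hδ, hδt⟩ := Metric.nhds_basis_closedBall.mem_iff.1
    ((chartAt (CSpace n) p).open_target.mem_nhds (mem_chart_target (CSpace n) p))
  obtain ⟨κ, hκ, hle⟩ := h.exists_normSq_coordMap_ge p (isCompact_closedBall _ δ) hδt
  exact ⟨δ, hδ, hδt, √κ, Real.sqrt_pos.2 hκ, by simpa [Real.sq_sqrt hκ.le] using hle⟩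

/-- **Removable singularities**: a holomorphic map of finite area from a punctured disc to a compact
hermitian manifold extends continuously over the puncture. -/
theorem exists_tendsto_of_finite_area [T2Space X] [CompactSpace X] (h : HermitianMetric n X)
    {F : ℂ → X} {c : ℂ} {ρ : ℝ} (hρ : 0 < ρ)
    (hF : MDifferentiableOn 𝓘(ℂ, ℂ) 𝓘(ℂ, CSpace n) F (ball c ρ \ {c}))
    (hfin : ∫⁻ w in ball c ρ \ {c}, ENNReal.ofReal (h.normSq
      (F w) (mfderiv 𝓘(ℂ, ℂ) 𝓘(ℂ, CSpace n) F w (1 : ℂ))) ≠ ⊤) :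
    ∃ p, Tendsto F (𝓝[≠] c) (𝓝 p) := by
  have hΩ : IsOpen (ball c ρ \ {c}) := isOpen_ball.sdiff isClosed_singleton
  set q : ℂ → ℝ := fun w => h.normSq (F w) (mfderiv 𝓘(ℂ, ℂ) 𝓘(ℂ, CSpace n) F w (1 : ℂ)) with hq
  have hq0 : ∀ w, 0 ≤ q w := fun w => h.normSq_nonneg _ _
  have hqc : ContinuousOn q (ball c ρ \ {c}) := h.continuousOn_normSq_mfderiv hΩ hF 1
  have hex : ∀ k : ℕ, ∃ r ∈ Ioo 0 (min ρ (1 / ((k : ℝ) + 1))),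
      ∫⁻ θ in Ioo (-Real.pi) Real.pi, ENNReal.ofReal (r * √(q (circleMap c r θ))) <
        ENNReal.ofReal (1 / ((k : ℝ) + 1)) := fun k =>
    exists_short_circle hq0 hqc hfin (by positivity) (min_le_left _ _) (by positivity)
  choose r hr hlen using hex
  have hr0 : ∀ k, 0 < r k := fun k => (hr k).1
  have hrρ : ∀ k, r k < ρ := fun k => (hr k).2.trans_le (min_le_left _ _)
  have hrk : ∀ k, r k < 1 / ((k : ℝ) + 1) := fun k => (hr k).2.trans_le (min_le_right _ _)
  -- An accumulation point of base points on circles whose radii and lengths tend to 0.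
  obtain ⟨p, hp⟩ := exists_clusterPt_of_compactSpace
    (map (fun k => F (circleMap c (r k) (-Real.pi))) atTop)
  have hp' := mapClusterPt_iff_frequently.1 (show MapClusterPt p atTop _ from hp)
  obtain ⟨δ, hδ, hδt, κ, hκ, hκle⟩ := h.exists_chart_ball p
  set φ := chartAt (CSpace n) p with hφ
  have hlim : Tendsto (fun k : ℕ => 1 / ((k : ℝ) + 1)) atTop (𝓝 0) :=
    tendsto_one_div_add_atTop_nhds_zero_nat
  have hsph : ∀ k, sphere c (r k) ⊆ ball c ρ \ {c} := by
    intro k w hw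
    have hw' := mem_sphere_iff_norm.1 hw
    refine ⟨mem_ball_iff_norm.2 (by rw [hw']; exact hrρ k), fun h0 => ?_⟩
    rw [mem_singleton_iff.1 h0, sub_self, norm_zero] at hw'
    exact (hr0 k).ne hw'
  have hgood : ∃ᶠ k in atTop, ∀ w ∈ sphere c (r k), F w ∈ φ.source ∩
      φ ⁻¹' ball (φ p) (δ / 4) := by
    have hfr := hp' _ ((isOpen_source_inter_preimage_ball p (φ p) (δ / 8)).mem_nhds
      ⟨mem_chart_source _ _, mem_ball_self (by positivity)⟩)
    have hsm : ∀ᶠ k : ℕ in atTop, 1 / ((k : ℝ) + 1) < κ * (δ / 16) :=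
      hlim.eventually (gt_mem_nhds (by positivity))
    refine (hfr.and_eventually hsm).mono ?_
    rintro k ⟨hk1, hk2⟩
    exact circle_mem_chart_ball h hΩ hF p hδ hδt hκ hκle (hr0 k) (hsph k) hk1
      ((hlen k).trans_le (ENNReal.ofReal_le_ofReal hk2.le))
  have hsmall : ∀ᶠ k : ℕ in atTop, ∫⁻ w in ball c (1 / ((k : ℝ) + 1)),
      (ball c ρ \ {c}).indicator (fun w => ENNReal.ofReal (q w)) w <
        ENNReal.ofReal (κ ^ 2 * ((δ / 16) ^ 2 / 200)) := by
    have htz : Tendsto (fun k : ℕ => ∫⁻ w in ball c (1 / ((k : ℝ) + 1)),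
        (ball c ρ \ {c}).indicator (fun w => ENNReal.ofReal (q w)) w) atTop (𝓝 0) := by
      refine tendsto_setLIntegral_zero ?_ ?_
      · rwa [lintegral_indicator hΩ.measurableSet]
      · have : (⇑(volume : Measure ℂ) ∘ fun k : ℕ => ball c (1 / ((k : ℝ) + 1))) =
            fun k : ℕ => ENNReal.ofReal (1 / ((k : ℝ) + 1)) ^ 2 * NNReal.pi := by
          ext k
          simp only [Function.comp_apply, Complex.volume_ball]
        rw [this]
        have h1 : Tendsto (fun k : ℕ => ENNReal.ofReal (1 / ((k : ℝ) + 1))) atTop (𝓝 0) := by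
          simpa using ENNReal.tendsto_ofReal hlim
        have h2 := ENNReal.Tendsto.mul_const (b := (NNReal.pi : ℝ≥0∞))
          (ENNReal.Tendsto.pow (n := 2) h1) (Or.inr ENNReal.coe_ne_top)
        simpa using h2
    exact htz.eventually (gt_mem_nhds (ENNReal.ofReal_pos.2 (by positivity)))
  -- The outer circle is fixed once and for all, with little area inside. The inner circle is chosen
  -- afterwards for each `w`, among infinitely many good ones.
  obtain ⟨k₀, hk₀g, hk₀s⟩ := (hgood.and_eventually hsmall).exists
  have himage : ∀ w, 0 < ‖w - c‖ → ‖w - c‖ < r k₀ → F w ∈ φ.source ∩ φ ⁻¹' ball (φ p) δ := by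
    intro w hw0 hw1
    obtain ⟨k, hkg, hks⟩ := (hgood.and_eventually
      (hlim.eventually (gt_mem_nhds hw0))).exists
    have hrkw : r k < ‖w - c‖ := (hrk k).trans hks
    refine annulus_mem_chart_ball h hΩ hF p hδ hδt hκ hκle (hr0 k) (hrkw.trans hw1) ?_ hkg hk₀g ?_
      w hrkw hw1
    · rintro u ⟨hu1, hu2⟩
      refine ⟨mem_ball_iff_norm.2 (hu2.trans_lt (hrρ k₀)), fun h0 => ?_⟩
      rw [mem_singleton_iff.1 h0, sub_self, norm_zero] at hu1
      exact absurd (hr0 k) (not_lt.2 hu1)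
    · refine lt_of_le_of_lt ?_ hk₀s
      have hnc : Continuous (fun w : ℂ => ‖w - c‖) := by fun_prop
      have hAm : MeasurableSet {u : ℂ | r k < ‖u - c‖ ∧ ‖u - c‖ < r k₀} :=
        ((isOpen_lt continuous_const hnc).inter (isOpen_lt hnc continuous_const)).measurableSet
      calc _ = ∫⁻ w in {u : ℂ | r k < ‖u - c‖ ∧ ‖u - c‖ < r k₀},
            (ball c ρ \ {c}).indicator (fun w => ENNReal.ofReal (q w)) w := by
            refine setLIntegral_congr_fun hAm fun u hu => ?_
            have : u ∈ ball c ρ \ {c} := by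
              refine ⟨mem_ball_iff_norm.2 (hu.2.trans (hrρ k₀)), fun h0 => ?_⟩
              have h3 := hu.1
              rw [mem_singleton_iff.1 h0, sub_self, norm_zero] at h3
              exact absurd (hr0 k) (not_lt.2 h3.le)
            simp only [indicator_of_mem this]
            rfl
        _ ≤ _ := lintegral_mono_set fun u hu =>
            mem_ball_iff_norm.2 (hu.2.trans (hrk k₀))
  -- conclude by the removable singularity theorem in the chart
  have hpunct : ∀ᶠ w in 𝓝[≠] c, 0 < ‖w - c‖ ∧ ‖w - c‖ < r k₀ := by
    refine eventually_nhdsWithin_iff.2 ?_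
    filter_upwards [ball_mem_nhds c (hr0 k₀)] with w hw hne
    exact ⟨norm_pos_iff.2 (sub_ne_zero.2 hne), mem_ball_iff_norm.1 hw⟩
  have hdiff : ∀ᶠ w in 𝓝[≠] c, DifferentiableAt ℂ (fun w => φ (F w)) w := by
    filter_upwards [hpunct] with w hw
    refine (hF.mdifferentiableAt (hΩ.mem_nhds ?_)).differentiableAt_chart_comp
      (himage w hw.1 hw.2).1
    exact ⟨mem_ball_iff_norm.2 (hw.2.trans (hrρ k₀)), sub_ne_zero.1 (norm_pos_iff.1 hw.1)⟩
  -- The value `F c` carries no information; Riemann's theorem is stated with boundedness of the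
  -- difference to it.
  have hbdd : IsBoundedUnder (· ≤ ·) (𝓝[≠] c) fun w => ‖φ (F w) - φ (F c)‖ := by
    refine isBoundedUnder_of_eventually_le (a := δ + ‖φ p - φ (F c)‖) ?_
    filter_upwards [hpunct] with w hw
    have := (mem_ball_iff_norm.1 (himage w hw.1 hw.2).2).le
    calc ‖φ (F w) - φ (F c)‖ = ‖(φ (F w) - φ p) + (φ p - φ (F c))‖ := by congr 1; abel
      _ ≤ _ := (norm_add_le _ _).trans (add_le_add_left this _)
  have hten := Complex.tendsto_limUnder_of_differentiable_on_punctured_nhds_of_bounded_under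
    hdiff hbdd
  set y := (𝓝[≠] c).limUnder fun w => φ (F w) with hy
  have hyt : y ∈ φ.target := by
    refine hδt (isClosed_closedBall.mem_of_tendsto hten ?_)
    filter_upwards [hpunct] with w hw
    exact ball_subset_closedBall (himage w hw.1 hw.2).2
  refine ⟨φ.symm y, ?_⟩
  have := ((φ.symm.continuousAt hyt).tendsto.comp hten)
  refine this.congr' ?_
  filter_upwards [hpunct] with w hw
  exact φ.left_inv (himage w hw.1 hw.2).1

end Removable

/-! ### Complex lines and analytic sets -/

section AnalyticSubset

variable {m : ℕ} {S : Set (CSpace m)}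

theorem IsAnalyticSubset.isClosed (hS : IsAnalyticSubset 𝓘(ℂ, CSpace m) S) : IsClosed S := by
  rw [← isOpen_compl_iff, isOpen_iff_mem_nhds]
  intro x hx
  obtain ⟨U, hU, hxU, N, g, hg, hSU⟩ := hS x
  have hex : ∃ i, g i x ≠ 0 := by
    by_contra! hcon
    have : x ∈ S ∩ U := by rw [hSU]; exact ⟨hxU, hcon⟩
    exact hx this.1
  obtain ⟨i, hi⟩ := hex
  have hgc : ContinuousAt (g i) x := (hg i).continuousOn.continuousAt (hU.mem_nhds hxU)
  filter_upwards [hgc.eventually_ne hi, hU.mem_nhds hxU] with y hy hyU hyS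
  have : y ∈ S ∩ U := ⟨hyS, hyU⟩
  rw [hSU] at this
  exact hy (this.2 i)

/-- A complex line which is not contained in an analytic set meets it in isolated points. -/
theorem IsAnalyticSubset.eventually_line_notMem (hS : IsAnalyticSubset 𝓘(ℂ, CSpace m) S)
    {a : CSpace m} (ha : a ∉ S) (z : CSpace m) (w₀ : ℂ) :
    ∀ᶠ w in 𝓝[≠] w₀, a + w • z ∉ S := by
  have hlc : Continuous (fun w : ℂ => a + w • z) := by fun_prop
  -- Near a point of the line either all local equations vanish identically along it, or one of them
  -- has isolated zeros. The first alternative is both open and closed in the line and fails at `w =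
  -- 0`.
  have hdich : ∀ w₀ : ℂ, (∀ᶠ w in 𝓝 w₀, a + w • z ∈ S) ∨ ∀ᶠ w in 𝓝[≠] w₀, a + w • z ∉ S := by
    intro w₀
    obtain ⟨U, hU, hxU, N, g, hg, hSU⟩ := hS (a + w₀ • z)
    have hUo : IsOpen ((fun w : ℂ => a + w • z) ⁻¹' U) := hU.preimage hlc
    have han : ∀ i, AnalyticOnNhd ℂ (fun w : ℂ => g i (a + w • z))
        ((fun w : ℂ => a + w • z) ⁻¹' U) := fun i =>
      (mdifferentiableOn_iff_differentiableOn.1 (hg i)).analyticOnNhd_comp_line hU a z hUo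
        fun w hw => hw
    have hUn : ∀ᶠ w in 𝓝 w₀, a + w • z ∈ U := hUo.mem_nhds hxU
    by_cases hall : ∀ i, ∀ᶠ w in 𝓝 w₀, g i (a + w • z) = 0
    · left
      filter_upwards [eventually_all.2 hall, hUn] with w hw hwU
      have : a + w • z ∈ S ∩ U := by rw [hSU]; exact ⟨hwU, hw⟩
      exact this.1
    · right
      push Not at hall
      obtain ⟨i, hi⟩ := hall
      rcases (han i w₀ hxU).eventually_eq_zero_or_eventually_ne_zero with h0 | h0
      · exact absurd h0 (by simpa using hi)
      · filter_upwards [h0, nhdsWithin_le_nhds hUn] with w hw hwU hwS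
        have : a + w • z ∈ S ∩ U := ⟨hwS, hwU⟩
        rw [hSU] at this
        exact hw (this.2 i)
  set I : Set ℂ := {w₀ | ∀ᶠ w in 𝓝 w₀, a + w • z ∈ S} with hI
  have hIo : IsOpen I := isOpen_iff_mem_nhds.2 fun w hw => eventually_eventually_nhds.2 hw
  have hIc : IsClosed I := by
    rw [← closure_subset_iff_isClosed]
    intro w hw
    by_contra hwI
    have h1 := (hdich w).resolve_left hwI
    rw [eventually_nhdsWithin_iff] at h1
    obtain ⟨O, hO, hOo, hwO⟩ := _root_.eventually_nhds_iff.1 h1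
    obtain ⟨u, huO, huI⟩ := mem_closure_iff.1 hw O hOo hwO
    have hne : u ≠ w := fun h => hwI (h ▸ huI)
    exact hO u huO hne (show ∀ᶠ w in 𝓝 u, a + w • z ∈ S from huI).self_of_nhds
  rcases isClopen_iff.1 ⟨hIc, hIo⟩ with h | h
  · refine (hdich w₀).resolve_left fun h1 => ?_
    have : w₀ ∈ I := h1
    rw [h] at this
    exact this
  · have h0 : (0 : ℂ) ∈ I := by rw [h]; exact mem_univ _
    exact absurd (by simpa using (show ∀ᶠ w in 𝓝 (0 : ℂ), a + w • z ∈ S from h0).self_of_nhds) ha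

end AnalyticSubset

/-! ### Tensor fields: coefficients, pull-back, boundedness, identity principle -/

section Tensors

variable {n : ℕ} {X : Type*} [TopologicalSpace X] [ChartedSpace (CSpace n) X] {l : Fin n → ℕ}

/-- The value of a tensor field at a point and coordinate vectors. -/
noncomputable def tensorEval
    (τ : ∀ x : X, symAltTensors n l (TangentSpace 𝓘(ℂ, CSpace n) x)) (x : X)
    (v : TensorIndex n l → CSpace n) : ℂ :=
  (τ x).1 v

/-- Expansion in the standard basis: a tensor with varying arguments becomes a finite sum of
coefficients with constant arguments, which are what `globalSections` controls. -/
theorem MultilinearMap.apply_eq_sum_single {ι : Type*} [Fintype ι] [DecidableEq ι]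
    {V : Type*} [AddCommGroup V] [Module ℂ V] {k : ℕ}
    (M : MultilinearMap ℂ (fun _ : ι => V) ℂ) (L : CSpace k →ₗ[ℂ] V) (v : ι → CSpace k) :
    M (fun p => L (v p)) = ∑ K : ι → Fin k, (∏ p, v p (K p)) *
      M (fun p => L (EuclideanSpace.single (K p) 1)) := by
  have h1 : (fun p => L (v p)) =
      fun p => ∑ j, v p j • L (EuclideanSpace.single j (1 : ℂ)) := by
    ext p
    conv_lhs => rw [euclidean_eq_sum_single (v p)]
    simp
  rw [h1, MultilinearMap.map_sum]
  refine Finset.sum_congr rfl fun K _ => ?_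
  rw [MultilinearMap.map_smul_univ, smul_eq_mul]

theorem tensorEval_coordMap
    (τ : ∀ x : X, symAltTensors n l (TangentSpace 𝓘(ℂ, CSpace n) x)) (x₀ : X) (y : CSpace n)
    (v : TensorIndex n l → CSpace n) :
    tensorEval τ ((chartAt (CSpace n) x₀).symm y) (fun p => coordMap x₀ y (v p)) =
      ∑ K : TensorIndex n l → Fin n, (∏ p, v p (K p)) *
        tensorEval τ ((chartAt (CSpace n) x₀).symm y)
          (fun p => coordMap x₀ y (EuclideanSpace.single (K p) 1)) := by
  classical
  exact MultilinearMap.apply_eq_sum_single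
    (τ ((chartAt (CSpace n) x₀).symm y)).1 (coordMap x₀ y).toLinearMap v

theorem tensorEval_comp_linear {m : ℕ}
    (τ : ∀ x : X, symAltTensors n l (TangentSpace 𝓘(ℂ, CSpace n) x)) (x : X)
    (L : CSpace m →L[ℂ] CSpace n) (v : TensorIndex n l → CSpace m) :
    tensorEval τ x (fun p => L (v p)) =
      ∑ K : TensorIndex n l → Fin m, (∏ p, v p (K p)) *
        tensorEval τ x (fun p => L (EuclideanSpace.single (K p) 1)) := by
  classical
  exact MultilinearMap.apply_eq_sum_single (τ x).1 L.toLinearMap v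

variable {τ : ∀ x : X, symAltTensors n l (TangentSpace 𝓘(ℂ, CSpace n) x)}

theorem differentiableOn_tensorEval_coordMap (hτ : τ ∈ globalSections n X l) (x₀ : X)
    {E : Type*} [NormedAddCommGroup E] [NormedSpace ℂ E] {U : Set E} {Y : E → CSpace n}
    {V : TensorIndex n l → E → CSpace n} (hY : DifferentiableOn ℂ Y U)
    (hYt : ∀ w ∈ U, Y w ∈ (chartAt (CSpace n) x₀).target)
    (hV : ∀ p, DifferentiableOn ℂ (V p) U) :
    DifferentiableOn ℂ (fun w => tensorEval τ ((chartAt (CSpace n) x₀).symm (Y w))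
      (fun p => coordMap x₀ (Y w) (V p w))) U := by
  refine DifferentiableOn.congr ?_ fun w _ => tensorEval_coordMap τ x₀ (Y w) fun p => V p w
  refine DifferentiableOn.fun_sum fun K _ => DifferentiableOn.mul ?_ ?_
  · classical
    have hVK : ∀ p, DifferentiableOn ℂ (fun w => V p w (K p)) U := fun p =>
      (EuclideanSpace.proj (𝕜 := ℂ) (K p)).differentiable.comp_differentiableOn (hV p)
    exact fun w hw => (HasFDerivWithinAt.finsetProd (u := Finset.univ)
      fun p _ => (hVK p w hw).hasFDerivWithinAt).differentiableWithinAt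
  · exact (hτ x₀ fun p => EuclideanSpace.single (K p) 1).comp hY hYt

variable [IsManifold 𝓘(ℂ, CSpace n) ω X]

theorem tensorEval_mfderiv_eq {E : Type*} [NormedAddCommGroup E] [NormedSpace ℂ E]
    (τ : ∀ x : X, symAltTensors n l (TangentSpace 𝓘(ℂ, CSpace n) x)) {F : E → X} {w : E} {x₀ : X}
    (hF : MDifferentiableAt 𝓘(ℂ, E) 𝓘(ℂ, CSpace n) F w)
    (hw : F w ∈ (chartAt (CSpace n) x₀).source) (u : TensorIndex n l → E) :
    tensorEval τ (F w) (fun p => mfderiv 𝓘(ℂ, E) 𝓘(ℂ, CSpace n) F w (u p)) =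
      tensorEval τ ((chartAt (CSpace n) x₀).symm (chartAt (CSpace n) x₀ (F w)))
        (fun p => coordMap x₀ (chartAt (CSpace n) x₀ (F w))
          (fderiv ℂ (fun w => chartAt (CSpace n) x₀ (F w)) w (u p))) := by
  rw [(chartAt (CSpace n) x₀).left_inv hw]
  congr 1
  ext1 p
  exact mfderiv_eq_coordMap hF hw (u p)

/-- In a chart the value is a polynomial in the partial derivatives of the map, with holomorphic
coefficients, and these partial derivatives are holomorphic. -/
theorem differentiableOn_tensorEval_mfderiv (hτ : τ ∈ globalSections n X l)
    {E : Type*} [NormedAddCommGroup E] [NormedSpace ℂ E] [FiniteDimensional ℂ E] {Ω : Set E}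
    (hΩ : IsOpen Ω) {F : E → X} (hF : MDifferentiableOn 𝓘(ℂ, E) 𝓘(ℂ, CSpace n) F Ω)
    (u : TensorIndex n l → E) :
    DifferentiableOn ℂ (fun w => tensorEval τ (F w)
      (fun p => mfderiv 𝓘(ℂ, E) 𝓘(ℂ, CSpace n) F w (u p))) Ω := by
  intro w hw
  set x₀ := F w
  obtain ⟨hO, hd⟩ := hF.differentiableOn_chart_comp hΩ x₀
  have hwO : w ∈ Ω ∩ F ⁻¹' (chartAt (CSpace n) x₀).source := ⟨hw, mem_chart_source _ _⟩
  have h1 := differentiableOn_tensorEval_coordMap hτ x₀ hd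
    (fun w hw => (chartAt (CSpace n) x₀).map_source hw.2)
    (fun p => hd.fderiv_apply_of_isOpen hO (u p))
  refine ((h1.differentiableAt (hO.mem_nhds hwO)).congr_of_eventuallyEq ?_).differentiableWithinAt
  filter_upwards [hO.mem_nhds hwO] with w' hw'
  exact tensorEval_mfderiv_eq τ (hF.mdifferentiableAt (hΩ.mem_nhds hw'.1)) hw'.2 u

/-- On a chart ball the coefficients are bounded and the coordinates of a vector are at most κ⁻¹
times its length. Finitely many such balls cover `X`; adding the constants bounds them all at once.
-/
theorem exists_tensorEval_bound [CompactSpace X] (h : HermitianMetric n X)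
    (hτ : τ ∈ globalSections n X l) :
    ∃ C : ℝ, 0 ≤ C ∧ ∀ x v, ‖tensorEval τ x v‖ ≤ C * ∏ p, √(h.normSq x (v p)) := by
  have hloc : ∀ x₀ : X, ∃ U ∈ 𝓝 x₀, ∃ C : ℝ, 0 ≤ C ∧ ∀ x ∈ U, ∀ v,
      ‖tensorEval τ x v‖ ≤ C * ∏ p, √(h.normSq x (v p)) := by
    intro x₀
    obtain ⟨δ, hδ, hδt, κ, hκ, hκle⟩ := h.exists_chart_ball x₀
    set φ := chartAt (CSpace n) x₀ with hφ
    have hcoef : ContinuousOn (fun y => ∑ K : TensorIndex n l → Fin n,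
        ‖tensorEval τ (φ.symm y) (fun p => coordMap x₀ y (EuclideanSpace.single (K p) 1))‖)
        (closedBall (φ x₀) δ) :=
      continuousOn_finsetSum _ fun K _ =>
        ((hτ x₀ fun p => EuclideanSpace.single (K p) 1).continuousOn.mono hδt).norm
    obtain ⟨C, hC⟩ := (isCompact_closedBall (φ x₀) δ).exists_bound_of_continuousOn hcoef
    have hC0 : 0 ≤ C := (norm_nonneg _).trans (hC _ (mem_closedBall_self hδ.le))
    refine ⟨φ.source ∩ φ ⁻¹' ball (φ x₀) δ, (isOpen_source_inter_preimage_ball x₀ _ δ).mem_nhds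
      ⟨mem_chart_source _ _, mem_ball_self hδ⟩, C * ∏ _p : TensorIndex n l, κ⁻¹, by positivity, ?_⟩
    rintro x ⟨hxs, hxb⟩ v
    set y := φ x with hy
    have hyt : y ∈ φ.target := φ.map_source hxs
    have hxy : φ.symm y = x := φ.left_inv hxs
    have hsurj : ∀ p, ∃ u, coordMap x₀ y u = v p := fun p => (coordMap_bijective x₀ hyt).2 (v p)
    choose u hu using hsurj
    have hv : v = fun p => coordMap x₀ y (u p) := funext fun p => (hu p).symm
    have hun : ∀ p, ‖u p‖ ≤ κ⁻¹ * √(h.normSq x (v p)) := by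
      intro p
      rw [le_inv_mul_iff₀ hκ]
      refine Real.le_sqrt_of_sq_le ?_
      rw [mul_pow, ← hu p, ← hxy]
      exact hκle y (ball_subset_closedBall hxb) (u p)
    calc ‖tensorEval τ x v‖ = ‖∑ K : TensorIndex n l → Fin n, (∏ p, u p (K p)) *
          tensorEval τ (φ.symm y) (fun p => coordMap x₀ y (EuclideanSpace.single (K p) 1))‖ := by
          rw [← tensorEval_coordMap, hxy, ← hv]
      _ ≤ ∑ K : TensorIndex n l → Fin n, (∏ p, ‖u p‖) *
          ‖tensorEval τ (φ.symm y) (fun p => coordMap x₀ y (EuclideanSpace.single (K p) 1))‖ := by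
          refine (norm_sum_le _ _).trans (Finset.sum_le_sum fun K _ => ?_)
          rw [norm_mul, norm_prod]
          gcongr with p
          exact PiLp.norm_apply_le (u p) (K p)
      _ = (∏ p, ‖u p‖) * ∑ K : TensorIndex n l → Fin n,
          ‖tensorEval τ (φ.symm y) (fun p => coordMap x₀ y (EuclideanSpace.single (K p) 1))‖ := by
          rw [Finset.mul_sum]
      _ ≤ (∏ p, (κ⁻¹ * √(h.normSq x (v p)))) * C := by
          gcongr with p
          · exact hun p
          · exact (le_abs_self _).trans (hC y (ball_subset_closedBall hxb))
      _ = _ := by rw [Finset.prod_mul_distrib]; ring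
  choose U hU C hC0 hC using hloc
  obtain ⟨t, ht⟩ := CompactSpace.elim_nhds_subcover U hU
  refine ⟨∑ x ∈ t, C x, Finset.sum_nonneg fun x _ => hC0 x, fun x v => ?_⟩
  have hx : x ∈ ⋃ i ∈ t, U i := by rw [ht]; exact mem_univ _
  obtain ⟨i, hi, hxi⟩ := mem_iUnion₂.1 hx
  refine (hC i x hxi v).trans ?_
  gcongr
  exact Finset.single_le_sum (f := C) (fun x _ => hC0 x) hi

/-- A holomorphic tensor field on a connected manifold which vanishes on a nonempty open set
vanishes. -/
theorem tensorEval_eq_zero_of_eventually [ConnectedSpace X] (hτ : τ ∈ globalSections n X l)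
    {x₁ : X} (h0 : ∀ᶠ x in 𝓝 x₁, ∀ v, tensorEval τ x v = 0) : τ = 0 := by
  set I : Set X := {x | ∀ᶠ y in 𝓝 x, ∀ v, tensorEval τ y v = 0} with hI
  have hIo : IsOpen I := isOpen_iff_mem_nhds.2 fun x hx => eventually_eventually_nhds.2 hx
  have hIc : IsClosed I := by
    rw [← closure_subset_iff_isClosed]
    intro x hx
    set φ := chartAt (CSpace n) x with hφ
    obtain ⟨δ, hδ, hδt⟩ := Metric.isOpen_iff.1 φ.open_target (φ x) (mem_chart_target _ _)
    have hball := isOpen_source_inter_preimage_ball x (φ x) (δ / 2)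
    have hxb : x ∈ φ.source ∩ φ ⁻¹' ball (φ x) (δ / 2) :=
      ⟨mem_chart_source _ _, mem_ball_self (by positivity)⟩
    obtain ⟨z, hzb, hzI⟩ := mem_closure_iff.1 hx _ hball hxb
    have hzt : φ z ∈ φ.target := φ.map_source hzb.1
    have hsub : ball (φ z) (δ / 2) ⊆ φ.target := by
      refine Subset.trans (fun y hy => ?_) hδt
      have h1 := mem_ball.1 hzb.2
      have h2 := mem_ball.1 hy
      exact mem_ball.2 ((dist_triangle _ _ _).trans_lt (by linarith))
    have hcoef : ∀ v : TensorIndex n l → CSpace n, ∀ y ∈ ball (φ z) (δ / 2),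
        tensorEval τ (φ.symm y) (fun p => coordMap x y (v p)) = 0 := by
      intro v
      refine DifferentiableOn.eqOn_zero_ball ((hτ x v).mono hsub) ?_
      have ht : Tendsto φ.symm (𝓝 (φ z)) (𝓝 z) := by
        have := (φ.symm.continuousAt hzt).tendsto
        rwa [φ.left_inv hzb.1] at this
      filter_upwards [ht.eventually hzI] with y hy
      exact hy _
    have hxz : φ x ∈ ball (φ z) (δ / 2) := by rw [mem_ball_comm]; exact hzb.2
    have hev : ∀ᶠ x' in 𝓝 x, x' ∈ φ.source ∩ φ ⁻¹' ball (φ z) (δ / 2) :=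
      (isOpen_source_inter_preimage_ball x (φ z) (δ / 2)).mem_nhds ⟨mem_chart_source _ _, hxz⟩
    filter_upwards [hev] with x' hx' v
    have hsurj : ∀ p, ∃ u, coordMap x (φ x') u = v p := fun p =>
      (coordMap_bijective x (φ.map_source hx'.1)).2 (v p)
    choose u hu using hsurj
    have := hcoef u (φ x') hx'.2
    rwa [φ.left_inv hx'.1, funext hu] at this
  rcases isClopen_iff.1 ⟨hIc, hIo⟩ with h | h
  · exact absurd (show x₁ ∈ I from h0) (by rw [h]; exact notMem_empty _)
  · ext x
    have hx : x ∈ I := by rw [h]; exact mem_univ _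
    have := (show ∀ᶠ y in 𝓝 x, ∀ v, tensorEval τ y v = 0 from hx).self_of_nhds
    exact this _

end Tensors

/-! ### Differentiating a circle integral in a parameter -/

section CircleDerivative

theorem hasDerivAt_circleIntegral_of_holomorphic {F : Type*} [NormedAddCommGroup F]
    [NormedSpace ℂ F] [CompleteSpace F] {V : Set ℂ} (hV : IsOpen V) {K : ℂ → ℂ → F} {c : ℂ} {R : ℝ}
    (hK : ContinuousOn (fun p : ℂ × ℂ => K p.1 p.2) (V ×ˢ sphere c |R|))
    (hd : ∀ ζ ∈ sphere c |R|, DifferentiableOn ℂ (fun x => K x ζ) V) {s : ℂ} (hs : s ∈ V) :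
    HasDerivAt (fun s => ∮ ζ in C(c, R), K s ζ) (∮ ζ in C(c, R), deriv (fun s => K s ζ) s) s := by
  have hK' : ContinuousOn (fun p : ℂ × ℝ => deriv (circleMap c R) p.2 • K p.1 (circleMap c R p.2))
      (V ×ˢ univ) := by
    refine ContinuousOn.smul ?_ ?_
    · simp only [deriv_circleMap]
      fun_prop
    · exact hK.comp (f := fun p : ℂ × ℝ => (p.1, circleMap c R p.2)) (by fun_prop)
        (fun p hp => ⟨hp.1, circleMap_mem_sphere' c R p.2⟩)
  have hd' : ∀ t : ℝ, DifferentiableOn ℂ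
      (fun x => deriv (circleMap c R) t • K x (circleMap c R t)) V := fun t =>
    (hd _ (circleMap_mem_sphere' c R t)).const_smul _
  have h1 := (hasFDerivAt_intervalIntegral_of_holomorphic hV hK' hd' hs 0
    (2 * Real.pi)).hasDerivAt
  have hc := continuousOn_fderiv_param hV hK' hd'
  have hcs : Continuous (fun t : ℝ => fderiv ℂ
      (fun x => deriv (circleMap c R) t • K x (circleMap c R t)) s) :=
    hc.comp_continuous (f := fun t : ℝ => (s, t)) (by fun_prop) (fun t => ⟨hs, mem_univ _⟩)
  rw [ContinuousLinearMap.intervalIntegral_apply (hcs.intervalIntegrable _ _)] at h1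
  refine h1.congr_deriv ?_
  unfold circleIntegral
  refine intervalIntegral.integral_congr fun t _ => ?_
  have hdt := (hd _ (circleMap_mem_sphere' c R t)).differentiableAt (hV.mem_nhds hs)
  simp only [fderiv_apply_one_eq_deriv]
  exact deriv_fun_const_smul _ hdt

end CircleDerivative

/-! ### Extension of the pull-back along almost all lines -/

section Extension

variable {n m : ℕ} {X : Type*} [TopologicalSpace X] [ChartedSpace (CSpace n) X]
  [IsManifold 𝓘(ℂ, CSpace n) ω X]

/-- The lines through `a` on which `F` maps a closed annulus into a chart ball. -/
def annulusDomain (n : ℕ) {m : ℕ} {X : Type*} [TopologicalSpace X] [ChartedSpace (CSpace n) X]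
    (F : CSpace m → X) (Ω : Set (CSpace m)) (a : CSpace m) (i : X) (δ : ℝ) (c : ℂ)
    (R₀ R₁ : ℝ) : Set (CSpace m) :=
  {z | ∀ w : ℂ, R₀ ≤ ‖w - c‖ → ‖w - c‖ ≤ R₁ → a + w • z ∈ Ω ∧ F (a + w • z) ∈
    (chartAt (CSpace n) i).source ∩ chartAt (CSpace n) i ⁻¹' ball (chartAt (CSpace n) i i) δ}

/-- The Cauchy integral of `F` along a circle in the line through `a` in the direction `z`. -/
noncomputable def lineCauchy (F : CSpace m → X) (a : CSpace m) (i : X) (c : ℂ) (R : ℝ)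
    (z : CSpace m) (w : ℂ) : CSpace n :=
  (2 * Real.pi * Complex.I : ℂ)⁻¹ •
    ∮ ζ in C(c, R), (ζ - w)⁻¹ • chartAt (CSpace n) i (F (a + ζ • z))

variable {F : CSpace m → X} {Ω : Set (CSpace m)} {a : CSpace m} {i : X} {δ : ℝ} {c : ℂ} {R₀ R₁ : ℝ}

/-- The closed annulus is compact, so the condition survives a small change of direction. -/
theorem isOpen_annulusDomain (hΩ : IsOpen Ω)
    (hF : MDifferentiableOn 𝓘(ℂ, CSpace m) 𝓘(ℂ, CSpace n) F Ω) :
    IsOpen (annulusDomain n F Ω a i δ c R₀ R₁) := by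
  have hnc : Continuous (fun w : ℂ => ‖w - c‖) := by fun_prop
  have hBcomp : IsCompact {w : ℂ | R₀ ≤ ‖w - c‖ ∧ ‖w - c‖ ≤ R₁} :=
    (isCompact_closedBall c R₁).of_isClosed_subset
      ((isClosed_le continuous_const hnc).inter (isClosed_le hnc continuous_const))
      (fun w hw => mem_closedBall_iff_norm.2 hw.2)
  set W : Set (CSpace m) := Ω ∩ F ⁻¹' ((chartAt (CSpace n) i).source ∩
    chartAt (CSpace n) i ⁻¹' ball (chartAt (CSpace n) i i) δ) with hW
  have hWo : IsOpen W :=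
    hF.continuousOn.isOpen_inter_preimage hΩ (isOpen_source_inter_preimage_ball i _ δ)
  rw [isOpen_iff_mem_nhds]
  intro z hz
  have hlc : Continuous (fun q : CSpace m × ℂ => a + q.2 • q.1) := by fun_prop
  have : ∀ᶠ z' in 𝓝 z, ∀ w ∈ {w : ℂ | R₀ ≤ ‖w - c‖ ∧ ‖w - c‖ ≤ R₁}, a + w • z' ∈ W := by
    refine hBcomp.eventually_forall_of_forall_eventually fun w hw => ?_
    exact (hWo.preimage hlc).mem_nhds (hz w hw.1 hw.2)
  filter_upwards [this] with z' hz' w hw1 hw2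
  exact hz' w ⟨hw1, hw2⟩

theorem sphere_subset_of_mem_annulusDomain (hR₁ : 0 < R₁) (hR : R₀ < R₁) {z : CSpace m}
    (hz : z ∈ annulusDomain n F Ω a i δ c R₀ R₁) {ζ : ℂ} (hζ : ζ ∈ sphere c |R₁|) :
    a + ζ • z ∈ Ω ∩ F ⁻¹' (chartAt (CSpace n) i).source := by
  have : ‖ζ - c‖ = R₁ := by rw [← abs_of_pos hR₁]; exact mem_sphere_iff_norm.1 hζ
  have := hz ζ (by rw [this]; exact hR.le) this.le
  exact ⟨this.1, this.2.1⟩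

theorem sub_ne_zero_of_mem_sphere (hR₁ : 0 < R₁) {w ζ : ℂ} (hw : ‖w - c‖ < R₁)
    (hζ : ζ ∈ sphere c |R₁|) : ζ - w ≠ 0 := by
  intro h0
  have h1 : ‖ζ - c‖ = R₁ := by rw [← abs_of_pos hR₁]; exact mem_sphere_iff_norm.1 hζ
  rw [sub_eq_zero.1 h0] at h1
  exact hw.ne h1

theorem differentiableOn_lineCauchy (hΩ : IsOpen Ω)
    (hF : MDifferentiableOn 𝓘(ℂ, CSpace m) 𝓘(ℂ, CSpace n) F Ω) (hR₁ : 0 < R₁) (hR : R₀ < R₁)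
    {w : ℂ} (hw : ‖w - c‖ < R₁) :
    DifferentiableOn ℂ (fun z => lineCauchy (n := n) F a i c R₁ z w)
      (annulusDomain n F Ω a i δ c R₀ R₁) := by
  obtain ⟨hO, hd⟩ := hF.differentiableOn_chart_comp hΩ i
  refine DifferentiableOn.fun_const_smul (c := (2 * Real.pi * Complex.I : ℂ)⁻¹)
    (differentiableOn_circleIntegral_of_holomorphic (isOpen_annulusDomain hΩ hF)
      (K := fun z ζ => (ζ - w)⁻¹ • chartAt (CSpace n) i (F (a + ζ • z))) ?_ ?_)
  · refine ContinuousOn.fun_smul ?_ ?_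
    · exact ContinuousOn.inv₀ (by fun_prop) fun p hp => sub_ne_zero_of_mem_sphere hR₁ hw hp.2
    · exact hd.continuousOn.comp (f := fun p : CSpace m × ℂ => a + p.2 • p.1) (by fun_prop)
        fun p hp => sphere_subset_of_mem_annulusDomain hR₁ hR hp.1 hp.2
  · intro ζ hζ
    exact (hd.comp (f := fun z : CSpace m => a + ζ • z) (by fun_prop)
      fun z hz => sphere_subset_of_mem_annulusDomain hR₁ hR hz hζ).fun_const_smul _

theorem differentiableOn_cauchy_transform {G : Type*} [NormedAddCommGroup G] [NormedSpace ℂ G]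
    [CompleteSpace G] (hR₁ : 0 < R₁) {k : ℂ → G} (hk : ContinuousOn k (sphere c |R₁|)) :
    DifferentiableOn ℂ (fun w => ∮ ζ in C(c, R₁), (ζ - w)⁻¹ • k ζ) (ball c R₁) := by
  refine differentiableOn_circleIntegral_of_holomorphic isOpen_ball
    (K := fun w ζ => (ζ - w)⁻¹ • k ζ) ?_ ?_
  · refine ContinuousOn.fun_smul ?_ (hk.comp continuousOn_snd fun p hp => hp.2)
    exact ContinuousOn.inv₀ (by fun_prop) fun p hp =>
      sub_ne_zero_of_mem_sphere hR₁ (mem_ball_iff_norm.1 hp.1) hp.2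
  · intro ζ hζ
    refine DifferentiableOn.smul_const ?_ _
    exact DifferentiableOn.inv (by fun_prop) fun w hw =>
      sub_ne_zero_of_mem_sphere hR₁ (mem_ball_iff_norm.1 hw) hζ

theorem continuousOn_chart_line_sphere (hΩ : IsOpen Ω)
    (hF : MDifferentiableOn 𝓘(ℂ, CSpace m) 𝓘(ℂ, CSpace n) F Ω) (hR₁ : 0 < R₁) (hR : R₀ < R₁)
    {z : CSpace m} (hz : z ∈ annulusDomain n F Ω a i δ c R₀ R₁) :
    ContinuousOn (fun ζ : ℂ => chartAt (CSpace n) i (F (a + ζ • z))) (sphere c |R₁|) :=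
  (hF.differentiableOn_chart_comp hΩ i).2.continuousOn.comp (f := fun ζ : ℂ => a + ζ • z)
    (by fun_prop) fun _ hζ => sphere_subset_of_mem_annulusDomain hR₁ hR hz hζ

/-- For almost all directions: if the restriction of `F` to the annulus extends over the disc, the
same holds for all neighbouring directions. -/
theorem ae_eventually_eq_lineCauchy (hΩ : IsOpen Ω)
    (hF : MDifferentiableOn 𝓘(ℂ, CSpace m) 𝓘(ℂ, CSpace n) F Ω) (hR₁ : 0 < R₁) (hR : R₀ < R₁) :
    ∀ᵐ z : CSpace m, z ∈ annulusDomain n F Ω a i δ c R₀ R₁ →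
      (∀ w, R₀ < ‖w - c‖ → ‖w - c‖ < R₁ →
        chartAt (CSpace n) i (F (a + w • z)) = lineCauchy F a i c R₁ z w) →
      ∀ᶠ z' in 𝓝 z, z' ∈ annulusDomain n F Ω a i δ c R₀ R₁ ∧ ∀ w, R₀ < ‖w - c‖ → ‖w - c‖ < R₁ →
        chartAt (CSpace n) i (F (a + w • z')) = lineCauchy F a i c R₁ z' w := by
  obtain ⟨hO, hd⟩ := hF.differentiableOn_chart_comp hΩ i
  -- The obstruction to extending over the disc, holomorphic in the direction `z` for each fixed
  -- `w`.
  set D : ℂ → CSpace m → CSpace n := fun w z =>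
    chartAt (CSpace n) i (F (a + w • z)) - lineCauchy F a i c R₁ z w with hD
  have hDd : ∀ w, R₀ < ‖w - c‖ → ‖w - c‖ < R₁ →
      DifferentiableOn ℂ (D w) (annulusDomain n F Ω a i δ c R₀ R₁) := by
    intro w hw1 hw2
    refine DifferentiableOn.sub ?_ (differentiableOn_lineCauchy hΩ hF hR₁ hR hw2)
    refine hd.comp (f := fun z : CSpace m => a + w • z) (by fun_prop) fun z hz => ?_
    have := hz w hw1.le hw2.le
    exact ⟨this.1, this.2.1⟩
  -- An exceptional null set of directions is discarded for each `w` of a countable dense set only;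
  -- continuity in `w` recovers the other points of the annulus.
  obtain ⟨Q, hQc, hQd⟩ := TopologicalSpace.exists_countable_dense ℂ
  have hae : ∀ᵐ z : CSpace m, ∀ w ∈ Q, R₀ < ‖w - c‖ → ‖w - c‖ < R₁ →
      z ∈ annulusDomain n F Ω a i δ c R₀ R₁ → D w z = 0 → ∀ᶠ y in 𝓝 z, D w y = 0 := by
    rw [ae_ball_iff hQc]
    intro w _
    by_cases hw : R₀ < ‖w - c‖ ∧ ‖w - c‖ < R₁
    · have := volume_zeros_diff_interior (isOpen_annulusDomain hΩ hF) (hDd w hw.1 hw.2)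
      rw [← compl_mem_ae_iff] at this
      filter_upwards [this] with z hz _ _ hzO hz0
      by_contra hcon
      exact hz ⟨hzO, hz0, hcon⟩
    · exact Eventually.of_forall fun z h1 h2 => (hw ⟨h1, h2⟩).elim
  filter_upwards [hae] with z hz hzO hz0
  obtain ⟨r, hr, hball⟩ := Metric.isOpen_iff.1 (isOpen_annulusDomain hΩ hF) z hzO
  filter_upwards [ball_mem_nhds z hr] with z' hz'
  refine ⟨hball hz', ?_⟩
  have hQ0 : ∀ w ∈ Q, R₀ < ‖w - c‖ → ‖w - c‖ < R₁ → D w z' = 0 := by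
    intro w hwQ hw1 hw2
    exact ((hDd w hw1 hw2).mono hball).eqOn_zero_ball
      (hz w hwQ hw1 hw2 hzO (sub_eq_zero.2 (hz0 w hw1 hw2))) z' hz'
  have hnc : Continuous (fun w : ℂ => ‖w - c‖) := by fun_prop
  have hAo : IsOpen {w : ℂ | R₀ < ‖w - c‖ ∧ ‖w - c‖ < R₁} :=
    (isOpen_lt continuous_const hnc).inter (isOpen_lt hnc continuous_const)
  have hDc : ContinuousOn (fun w => D w z') {w : ℂ | R₀ < ‖w - c‖ ∧ ‖w - c‖ < R₁} := by
    refine ContinuousOn.sub ?_ ?_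
    · refine hd.continuousOn.comp (f := fun w : ℂ => a + w • z') (by fun_prop) fun w hw => ?_
      have := hball hz' w hw.1.le hw.2.le
      exact ⟨this.1, this.2.1⟩
    · refine ContinuousOn.const_smul (c := (2 * Real.pi * Complex.I : ℂ)⁻¹) ?_
      exact (differentiableOn_cauchy_transform hR₁ (continuousOn_chart_line_sphere hΩ hF hR₁ hR
        (hball hz'))).continuousOn.mono fun w hw => mem_ball_iff_norm.2 hw.2
  intro w hw1 hw2
  have hmem : w ∈ closure ({w : ℂ | R₀ < ‖w - c‖ ∧ ‖w - c‖ < R₁} ∩ Q) :=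
    hQd.open_subset_closure_inter hAo ⟨hw1, hw2⟩
  have hcl : w ∈ {w : ℂ | R₀ < ‖w - c‖ ∧ ‖w - c‖ < R₁} := ⟨hw1, hw2⟩
  have h0 : D w z' ∈ closure ((fun w => D w z') ''
      ({w : ℂ | R₀ < ‖w - c‖ ∧ ‖w - c‖ < R₁} ∩ Q)) :=
    ((hDc w hcl).mono inter_subset_left).mem_closure_image hmem
  have hsub : (fun w => D w z') '' ({w : ℂ | R₀ < ‖w - c‖ ∧ ‖w - c‖ < R₁} ∩ Q) ⊆ {0} := by
    rintro _ ⟨u, ⟨hu, huQ⟩, rfl⟩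
    exact hQ0 u huQ hu.1 hu.2
  have h1 := closure_mono hsub h0
  rw [closure_singleton] at h1
  exact sub_eq_zero.1 h1

variable {l : Fin n → ℕ} {τ : ∀ x : X, symAltTensors n l (TangentSpace 𝓘(ℂ, CSpace n) x)}

/-- The pull-back of a tensor extends over the disc, if this holds for `F` in all neighbouring
directions. -/
theorem exists_extension_pullback (hτ : τ ∈ globalSections n X l) (hΩ : IsOpen Ω)
    (hF : MDifferentiableOn 𝓘(ℂ, CSpace m) 𝓘(ℂ, CSpace n) F Ω) (hR₀ : 0 < R₀) (hR : R₀ < R₁)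
    (hc : R₁ < ‖c‖)
    (hδt : closedBall (chartAt (CSpace n) i i) δ ⊆ (chartAt (CSpace n) i).target)
    (u : TensorIndex n l → CSpace m) {z : CSpace m}
    (hz : ∀ᶠ z' in 𝓝 z, z' ∈ annulusDomain n F Ω a i δ c R₀ R₁ ∧ ∀ w, R₀ < ‖w - c‖ → ‖w - c‖ < R₁ →
        chartAt (CSpace n) i (F (a + w • z')) = lineCauchy F a i c R₁ z' w) :
    ∃ g : ℂ → ℂ, DifferentiableOn ℂ g (ball c R₁) ∧ ∀ w, R₀ < ‖w - c‖ → ‖w - c‖ < R₁ →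
      tensorEval τ (F (a + w • z)) (fun p => mfderiv 𝓘(ℂ, CSpace m) 𝓘(ℂ, CSpace n) F
        (a + w • z) (u p)) = g w := by
  have hR₁ : 0 < R₁ := hR₀.trans hR
  obtain ⟨hO, hd⟩ := hF.differentiableOn_chart_comp hΩ i
  set φ := chartAt (CSpace n) i with hφ
  set Y : CSpace m → CSpace n := fun x => φ (F x) with hY
  obtain ⟨hzO, hz0⟩ := hz.self_of_nhds
  have hmem : ∀ w, R₀ ≤ ‖w - c‖ → ‖w - c‖ ≤ R₁ → a + w • z ∈ Ω ∩ F ⁻¹' φ.source :=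
    fun w h1 h2 => ⟨(hzO w h1 h2).1, (hzO w h1 h2).2.1⟩
  have hfc := hd.continuousOn_fderiv_of_isOpen hO
  -- the extensions of the coordinates and of the derivatives
  set Yh : ℂ → CSpace n := fun w => lineCauchy F a i c R₁ z w with hYh
  set V : CSpace m → ℂ → CSpace n := fun e w => w⁻¹ • (2 * Real.pi * Complex.I : ℂ)⁻¹ •
    ∮ ζ in C(c, R₁), (ζ - w)⁻¹ • (ζ • fderiv ℂ Y (a + ζ • z) e) with hV
  have hYhd : DifferentiableOn ℂ Yh (ball c R₁) :=
    (differentiableOn_cauchy_transform hR₁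
      (continuousOn_chart_line_sphere hΩ hF hR₁ hR hzO)).const_smul
        (2 * Real.pi * Complex.I : ℂ)⁻¹
  -- `R₁ < ‖c‖` keeps 0, the parameter of `a`, out of the disc, so that division by `w` is harmless.
  have hw0 : ∀ w ∈ ball c R₁, w ≠ 0 := by
    rintro w hw rfl
    rw [mem_ball_iff_norm, zero_sub, norm_neg] at hw
    exact lt_asymm hw hc
  have hVd : ∀ e, DifferentiableOn ℂ (V e) (ball c R₁) := by
    intro e
    refine DifferentiableOn.fun_smul (DifferentiableOn.inv (by fun_prop) hw0) ?_
    refine DifferentiableOn.fun_const_smul (differentiableOn_cauchy_transform hR₁ ?_) _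
    refine ContinuousOn.fun_smul continuousOn_id ?_
    refine (hfc.comp (f := fun ζ : ℂ => a + ζ • z) (by fun_prop) fun ζ hζ =>
      sphere_subset_of_mem_annulusDomain hR₁ hR hzO hζ).clm_apply continuousOn_const
  -- Move the direction `z` along `e` and differentiate the Cauchy formula, which holds for all
  -- nearby directions. The left side gives w · dY(e), the right side the Cauchy integral of ζ ·
  -- dY(e); hence the factor `w⁻¹` in `V`.
  have hVeq : ∀ e w, R₀ < ‖w - c‖ → ‖w - c‖ < R₁ → fderiv ℂ Y (a + w • z) e = V e w := by
    intro e w hw1 hw2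
    have hwne : w ≠ 0 := hw0 w (mem_ball_iff_norm.2 hw2)
    have htz : Tendsto (fun s : ℂ => z + s • e) (𝓝 0) (𝓝 z) := by
      have : Continuous (fun s : ℂ => z + s • e) := by fun_prop
      simpa using this.tendsto 0
    set W : Set ℂ := interior {s : ℂ | z + s • e ∈ annulusDomain n F Ω a i δ c R₀ R₁} with hW
    have hW0 : (0 : ℂ) ∈ W := mem_interior_iff_mem_nhds.2 ((htz.eventually hz).mono fun s hs => hs.1)
    have hWmem : ∀ s ∈ W, z + s • e ∈ annulusDomain n F Ω a i δ c R₀ R₁ :=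
      fun s hs => interior_subset (s := {s : ℂ | z + s • e ∈ annulusDomain n F Ω a i δ c R₀ R₁}) hs
    have hline : ∀ ζ : ℂ, ∀ s, a + ζ • (z + s • e) ∈ Ω ∩ F ⁻¹' φ.source →
        HasDerivAt (fun s : ℂ => Y (a + ζ • (z + s • e)))
          (ζ • fderiv ℂ Y (a + ζ • (z + s • e)) e) s := by
      intro ζ s hs
      have h1 : HasDerivAt (fun s : ℂ => a + ζ • (z + s • e)) (ζ • e) s := by
        have := ((((hasDerivAt_id s).smul_const e).const_add z).const_smul ζ).const_add a
        simpa using this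
      have h2 := (hd.differentiableAt (hO.mem_nhds hs)).hasFDerivAt.comp_hasDerivAt s h1
      rwa [map_smul] at h2
    have hL : HasDerivAt (fun s : ℂ => Y (a + w • (z + s • e)))
        (w • fderiv ℂ Y (a + w • z) e) 0 := by
      have := hline w 0 (by simpa using hmem w hw1.le hw2.le)
      simpa using this
    have hRR : HasDerivAt (fun s : ℂ => (2 * Real.pi * Complex.I : ℂ)⁻¹ •
        ∮ ζ in C(c, R₁), (ζ - w)⁻¹ • Y (a + ζ • (z + s • e)))
        ((2 * Real.pi * Complex.I : ℂ)⁻¹ •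
          ∮ ζ in C(c, R₁), (ζ - w)⁻¹ • (ζ • fderiv ℂ Y (a + ζ • z) e)) 0 := by
      have h3 := hasDerivAt_circleIntegral_of_holomorphic (V := W) isOpen_interior
        (K := fun s ζ => (ζ - w)⁻¹ • Y (a + ζ • (z + s • e))) (c := c) (R := R₁) ?_ ?_ hW0
      · refine HasDerivAt.fun_const_smul _ (h3.congr_deriv ?_)
        refine circleIntegral.integral_congr hR₁.le fun ζ hζ => ?_
        have hζ' : ζ ∈ sphere c |R₁| := by rwa [abs_of_pos hR₁]
        have h4 := hline ζ 0
          (by simpa using sphere_subset_of_mem_annulusDomain hR₁ hR hzO hζ')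
        have h5 := (h4.fun_const_smul (ζ - w)⁻¹).deriv
        simpa using h5
      · refine ContinuousOn.fun_smul ?_ ?_
        · exact ContinuousOn.inv₀ (by fun_prop) fun p hp => sub_ne_zero_of_mem_sphere hR₁ hw2 hp.2
        · exact hd.continuousOn.comp (f := fun p : ℂ × ℂ => a + p.2 • (z + p.1 • e)) (by fun_prop)
            fun p hp => sphere_subset_of_mem_annulusDomain hR₁ hR (hWmem _ hp.1) hp.2
      · intro ζ hζ
        refine DifferentiableOn.fun_const_smul ?_ _
        exact hd.comp (f := fun s : ℂ => a + ζ • (z + s • e)) (by fun_prop)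
          fun s hs => sphere_subset_of_mem_annulusDomain hR₁ hR (hWmem s hs) hζ
    have hev : (fun s : ℂ => Y (a + w • (z + s • e))) =ᶠ[𝓝 0]
        fun s : ℂ => (2 * Real.pi * Complex.I : ℂ)⁻¹ •
        ∮ ζ in C(c, R₁), (ζ - w)⁻¹ • Y (a + ζ • (z + s • e)) := by
      filter_upwards [htz.eventually hz] with s hs
      exact hs.2 w hw1 hw2
    have heq := hL.unique (hRR.congr_of_eventuallyEq hev)
    rw [hV]
    simp only
    rw [← heq, smul_smul, inv_mul_cancel₀ hwne, one_smul]
  have hYht : ∀ w ∈ ball c R₁, Yh w ∈ φ.target := by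
    intro w hw
    refine hδt ?_
    rw [mem_closedBall_iff_norm]
    have hann : ∀ w, R₀ < ‖w - c‖ → ‖w - c‖ < R₁ → ‖Yh w - φ i‖ ≤ δ := by
      intro w h1 h2
      have h3 := mem_ball_iff_norm.1 (hzO w h1.le h2.le).2.2
      rw [hz0 w h1 h2] at h3
      exact h3.le
    by_cases hw1 : R₀ < ‖w - c‖
    · exact hann w hw1 (mem_ball_iff_norm.1 hw)
    -- Maximum principle: the circle of mean radius lies in the annulus, where the values are known
    -- to be in the δ-ball.
    · set ρ := (R₀ + R₁) / 2 with hρ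
      have hρ0 : ρ ≠ 0 := by rw [hρ]; positivity
      have hdc : DiffContOnCl ℂ (fun w => Yh w - φ i) (ball c ρ) := by
        refine DifferentiableOn.diffContOnCl ?_
        rw [closure_ball c hρ0]
        exact (hYhd.sub_const _).mono (closedBall_subset_ball (by rw [hρ]; linarith))
      refine Complex.norm_le_of_forall_mem_frontier_norm_le isBounded_ball hdc ?_ ?_
      · intro v hv
        rw [frontier_ball c hρ0] at hv
        have hv' := mem_sphere_iff_norm.1 hv
        exact hann v (by rw [hv', hρ]; linarith) (by rw [hv', hρ]; linarith)
      · refine subset_closure (mem_ball_iff_norm.2 ?_)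
        rw [hρ]
        linarith [not_lt.1 hw1]
  refine ⟨fun w => tensorEval τ (φ.symm (Yh w)) (fun p => coordMap i (Yh w) (V (u p) w)),
    differentiableOn_tensorEval_coordMap hτ i hYhd hYht (fun p => hVd (u p)), ?_⟩
  intro w hw1 hw2
  have hm := hmem w hw1.le hw2.le
  rw [tensorEval_mfderiv_eq τ (x₀ := i) (hF.mdifferentiableAt (hΩ.mem_nhds hm.1)) hm.2 u]
  have h1 : φ (F (a + w • z)) = Yh w := hz0 w hw1 hw2
  rw [← hφ, h1]
  congr 1
  ext1 p
  rw [← hVeq (u p) w hw1 hw2]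

/-- If `F` extends continuously over the punctures of almost all lines through `a`, so does the
pull-back of a holomorphic tensor. -/
theorem ae_exists_tendsto_pullback [CompactSpace X] (hτ : τ ∈ globalSections n X l)
    (hΩ : IsOpen Ω) (hF : MDifferentiableOn 𝓘(ℂ, CSpace m) 𝓘(ℂ, CSpace n) F Ω) (ha : a ∈ Ω)
    (hline : ∀ z : CSpace m, ∀ w₀ : ℂ, ∀ᶠ w in 𝓝[≠] w₀, a + w • z ∈ Ω)
    (hlim : ∀ᵐ z : CSpace m, ∀ w₀ : ℂ, ∃ p, Tendsto (fun w : ℂ => F (a + w • z)) (𝓝[≠] w₀) (𝓝 p))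
    (u : TensorIndex n l → CSpace m) :
    ∀ᵐ z : CSpace m, ∀ w₀ : ℂ, ∃ L : ℂ, Tendsto (fun w : ℂ => tensorEval τ (F (a + w • z))
      (fun p => mfderiv 𝓘(ℂ, CSpace m) 𝓘(ℂ, CSpace n) F (a + w • z) (u p))) (𝓝[≠] w₀) (𝓝 L) := by
  have hballs : ∀ i : X, ∃ δ > 0, closedBall (chartAt (CSpace n) i i) δ ⊆
      (chartAt (CSpace n) i).target := fun i => Metric.nhds_basis_closedBall.mem_iff.1
    ((chartAt (CSpace n) i).open_target.mem_nhds (mem_chart_target (CSpace n) i))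
  choose δ hδ hδt using hballs
  obtain ⟨t, ht⟩ := CompactSpace.elim_nhds_subcover
    (fun i : X => (chartAt (CSpace n) i).source ∩
      chartAt (CSpace n) i ⁻¹' ball (chartAt (CSpace n) i i) (δ i))
    (fun i => (isOpen_source_inter_preimage_ball i _ (δ i)).mem_nhds
      ⟨mem_chart_source _ _, mem_ball_self (hδ i)⟩)
  obtain ⟨Q, hQc, hQd⟩ := TopologicalSpace.exists_countable_dense ℂ
  -- Only countably many data occur: finitely many charts, centres in a countable dense set, radii
  -- 1/(k+1) and 4/(k+1). So one null set of directions serves all singular points of all lines.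
  have hae : ∀ᵐ z : CSpace m, ∀ i ∈ t, ∀ c ∈ Q, ∀ k : ℕ,
      z ∈ annulusDomain n F Ω a i (δ i) c (1 / ((k : ℝ) + 1)) (4 * (1 / ((k : ℝ) + 1))) →
      (∀ w, 1 / ((k : ℝ) + 1) < ‖w - c‖ → ‖w - c‖ < 4 * (1 / ((k : ℝ) + 1)) →
        chartAt (CSpace n) i (F (a + w • z)) =
          lineCauchy F a i c (4 * (1 / ((k : ℝ) + 1))) z w) →
      ∀ᶠ z' in 𝓝 z,
        z' ∈ annulusDomain n F Ω a i (δ i) c (1 / ((k : ℝ) + 1)) (4 * (1 / ((k : ℝ) + 1))) ∧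
        ∀ w, 1 / ((k : ℝ) + 1) < ‖w - c‖ → ‖w - c‖ < 4 * (1 / ((k : ℝ) + 1)) →
        chartAt (CSpace n) i (F (a + w • z')) =
          lineCauchy F a i c (4 * (1 / ((k : ℝ) + 1))) z' w := by
    have htc : (t : Set X).Countable := t.countable_toSet
    refine (ae_ball_iff htc).2 fun i _ => (ae_ball_iff hQc).2 fun c _ => ae_all_iff.2 fun k => ?_
    have hk : 0 < 1 / ((k : ℝ) + 1) := by positivity
    exact ae_eventually_eq_lineCauchy hΩ hF (by positivity) (by linarith)
  filter_upwards [hlim, hae] with z hzlim hzae w₀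
  have hξ := differentiableOn_tensorEval_mfderiv hτ hΩ hF u
  -- Here the line passes through `a`, where the pull-back is continuous anyway; the division by `w`
  -- in the general case excludes this point.
  by_cases hw₀ : w₀ = 0
  · subst hw₀
    have hlc : ContinuousAt (fun w : ℂ => a + w • z) 0 := by fun_prop
    have h1 := (hξ.continuousOn.continuousAt (hΩ.mem_nhds (show a + (0 : ℂ) • z ∈ Ω by simpa)))
    have h2 := ContinuousAt.comp (f := fun w : ℂ => a + w • z) (x := (0 : ℂ)) h1 hlc
    exact ⟨_, h2.tendsto.mono_left nhdsWithin_le_nhds⟩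
  obtain ⟨p, hp⟩ := hzlim w₀
  have hpi : p ∈ ⋃ i ∈ t, (chartAt (CSpace n) i).source ∩
      chartAt (CSpace n) i ⁻¹' ball (chartAt (CSpace n) i i) (δ i) := by rw [ht]; exact mem_univ _
  obtain ⟨i, hit, hpi⟩ := mem_iUnion₂.1 hpi
  have hev : ∀ᶠ w in 𝓝[≠] w₀, a + w • z ∈ Ω ∧ F (a + w • z) ∈ (chartAt (CSpace n) i).source ∩
      chartAt (CSpace n) i ⁻¹' ball (chartAt (CSpace n) i i) (δ i) :=
    (hline z w₀).and (hp.eventually ((isOpen_source_inter_preimage_ball i _ (δ i)).mem_nhds hpi))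
  rw [eventually_nhdsWithin_iff] at hev
  obtain ⟨ρ₁, hρ₁, hball⟩ := Metric.eventually_nhds_iff_ball.1 hev
  -- Bounded by ‖w₀‖ so that the disc of radius 4R around `c`, with R < ρ/8 and ‖w₀ - c‖ < R, avoids
  -- 0.
  set ρ := min ρ₁ ‖w₀‖ with hρ
  have hρpos : 0 < ρ := lt_min hρ₁ (norm_pos_iff.2 hw₀)
  obtain ⟨k, hk⟩ := exists_nat_one_div_lt (show 0 < ρ / 8 by positivity)
  set R := 1 / ((k : ℝ) + 1) with hRdef
  have hRpos : 0 < R := by rw [hRdef]; positivity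
  obtain ⟨c, hcw, hcQ⟩ := hQd.inter_open_nonempty _ isOpen_ball
    ⟨w₀, mem_ball_self hRpos⟩
  have hcw' : ‖w₀ - c‖ < R := by rw [norm_sub_rev]; exact mem_ball_iff_norm.1 hcw
  have hin : ∀ w, ‖w - c‖ ≤ 4 * R → w ≠ w₀ → a + w • z ∈ Ω ∧
      F (a + w • z) ∈ (chartAt (CSpace n) i).source ∩
      chartAt (CSpace n) i ⁻¹' ball (chartAt (CSpace n) i i) (δ i) := by
    intro w hw hne
    refine hball w (mem_ball_iff_norm.2 ?_) hne
    calc ‖w - w₀‖ = ‖(w - c) - (w₀ - c)‖ := by congr 1; abel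
      _ ≤ ‖w - c‖ + ‖w₀ - c‖ := norm_sub_le _ _
      _ < ρ := by linarith
      _ ≤ ρ₁ := min_le_left _ _
  have hc4 : 4 * R < ‖c‖ := by
    have h1 : ‖w₀‖ ≤ ‖w₀ - c‖ + ‖c‖ := by
      calc ‖w₀‖ = ‖(w₀ - c) + c‖ := by rw [sub_add_cancel]
        _ ≤ _ := norm_add_le _ _
    have h2 : ρ ≤ ‖w₀‖ := min_le_right _ _
    linarith
  have hzO : z ∈ annulusDomain n F Ω a i (δ i) c R (4 * R) := by
    intro w h1 h2
    refine hin w h2 ?_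
    rintro rfl
    exact absurd hcw' (not_lt.2 h1)
  -- the Cauchy formula for the extension
  have hcauchy : ∀ w, R < ‖w - c‖ → ‖w - c‖ < 4 * R →
      chartAt (CSpace n) i (F (a + w • z)) = lineCauchy F a i c (4 * R) z w := by
    intro w h1 h2
    have hww₀ : w ≠ w₀ := by rintro rfl; exact lt_asymm h1 hcw'
    set k₀ : ℂ → CSpace n := fun w => chartAt (CSpace n) i (F (a + w • z)) with hk₀
    -- Filling in the limit makes the map continuous on the closed disc, and Cauchy's formula
    -- tolerates one point without differentiability.
    set k₁ : ℂ → CSpace n := Function.update k₀ w₀ (chartAt (CSpace n) i p) with hk₁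
    have hdiff : ∀ w, ‖w - c‖ ≤ 4 * R → w ≠ w₀ → DifferentiableAt ℂ k₀ w := by
      intro w hw hne
      have hm := hin w hw hne
      have h3 := (hF.mdifferentiableAt (hΩ.mem_nhds hm.1)).differentiableAt_chart_comp hm.2.1
      exact h3.comp (f := fun w : ℂ => a + w • z) w (by fun_prop)
    have hk₁ev : ∀ w, w ≠ w₀ → k₁ =ᶠ[𝓝 w] k₀ := by
      intro w hne
      filter_upwards [isOpen_ne.mem_nhds hne] with v hv
      exact Function.update_of_ne hv _ _
    have hcont : ContinuousOn k₁ (closedBall c (4 * R)) := by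
      intro w hw
      rw [mem_closedBall_iff_norm] at hw
      by_cases hne : w = w₀
      · subst hne
        refine ContinuousAt.continuousWithinAt ?_
        rw [hk₁, continuousAt_update_same]
        exact (((chartAt (CSpace n) i).continuousAt hpi.1).tendsto.comp hp)
      · exact ((hdiff w hw hne).continuousAt.congr (hk₁ev w hne).symm).continuousWithinAt
    have hC := Complex.two_pi_I_inv_smul_circleIntegral_sub_inv_smul_of_differentiable_on_off_countable
      (countable_singleton w₀) (mem_ball_iff_norm.2 h2) hcont
      (fun v hv => (hdiff v (mem_ball_iff_norm.1 hv.1).le hv.2).congr_of_eventuallyEq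
        (hk₁ev v hv.2))
    rw [hk₁, Function.update_of_ne hww₀] at hC
    rw [lineCauchy]
    change k₀ w = _
    rw [← hC]
    congr 1
    refine circleIntegral.integral_congr (by positivity) fun ζ hζ => ?_
    have hne : ζ ≠ w₀ := by
      rintro rfl
      have := mem_sphere_iff_norm.1 hζ
      linarith
    simp only [Function.update_of_ne hne, hk₀]
  have hnear := hzae i hit c hcQ k hzO hcauchy
  obtain ⟨g, hgd, hg⟩ := exists_extension_pullback hτ hΩ hF hRpos (by linarith) hc4 (hδt i) u hnear
  -- identity theorem on the punctured disc
  set ξ : CSpace m → ℂ := fun x => tensorEval τ (F x)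
    (fun p => mfderiv 𝓘(ℂ, CSpace m) 𝓘(ℂ, CSpace n) F x (u p)) with hξdef
  set P : Set ℂ := {w | 0 < ‖w - w₀‖ ∧ ‖w - w₀‖ < 3 * R} with hP
  have hnc : Continuous (fun w : ℂ => ‖w - w₀‖) := by fun_prop
  have hPo : IsOpen P := (isOpen_lt continuous_const hnc).inter (isOpen_lt hnc continuous_const)
  have hPc : ∀ w ∈ P, ‖w - c‖ < 4 * R := by
    intro w hw
    calc ‖w - c‖ = ‖(w - w₀) + (w₀ - c)‖ := by congr 1; abel
      _ ≤ ‖w - w₀‖ + ‖w₀ - c‖ := norm_add_le _ _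
      _ < 4 * R := by linarith [hw.2]
  have hPne : ∀ w ∈ P, w ≠ w₀ := fun w hw => sub_ne_zero.1 (norm_pos_iff.1 hw.1)
  have hξan : AnalyticOnNhd ℂ (fun w : ℂ => ξ (a + w • z)) P :=
    hξ.analyticOnNhd_comp_line hΩ a z hPo fun w hw => (hin w (hPc w hw).le (hPne w hw)).1
  have hgan : AnalyticOnNhd ℂ g P :=
    (hgd.analyticOnNhd isOpen_ball).mono fun w hw => mem_ball_iff_norm.2 (hPc w hw)
  -- A point of the punctured disc at distance more than 3R/2 from `c`, thus in the annulus where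
  -- `g` is known to be the pull-back.
  have hw₁ : w₀ + ((5 / 2 * R : ℝ) : ℂ) ∈ P := by
    have : ‖w₀ + ((5 / 2 * R : ℝ) : ℂ) - w₀‖ = 5 / 2 * R := by
      rw [add_sub_cancel_left, Complex.norm_real, Real.norm_of_nonneg (by positivity)]
    exact ⟨by rw [this]; positivity, by rw [this]; linarith⟩
  have hw₁R : R < ‖w₀ + ((5 / 2 * R : ℝ) : ℂ) - c‖ := by
    have h1 : ‖((5 / 2 * R : ℝ) : ℂ)‖ = 5 / 2 * R := by
      rw [Complex.norm_real, Real.norm_of_nonneg (by positivity)]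
    have h2 : ‖((5 / 2 * R : ℝ) : ℂ)‖ ≤ ‖w₀ + ((5 / 2 * R : ℝ) : ℂ) - c‖ + ‖w₀ - c‖ := by
      calc ‖((5 / 2 * R : ℝ) : ℂ)‖ = ‖(w₀ + ((5 / 2 * R : ℝ) : ℂ) - c) - (w₀ - c)‖ := by
            congr 1; ring
        _ ≤ _ := norm_sub_le _ _
    linarith
  have heq : EqOn (fun w : ℂ => ξ (a + w • z)) g P := by
    refine hξan.eqOn_of_preconnected_of_eventuallyEq hgan (isPreconnected_annulus w₀ le_rfl) hw₁ ?_
    have hncc : Continuous (fun w : ℂ => ‖w - c‖) := by fun_prop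
    filter_upwards [(isOpen_lt continuous_const hncc).mem_nhds hw₁R, hPo.mem_nhds hw₁] with w h1 h2
    exact hg w h1 (hPc w h2)
  refine ⟨g w₀, ?_⟩
  have hgc : ContinuousAt g w₀ := hgd.continuousOn.continuousAt
    (isOpen_ball.mem_nhds (mem_ball_iff_norm.2 (by linarith)))
  refine (hgc.tendsto.mono_left nhdsWithin_le_nhds).congr' ?_
  refine eventually_nhdsWithin_iff.2 ?_
  filter_upwards [ball_mem_nhds w₀ (show 0 < 3 * R by positivity)] with w hw hne
  exact (heq ⟨norm_pos_iff.2 (sub_ne_zero.2 hne), mem_ball_iff_norm.1 hw⟩).symm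

end Extension

/-! ### Non-degeneracy: the pull-back of a non-zero tensor is non-zero -/

section Nonzero

variable {n m : ℕ} {X : Type*} [TopologicalSpace X] [ChartedSpace (CSpace n) X]
  [IsManifold 𝓘(ℂ, CSpace n) ω X] {l : Fin n → ℕ}
  {τ : ∀ x : X, symAltTensors n l (TangentSpace 𝓘(ℂ, CSpace n) x)}

/-- A tensor whose pull-back by a differentiably non-degenerate map vanishes is zero. -/
theorem exists_pullback_ne_zero [ConnectedSpace X] (hmn : n ≤ m) (f : MeromorphicMap n X m)
    (hf : f.DifferentiablyNondegenerate) (hτ : τ ∈ globalSections n X l) (hτ0 : τ ≠ 0) :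
    ∃ a ∉ f.S, ∃ J : TensorIndex n l → Fin m, tensorEval τ (f.toFun a)
      (fun p => mfderiv 𝓘(ℂ, CSpace m) 𝓘(ℂ, CSpace n) f.toFun a
        (EuclideanSpace.single (J p) 1)) ≠ 0 := by
  by_contra! hcon
  refine hτ0 ?_
  have hΩ : IsOpen (f.Sᶜ) := f.analytic_S.isClosed.isOpen_compl
  have hF := f.holomorphic
  have hall : ∀ a ∉ f.S, ∀ u : TensorIndex n l → CSpace m, tensorEval τ (f.toFun a)
      (fun p => mfderiv 𝓘(ℂ, CSpace m) 𝓘(ℂ, CSpace n) f.toFun a (u p)) = 0 := by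
    intro a ha u
    exact (tensorEval_comp_linear τ (f.toFun a)
      (mfderiv 𝓘(ℂ, CSpace m) 𝓘(ℂ, CSpace n) f.toFun a) u).trans
      (Finset.sum_eq_zero fun J _ => mul_eq_zero_of_right _ (hcon a ha J))
  set D : Set (CSpace m) := {z | z ∉ f.S ∧
    Module.finrank ℂ (LinearMap.range (f.differential z).toLinearMap) = min m n} with hD
  have hsurj : ∀ a ∈ D, Function.Surjective
      (mfderiv 𝓘(ℂ, CSpace m) 𝓘(ℂ, CSpace n) f.toFun a : CSpace m → CSpace n) := by
    intro a ha
    have h1 : Module.finrank ℂ (LinearMap.range (f.differential a).toLinearMap) = n := by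
      rw [ha.2, min_eq_right hmn]
    have key : ∀ L : CSpace m →L[ℂ] CSpace n,
        Module.finrank ℂ (LinearMap.range L.toLinearMap) = n → Function.Surjective L := by
      intro L hL
      have : LinearMap.range L.toLinearMap = ⊤ :=
        Submodule.eq_top_of_finrank_eq (by rw [hL, finrank_euclideanSpace_fin])
      exact LinearMap.range_eq_top.1 this
    exact key _ h1
  have hzero : ∀ a ∈ D, ∀ v, tensorEval τ (f.toFun a) v = 0 := by
    intro a ha v
    choose u hu using fun p => hsurj a ha (v p)
    have := hall a ha.1 u
    simp only [hu] at this
    exact this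
  obtain ⟨a₀, ha₀⟩ := Dense.nonempty hf
  change a₀ ∈ D at ha₀
  set x₀ := f.toFun a₀ with hx₀
  set φ := chartAt (CSpace n) x₀ with hφ
  obtain ⟨hO, hd⟩ := hF.differentiableOn_chart_comp hΩ x₀
  set O := f.Sᶜ ∩ f.toFun ⁻¹' φ.source with hOdef
  set Y : CSpace m → CSpace n := fun w => φ (f.toFun w) with hY
  have ha₀O : a₀ ∈ O := ⟨ha₀.1, mem_chart_source _ _⟩
  have hcoef : ∀ K : TensorIndex n l → Fin n, ∀ w ∈ O, tensorEval τ (φ.symm (Y w))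
      (fun p => coordMap x₀ (Y w) (EuclideanSpace.single (K p) 1)) = 0 := by
    intro K
    have hc := (differentiableOn_tensorEval_coordMap hτ x₀ hd
      (fun w hw => φ.map_source hw.2) (V := fun p _ => EuclideanSpace.single (K p) (1 : ℂ))
      (fun p => differentiableOn_const _)).continuousOn
    -- The coefficients vanish where the differential is onto; this set is dense, so by continuity
    -- they vanish on all of `O`.
    have hsub : O ⊆ closure (O ∩ D) := fun w hw => Dense.open_subset_closure_inter hf hO hw
    have h0 : EqOn (fun w => tensorEval τ (φ.symm (Y w))
        (fun p => coordMap x₀ (Y w) (EuclideanSpace.single (K p) 1))) 0 (O ∩ D) := by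
      intro w hw
      have : φ.symm (Y w) = f.toFun w := φ.left_inv hw.1.2
      simp only [this]
      exact hzero w hw.2 _
    exact h0.of_subset_closure hc continuousOn_const inter_subset_left hsub
  have hO0 : ∀ w ∈ O, ∀ v, tensorEval τ (f.toFun w) v = 0 := by
    intro w hw v
    choose u hu using fun p => (coordMap_bijective x₀ (φ.map_source hw.2)).2 (v p)
    have h1 : φ.symm (Y w) = f.toFun w := φ.left_inv hw.2
    have h2 := tensorEval_coordMap τ x₀ (Y w) u
    rw [Finset.sum_eq_zero fun K _ => by rw [hcoef K w hw, mul_zero], h1] at h2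
    rw [← h2]
    congr 1
    ext1 p
    exact (hu p).symm
  have hfd : HasStrictFDerivAt Y (fderiv ℂ Y a₀) a₀ := by
    refine hasStrictFDerivAt_of_hasFDerivAt_of_continuousAt ?_
      ((hd.continuousOn_fderiv_of_isOpen hO).continuousAt (hO.mem_nhds ha₀O))
    filter_upwards [hO.mem_nhds ha₀O] with w hw
    exact (hd.differentiableAt (hO.mem_nhds hw)).hasFDerivAt
  have hfds : LinearMap.range (fderiv ℂ Y a₀).toLinearMap = ⊤ := by
    refine LinearMap.range_eq_top.2 fun v => ?_
    obtain ⟨u, hu⟩ := hsurj a₀ ha₀ (coordMap x₀ (Y a₀) v)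
    refine ⟨u, (coordMap_bijective x₀ (φ.map_source ha₀O.2)).1 ?_⟩
    rw [← hu]
    exact (mfderiv_eq_coordMap (hF.mdifferentiableAt (hΩ.mem_nhds ha₀.1)) ha₀O.2 u).symm
  -- A submersion is open, so the image of a neighbourhood of `a₀` fills a neighbourhood of `x₀`.
  have hmap := hfd.map_nhds_eq_of_surj hfds
  have hev : ∀ᶠ y in 𝓝 (φ x₀), ∀ v, tensorEval τ (φ.symm y) v = 0 := by
    have h1 : ∀ᶠ y in map Y (𝓝 a₀), ∀ v, tensorEval τ (φ.symm y) v = 0 := by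
      rw [eventually_map]
      filter_upwards [hO.mem_nhds ha₀O] with w hw v
      have h1 : φ.symm (Y w) = f.toFun w := φ.left_inv hw.2
      rw [h1]
      exact hO0 w hw v
    rwa [hmap] at h1
  refine tensorEval_eq_zero_of_eventually hτ (x₁ := x₀) ?_
  have hcφ : ContinuousAt φ x₀ := φ.continuousAt (mem_chart_source _ _)
  filter_upwards [hcφ.eventually hev, φ.open_source.mem_nhds (mem_chart_source _ x₀)] with x hx hxs
  rwa [φ.left_inv hxs] at hx

end Nonzero

/-! ### Signs and block permutations in a wedge product of 2-forms -/

section BlockPermutations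

variable {m : ℕ}

/-- If all pairs but one are mapped to pairs, so is the last one, since otherwise some block of two
would receive three points. Then σ permutes whole blocks, which is an even permutation as it acts on
two copies, and also acts inside each block. -/
theorem exists_block_perm {σ : Equiv.Perm (Fin m × Fin 2)} {i₀ : Fin m}
    (hσ : ∀ i ≠ i₀, (σ (i, 0)).1 = (σ (i, 1)).1) :
    ∃ (π : Equiv.Perm (Fin m)) (ε : Fin m → Equiv.Perm (Fin 2)),
      (∀ i s, σ (i, s) = (π i, ε i s)) ∧
      Equiv.Perm.sign σ = ∏ i, Equiv.Perm.sign (ε i) := by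
  have hthree : ∀ p q r : Fin m × Fin 2, p.1 = q.1 → q.1 = r.1 → p ≠ q → q ≠ r → p ≠ r → False := by
    rintro ⟨j, s⟩ ⟨k, t⟩ ⟨i, u⟩ h1 h2 h3 h4 h5
    dsimp only at h1 h2
    subst h1 h2
    simp only [ne_eq, Prod.mk.injEq, true_and] at h3 h4 h5
    omega
  have h01 : ∀ i, σ (i, 0) ≠ σ (i, 1) := fun i h => by simpa using σ.injective h
  have hne : ∀ {i i'} (s t : Fin 2), i ≠ i' → σ (i, s) ≠ σ (i', t) := fun s t hii h => by
    have := σ.injective h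
    simp only [Prod.mk.injEq] at this
    exact hii this.1
  have hblock : ∀ i, (σ (i, 0)).1 = (σ (i, 1)).1 := by
    intro i
    by_cases hi : i = i₀
    · subst hi
      -- The point mapped to the partner of `σ (i, 0)` in its block; in `Fin 2` the partner of `s`
      -- is `1 - s`.
      obtain ⟨⟨i', t⟩, hit⟩ := σ.surjective ((σ (i, 0)).1, 1 - (σ (i, 0)).2)
      by_cases hii : i' = i
      · subst hii
        have ht : t = 1 := by
          by_contra ht
          have ht0 : t = 0 := by omega
          subst ht0
          have := congrArg Prod.snd hit
          simp only at this
          omega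
        subst ht
        rw [hit]
      · have hb : (σ (i', t)).1 = (σ (i, 0)).1 := by rw [hit]
        have h0 : (σ (i', 0)).1 = (σ (i, 0)).1 := by
          fin_cases t
          · exact hb
          · exact (hσ i' hii).trans hb
        exact (hthree _ _ _ h0.symm (hσ i' hii) (hne _ _ (Ne.symm hii)) (h01 i')
          (hne _ _ (Ne.symm hii))).elim
    · exact hσ i hi
  have hfst : ∀ i s, (σ (i, s)).1 = (σ (i, 0)).1 := by
    intro i s
    fin_cases s
    · rfl
    · exact (hblock i).symm
  have hπ : Function.Injective (fun i => (σ (i, 0)).1) := by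
    intro i i' hii
    by_contra hcon
    exact hthree _ _ _ hii (hblock i') (hne _ _ hcon) (h01 i') (hne _ _ hcon)
  have hε : ∀ i, Function.Injective (fun s => (σ (i, s)).2) := by
    intro i s t hst
    have : σ (i, s) = σ (i, t) := Prod.ext ((hfst i s).trans (hfst i t).symm) hst
    simpa using σ.injective this
  set π : Equiv.Perm (Fin m) := Equiv.ofBijective _ (Finite.injective_iff_bijective.1 hπ) with hπd
  set ε : Fin m → Equiv.Perm (Fin 2) := fun i =>
    Equiv.ofBijective _ (Finite.injective_iff_bijective.1 (hε i)) with hεd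
  have hform : ∀ i s, σ (i, s) = (π i, ε i s) := fun i s => Prod.ext (hfst i s) rfl
  refine ⟨π, ε, hform, ?_⟩
  have hσeq : σ = (Equiv.prodCongrLeft fun _ : Fin 2 => π) * Equiv.prodCongrRight ε := by
    ext1 ⟨i, s⟩
    rw [hform i s]
    rfl
  rw [hσeq, map_mul, Equiv.Perm.sign_prodCongrLeft, Equiv.Perm.sign_prodCongrRight]
  simp

variable {B : Fin m → Fin m × Fin 2 → Fin m × Fin 2 → ℝ} {i₀ : Fin m}

/-- A swap inside a block changes the sign of σ and, by antisymmetry, the sign of one factor; the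
two changes cancel. -/
theorem sign_mul_prod_eq_of_block
    (hanti : ∀ i j, B i (j, 1) (j, 0) = -B i (j, 0) (j, 1))
    {σ : Equiv.Perm (Fin m × Fin 2)} {π : Equiv.Perm (Fin m)} {ε : Fin m → Equiv.Perm (Fin 2)}
    (hσ : ∀ i s, σ (i, s) = (π i, ε i s))
    (hsign : Equiv.Perm.sign σ = ∏ i, Equiv.Perm.sign (ε i)) :
    ((Equiv.Perm.sign σ : ℤ) : ℝ) * ∏ i, B i (σ (i, 0)) (σ (i, 1)) =
      ∏ i, B i (π i, 0) (π i, 1) := by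
  have hB : ∀ i, B i (σ (i, 0)) (σ (i, 1)) =
      ((Equiv.Perm.sign (ε i) : ℤ) : ℝ) * B i (π i, 0) (π i, 1) := by
    intro i
    rw [hσ, hσ]
    have : ε i = 1 ∨ ε i = Equiv.swap 0 1 := by
      generalize ε i = e
      revert e
      decide
    rcases this with h | h
    · simp [h]
    · have hs : Equiv.Perm.sign (Equiv.swap (0 : Fin 2) 1) = -1 := by decide
      rw [h, hs, Equiv.swap_apply_left, Equiv.swap_apply_right, hanti]
      simp
  rw [Finset.prod_congr rfl fun i _ => hB i, Finset.prod_mul_distrib, hsign]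
  push_cast
  rw [← mul_assoc, ← Finset.prod_mul_distrib]
  rw [Finset.prod_eq_one, one_mul]
  intro i _
  rcases Int.units_eq_one_or (Equiv.Perm.sign (ε i)) with h | h <;> simp [h]

/-- Lower bound for the antisymmetrization of a product of forms of type `(1,1)`, all but one of
which are diagonal. -/
theorem sum_swap_le_sum_perm
    (hanti : ∀ i j, B i (j, 1) (j, 0) = -B i (j, 0) (j, 1))
    (hpos : ∀ i j, 0 ≤ B i (j, 0) (j, 1))
    (hdiag : ∀ i ≠ i₀, ∀ p q, p.1 ≠ q.1 → B i p q = 0) :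
    ∑ j, ∏ i, B i (Equiv.swap i₀ j i, 0) (Equiv.swap i₀ j i, 1) ≤
      ∑ σ : Equiv.Perm (Fin m × Fin 2),
        ((Equiv.Perm.sign σ : ℤ) : ℝ) * ∏ i, B i (σ (i, 0)) (σ (i, 1)) := by
  set term : Equiv.Perm (Fin m × Fin 2) → ℝ := fun σ =>
    ((Equiv.Perm.sign σ : ℤ) : ℝ) * ∏ i, B i (σ (i, 0)) (σ (i, 1)) with hterm
  -- Permutations that break a pair other than the one at `i₀` contribute 0, the others a product of
  -- non-negative numbers. So the sum is bounded below by any partial sum, here over the block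
  -- transpositions (i₀ j).
  have hnonneg : ∀ σ, 0 ≤ term σ := by
    intro σ
    by_cases hσ : ∀ i ≠ i₀, (σ (i, 0)).1 = (σ (i, 1)).1
    · obtain ⟨π, ε, h1, h2⟩ := exists_block_perm hσ
      rw [hterm]
      dsimp only
      rw [sign_mul_prod_eq_of_block hanti h1 h2]
      exact Finset.prod_nonneg fun i _ => hpos _ _
    · push Not at hσ
      obtain ⟨i, hi, hne⟩ := hσ
      have : ∏ i, B i (σ (i, 0)) (σ (i, 1)) = 0 :=
        Finset.prod_eq_zero (Finset.mem_univ i) (hdiag i hi _ _ hne)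
      simp [hterm, this]
  set s : Fin m → Equiv.Perm (Fin m × Fin 2) := fun j =>
    Equiv.prodCongrLeft fun _ : Fin 2 => Equiv.swap i₀ j with hs
  have hsapp : ∀ j i t, s j (i, t) = (Equiv.swap i₀ j i, (1 : Equiv.Perm (Fin 2)) t) :=
    fun j i t => rfl
  have hsinj : Function.Injective s := by
    intro j k hjk
    have := congrArg (fun σ : Equiv.Perm (Fin m × Fin 2) => (σ (i₀, 0)).1) hjk
    simpa [hsapp] using this
  have hsterm : ∀ j, term (s j) = ∏ i, B i (Equiv.swap i₀ j i, 0) (Equiv.swap i₀ j i, 1) := by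
    intro j
    refine sign_mul_prod_eq_of_block (ε := fun _ => 1) hanti (hsapp j) ?_
    rw [hs]
    dsimp only
    rw [Equiv.Perm.sign_prodCongrLeft]
    simp
  calc _ = ∑ j, term (s j) := Finset.sum_congr rfl fun j _ => (hsterm j).symm
    _ = ∑ σ ∈ Finset.univ.map ⟨s, hsinj⟩, term σ := by rw [Finset.sum_map]; rfl
    _ ≤ ∑ σ, term σ :=
        Finset.sum_le_sum_of_subset_of_nonneg (Finset.subset_univ _) fun σ _ _ => hnonneg σ

end BlockPermutations

/-! ### Energy density, the form f^*ω ∧ α^{m-1}, and the size of the pull-back -/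

section Density

variable {n m : ℕ} {X : Type*} [TopologicalSpace X] [ChartedSpace (CSpace n) X]

theorem HermitianMetric.normSq_smul (h : HermitianMetric n X) (x : X) (c : ℂ) (v : CSpace n) :
    h.normSq x (c • v) = ‖c‖ ^ 2 * h.normSq x v := by
  have key : ∀ B : CSpace n →ₗ⋆[ℂ] CSpace n →ₗ[ℂ] ℂ,
      (B (c • v) (c • v)).re = ‖c‖ ^ 2 * (B v v).re := by
    intro B
    rw [map_smul, LinearMap.map_smulₛₗ, LinearMap.smul_apply, smul_eq_mul, smul_eq_mul, ← mul_assoc,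
      Complex.mul_conj, Complex.re_ofReal_mul, Complex.normSq_eq_norm_sq]
  exact key (h.form x)

/-- The parallelogram law, with the square of the difference dropped. -/
theorem HermitianMetric.normSq_add_le (h : HermitianMetric n X) (x : X) (u v : CSpace n) :
    h.normSq x (u + v) ≤ 2 * (h.normSq x u + h.normSq x v) := by
  have key : ∀ B : CSpace n →ₗ⋆[ℂ] CSpace n →ₗ[ℂ] ℂ,
      (B (u + v) (u + v)).re + (B (u - v) (u - v)).re = 2 * ((B u u).re + (B v v).re) := by
    intro B
    simp only [map_add, map_sub, LinearMap.add_apply, LinearMap.sub_apply, Complex.add_re,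
      Complex.sub_re]
    ring
  have h1 := key (h.form x)
  have h2 := h.normSq_nonneg x (u - v)
  have h3 : h.normSq x (u + v) + h.normSq x (u - v) = 2 * (h.normSq x u + h.normSq x v) := h1
  linarith

theorem HermitianMetric.normSq_sum_le {ι : Type*} (h : HermitianMetric n X) (x : X) (s : Finset ι)
    (a : ι → CSpace n) : h.normSq x (∑ j ∈ s, a j) ≤ 2 ^ s.card * ∑ j ∈ s, h.normSq x (a j) := by
  classical
  induction s using Finset.induction_on with
  | empty =>
    have := h.normSq_smul x 0 0
    simp only [smul_zero, norm_zero, ne_eq, OfNat.ofNat_ne_zero, not_false_eq_true, zero_pow,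
      zero_mul] at this
    simp [this]
  | insert i s hi ih =>
    rw [Finset.sum_insert hi, Finset.sum_insert hi, Finset.card_insert_of_notMem hi, pow_succ]
    have h1 := h.normSq_add_le x (a i) (∑ j ∈ s, a j)
    have h2 : (1 : ℝ) ≤ 2 ^ s.card := one_le_pow₀ one_le_two
    have h3 := h.normSq_nonneg x (a i)
    nlinarith [mul_nonneg (sub_nonneg.2 h2) h3]

/-- The energy density of a map: the sum of the squared norms of its partial derivatives. -/
noncomputable def HermitianMetric.energy (h : HermitianMetric n X) (F : CSpace m → X)
    (z : CSpace m) : ℝ :=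
  ∑ j, h.normSq (F z) (mfderiv 𝓘(ℂ, CSpace m) 𝓘(ℂ, CSpace n) F z (EuclideanSpace.single j 1))

theorem HermitianMetric.energy_nonneg (h : HermitianMetric n X) (F : CSpace m → X)
    (z : CSpace m) : 0 ≤ h.energy F z :=
  Finset.sum_nonneg fun _ _ => h.normSq_nonneg _ _

theorem HermitianMetric.normSq_mfderiv_le_energy (h : HermitianMetric n X) (F : CSpace m → X)
    (z v : CSpace m) :
    h.normSq (F z) (mfderiv 𝓘(ℂ, CSpace m) 𝓘(ℂ, CSpace n) F z v) ≤
      2 ^ m * ‖v‖ ^ 2 * h.energy F z := by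
  have key : ∀ L : CSpace m →L[ℂ] CSpace n, h.normSq (F z) (L v) ≤ 2 ^ m * ‖v‖ ^ 2 *
      ∑ j, h.normSq (F z) (L (EuclideanSpace.single j 1)) := by
    intro L
    have h1 : L v = ∑ j, v j • L (EuclideanSpace.single j (1 : ℂ)) := by
      conv_lhs => rw [euclidean_eq_sum_single v]
      simp
    rw [h1]
    refine (h.normSq_sum_le _ _ _).trans ?_
    rw [Finset.card_univ, Fintype.card_fin, mul_assoc, Finset.mul_sum (a := ‖v‖ ^ 2)]
    refine mul_le_mul_of_nonneg_left (Finset.sum_le_sum fun j _ => ?_) (by positivity)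
    rw [h.normSq_smul]
    refine mul_le_mul_of_nonneg_right ?_ (h.normSq_nonneg _ _)
    exact pow_le_pow_left₀ (norm_nonneg _) (PiLp.norm_apply_le v j) 2
  exact key _

theorem alphaForm_stdRealBasis_of_ne {p q : Fin m × Fin 2} (hpq : p.1 ≠ q.1) :
    alphaForm m (stdRealBasis m p) (stdRealBasis m q) = 0 := by
  rw [alphaForm, Finset.sum_eq_zero, zero_div]
  intro j _
  simp only [stdRealBasis, PiLp.single_apply]
  by_cases h1 : j = p.1
  · have h2 : j ≠ q.1 := h1 ▸ hpq
    simp [h2]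
  · simp [h1]

theorem alphaForm_stdRealBasis (j : Fin m) :
    alphaForm m (stdRealBasis m (j, 0)) (stdRealBasis m (j, 1)) = 1 / Real.pi := by
  rw [alphaForm, Finset.sum_eq_single j]
  · simp [stdRealBasis]
  · intro k _ hk
    simp [stdRealBasis, hk]
  · simp

theorem alphaForm_swap (u v : CSpace m) : alphaForm m v u = -alphaForm m u v := by
  rw [alphaForm, alphaForm, ← neg_div, ← Finset.sum_neg_distrib]
  congr 1
  exact Finset.sum_congr rfl fun j _ => by ring

theorem metricForm_swap (h : HermitianMetric n X) (x : X) (u v : TangentSpace 𝓘(ℂ, CSpace n) x) :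
    h.metricForm x v u = -h.metricForm x u v := by
  rw [HermitianMetric.metricForm, HermitianMetric.metricForm, ← h.conj_symm x u v, Complex.conj_im,
    neg_div]

/-- Linearity in the second variable gives Im h(v, iv) = h(v, v), and `L` commutes with
multiplication by i. This is the positivity of ω on complex lines. -/
theorem metricForm_smul_I (h : HermitianMetric n X) (x : X) (L : CSpace m →L[ℂ] CSpace n)
    (j : Fin m) :
    h.metricForm x (L (stdRealBasis m (j, 0))) (L (stdRealBasis m (j, 1))) =
      h.normSq x (L (EuclideanSpace.single j 1)) / Real.pi := by
  have h0 : stdRealBasis m (j, 0) = EuclideanSpace.single j 1 := by simp [stdRealBasis]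
  have h1 : stdRealBasis m (j, 1) = Complex.I • EuclideanSpace.single j (1 : ℂ) := by
    ext k
    simp [stdRealBasis]
  have key : ∀ B : CSpace n →ₗ⋆[ℂ] CSpace n →ₗ[ℂ] ℂ, ∀ v, (B v (Complex.I • v)).im = (B v v).re := by
    intro B v
    rw [map_smul, smul_eq_mul, Complex.I_mul_im]
  rw [h0, h1, map_smul]
  exact congrArg (· / Real.pi) (key (h.form x) _)

/-- In the standard basis α is block diagonal with entries 1/π. The block transposition that gives
f^*ω the j-th coordinate line contributes the squared length of ∂f/∂z_j times π^{-m}; all other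
permutations contribute non-negatively. -/
theorem MeromorphicMap.energy_le_pullbackDensity (f : MeromorphicMap n X m)
    (h : HermitianMetric n X) (hm : 0 < m) (z : CSpace m) :
    (1 / 2 ^ m * (1 / Real.pi) ^ m) * h.energy f.toFun z ≤ f.pullbackDensity h z := by
  rw [MeromorphicMap.pullbackDensity, wedgeTwoForms, mul_assoc]
  refine mul_le_mul_of_nonneg_left ?_ (by positivity)
  set β : Fin m → CSpace m → CSpace m → ℝ := fun i => if (i : ℕ) = 0
      then fun u v => h.metricForm (f.toFun z) (f.differential z u) (f.differential z v)
      else alphaForm m with hβ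
  set i₀ : Fin m := ⟨0, hm⟩ with hi₀
  have hβ0 : ∀ u v, β i₀ u v =
      h.metricForm (f.toFun z) (f.differential z u) (f.differential z v) := fun u v => by
    simp [hβ, hi₀]
  have hβ1 : ∀ i ≠ i₀, β i = alphaForm m := by
    intro i hi
    have : (i : ℕ) ≠ 0 := fun h0 => hi (Fin.ext h0)
    simp [hβ, this]
  have hβ0' : ∀ j, β i₀ (stdRealBasis m (j, 0)) (stdRealBasis m (j, 1)) =
      h.normSq (f.toFun z) (mfderiv 𝓘(ℂ, CSpace m) 𝓘(ℂ, CSpace n) f.toFun z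
        (EuclideanSpace.single j 1)) / Real.pi := by
    intro j
    rw [hβ0]
    exact metricForm_smul_I h (f.toFun z) (f.differential z) j
  refine le_trans ?_ (sum_swap_le_sum_perm (i₀ := i₀)
    (B := fun i p q => β i (stdRealBasis m p) (stdRealBasis m q)) ?_ ?_ ?_)
  · rw [HermitianMetric.energy, Finset.mul_sum]
    refine Finset.sum_le_sum fun j _ => le_of_eq ?_
    rw [← Finset.mul_prod_erase _ _ (Finset.mem_univ i₀), Equiv.swap_apply_left, hβ0']
    rw [Finset.prod_congr rfl (g := fun _ => 1 / Real.pi) fun i hi => by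
      rw [hβ1 i (Finset.ne_of_mem_erase hi), alphaForm_stdRealBasis]]
    rw [Finset.prod_const, Finset.card_erase_of_mem (Finset.mem_univ _), Finset.card_univ,
      Fintype.card_fin]
    obtain ⟨k, rfl⟩ : ∃ k, m = k + 1 := ⟨m - 1, by omega⟩
    rw [Nat.add_sub_cancel, pow_succ]
    ring
  · intro i j
    by_cases hi : i = i₀
    · subst hi
      rw [hβ0, hβ0]
      exact metricForm_swap h _ _ _
    · rw [hβ1 i hi]
      exact alphaForm_swap _ _
  · intro i j
    by_cases hi : i = i₀
    · subst hi
      rw [hβ0']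
      exact div_nonneg (h.normSq_nonneg _ _) Real.pi_pos.le
    · rw [hβ1 i hi, alphaForm_stdRealBasis]
      positivity
  · intro i hi p q hpq
    rw [hβ1 i hi]
    exact alphaForm_stdRealBasis_of_ne hpq

/-- The pull-back of a tensor in `N` arguments is bounded by the energy to the power `N / 2`. -/
theorem exists_norm_pullback_rpow_le_energy [IsManifold 𝓘(ℂ, CSpace n) ω X] [CompactSpace X]
    {l : Fin n → ℕ}
    {τ : ∀ x : X, symAltTensors n l (TangentSpace 𝓘(ℂ, CSpace n) x)} (h : HermitianMetric n X)
    (hτ : τ ∈ globalSections n X l) (hN : 0 < Fintype.card (TensorIndex n l)) :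
    ∃ C : ℝ, 0 ≤ C ∧ ∀ (F : CSpace m → X) (z : CSpace m) (J : TensorIndex n l → Fin m),
      ‖tensorEval τ (F z) (fun p => mfderiv 𝓘(ℂ, CSpace m) 𝓘(ℂ, CSpace n) F z
        (EuclideanSpace.single (J p) 1))‖ ^ (2 / (Fintype.card (TensorIndex n l) : ℝ)) ≤
        C * h.energy F z := by
  obtain ⟨C, hC, hbound⟩ := exists_tensorEval_bound h hτ
  set N := Fintype.card (TensorIndex n l) with hNdef
  have hN' : (0 : ℝ) < N := by exact_mod_cast hN
  refine ⟨C ^ (2 / (N : ℝ)), by positivity, fun F z J => ?_⟩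
  have hE := h.energy_nonneg F z
  have h1 := (hbound (F z) (fun p => mfderiv 𝓘(ℂ, CSpace m) 𝓘(ℂ, CSpace n) F z
        (EuclideanSpace.single (J p) 1)))
  have h2 : ∏ p, √(h.normSq (F z) (mfderiv 𝓘(ℂ, CSpace m) 𝓘(ℂ, CSpace n) F z
        (EuclideanSpace.single (J p) 1))) ≤ √(h.energy F z) ^ N := by
    rw [hNdef, ← Finset.card_univ, ← Finset.prod_const]
    refine Finset.prod_le_prod (fun p _ => Real.sqrt_nonneg _) fun p _ => Real.sqrt_le_sqrt ?_
    exact Finset.single_le_sum (f := fun j => h.normSq (F z)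
      (mfderiv 𝓘(ℂ, CSpace m) 𝓘(ℂ, CSpace n) F z (EuclideanSpace.single j 1)))
      (fun j _ => h.normSq_nonneg _ _) (Finset.mem_univ (J p))
  have h3 := h1.trans (mul_le_mul_of_nonneg_left h2 hC)
  refine (Real.rpow_le_rpow (norm_nonneg _) h3 (by positivity)).trans (le_of_eq ?_)
  rw [Real.mul_rpow hC (by positivity), ← Real.rpow_natCast, ← Real.rpow_mul (Real.sqrt_nonneg _),
    mul_div_cancel₀ _ hN'.ne']
  congr 1
  rw [Real.rpow_two, Real.sq_sqrt hE]

end Density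

/-! ### Change of variables under complex scalars -/

section ScalarMultiplication

variable {m : ℕ}

theorem measurePreserving_unit_smul {u : ℂ} (hu : ‖u‖ = 1) :
    MeasurePreserving (fun z : CSpace m => u • z) := by
  have hu0 : u ≠ 0 := by
    rintro rfl
    simp at hu
  let e : CSpace m ≃ₗᵢ[ℝ] CSpace m :=
    { (LinearEquiv.smulOfNeZero ℂ (CSpace m) u hu0).restrictScalars ℝ with
      norm_map' := fun z => by
        change ‖u • z‖ = ‖z‖
        rw [norm_smul, hu, one_mul] }
  exact e.measurePreserving

/-- Split `w` into its modulus, a real dilation, and a unit scalar, which is an isometry and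
preserves volume. -/
theorem lintegral_comp_complex_smul {w : ℂ} (hw : w ≠ 0) {G : CSpace m → ℝ≥0∞} (hG : Measurable G) :
    ∫⁻ z, G (w • z) =
      ENNReal.ofReal |(‖w‖ ^ Module.finrank ℝ (CSpace m))⁻¹| * ∫⁻ z, G z := by
  have hn : (‖w‖ : ℂ) ≠ 0 := by exact_mod_cast norm_ne_zero_iff.2 hw
  have hu : ‖w / ‖w‖‖ = 1 := by
    rw [norm_div, Complex.norm_real, norm_norm, div_self (norm_ne_zero_iff.2 hw)]
  have h1 : ∀ z : CSpace m, w • z = ‖w‖ • ((w / ‖w‖) • z) := by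
    intro z
    rw [← Complex.coe_smul, smul_smul, mul_div_cancel₀ _ hn]
  simp only [h1]
  have hG1 : Measurable fun z : CSpace m => G (‖w‖ • z) := hG.comp (measurable_const_smul _)
  rw [(measurePreserving_unit_smul hu).lintegral_comp hG1,
    ← lintegral_map hG (measurable_const_smul ‖w‖),
    Measure.map_addHaar_smul _ (norm_ne_zero_iff.2 hw), lintegral_smul_measure, smul_eq_mul]

end ScalarMultiplication

/-! ### From the order function to the growth of the energy -/

section Order

variable {n m : ℕ} {X : Type*} [TopologicalSpace X] [ChartedSpace (CSpace n) X]

/-- Any real q strictly between the order and 2 works: eventually log T < q log r. -/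
theorem MeromorphicMap.exists_orderFunction_le (f : MeromorphicMap n X m) (h : HermitianMetric n X)
    (hρ : f.order h < 2) :
    ∃ q : ℝ, q < 2 ∧ ∀ᶠ r : ℝ in atTop, f.orderFunction h r ≤ ENNReal.ofReal (r ^ q) := by
  obtain ⟨q, hq1, hq2⟩ := EReal.lt_iff_exists_real_btwn.1 hρ
  refine ⟨q, EReal.coe_lt_coe_iff.1 (show (q : EReal) < ((2 : ℝ) : EReal) from hq2), ?_⟩
  have hev := eventually_lt_of_limsup_lt hq1
  filter_upwards [hev, eventually_gt_atTop 1] with r hr hr1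
  have hlog : 0 < Real.log r := Real.log_pos hr1
  rw [EReal.div_lt_iff (by exact_mod_cast hlog) (EReal.coe_ne_top _)] at hr
  have hrq : 0 < r ^ q := Real.rpow_pos_of_pos (by linarith) q
  by_contra! hcon
  have h1 := ENNReal.log_lt_log_iff.2 hcon
  rw [ENNReal.log_ofReal, if_neg (not_le.2 hrq), Real.log_rpow (by linarith)] at h1
  rw [← EReal.coe_mul] at hr
  exact lt_asymm h1 hr

/-- Keep only t in (r, 2r], an interval of length r. There the inner integral is at least its value
at r, and the weight is at least its value at 2r. -/
theorem MeromorphicMap.mul_lintegral_le_orderFunction (f : MeromorphicMap n X m)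
    (h : HermitianMetric n X) {r : ℝ} (hr : 1 ≤ r) :
    ENNReal.ofReal (1 / (2 * r) ^ (2 * m - 1) * r) *
      ∫⁻ z in ball (0 : CSpace m) r \ f.S, ENNReal.ofReal (f.pullbackDensity h z) ≤
      f.orderFunction h (2 * r) := by
  set A := ∫⁻ z in ball (0 : CSpace m) r \ f.S, ENNReal.ofReal (f.pullbackDensity h z) with hA
  calc ENNReal.ofReal (1 / (2 * r) ^ (2 * m - 1) * r) * A
      = ∫⁻ _ in Ioc r (2 * r), ENNReal.ofReal (1 / (2 * r) ^ (2 * m - 1)) * A := by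
        rw [setLIntegral_const, Real.volume_Ioc, ENNReal.ofReal_mul (by positivity)]
        rw [show 2 * r - r = r by ring]
        ring
    _ ≤ ∫⁻ t in Ioc r (2 * r), ENNReal.ofReal (1 / t ^ (2 * m - 1)) *
          ∫⁻ z in ball (0 : CSpace m) t \ f.S, ENNReal.ofReal (f.pullbackDensity h z) := by
        refine setLIntegral_mono' measurableSet_Ioc fun t ht => ?_
        have ht0 : 0 < t := by linarith [ht.1]
        gcongr
        · exact ht.2
        · exact lintegral_mono_set (sdiff_subset_sdiff_left (ball_subset_ball ht.1.le))
    _ ≤ f.orderFunction h (2 * r) := lintegral_mono_set (Ioc_subset_Ioc_left hr)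

/-- If the order is less than 2, the energy grows slower than the volume. -/
theorem MeromorphicMap.exists_lintegral_energy_le (f : MeromorphicMap n X m)
    (h : HermitianMetric n X) (hm : 0 < m) (hρ : f.order h < 2) :
    ∃ q : ℝ, q < 2 ∧ ∀ᶠ r : ℝ in atTop,
      ENNReal.ofReal (1 / 2 ^ m * (1 / Real.pi) ^ m * (1 / (2 * r) ^ (2 * m - 1) * r)) *
      ∫⁻ z in ball (0 : CSpace m) r \ f.S, ENNReal.ofReal (h.energy f.toFun z) ≤
        ENNReal.ofReal ((2 * r) ^ q) := by
  obtain ⟨q, hq, hev⟩ := f.exists_orderFunction_le h hρ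
  refine ⟨q, hq, ?_⟩
  have ht : Tendsto (fun r : ℝ => 2 * r) atTop atTop := tendsto_id.const_mul_atTop two_pos
  filter_upwards [ht.eventually hev, eventually_ge_atTop 1] with r hr hr1
  refine le_trans ?_ ((f.mul_lintegral_le_orderFunction h hr1).trans hr)
  have hK : (0 : ℝ) ≤ 1 / 2 ^ m * (1 / Real.pi) ^ m := by positivity
  rw [ENNReal.ofReal_mul hK, mul_comm (ENNReal.ofReal (1 / 2 ^ m * (1 / Real.pi) ^ m)), mul_assoc]
  gcongr
  rw [← lintegral_const_mul' _ _ ENNReal.ofReal_ne_top]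
  refine lintegral_mono fun z => ?_
  rw [← ENNReal.ofReal_mul hK]
  exact ENNReal.ofReal_le_ofReal (f.energy_le_pullbackDensity h hm z)

/-- The order function takes values in [0, ∞], so local finiteness of the energy near `S` has to be
extracted from the bound on the order. -/
theorem MeromorphicMap.lintegral_energy_ne_top (f : MeromorphicMap n X m)
    (h : HermitianMetric n X) (hm : 0 < m) (hρ : f.order h < 2) (R : ℝ) :
    ∫⁻ z in ball (0 : CSpace m) R \ f.S, ENNReal.ofReal (h.energy f.toFun z) ≠ ⊤ := by
  obtain ⟨q, -, hev⟩ := f.exists_lintegral_energy_le h hm hρ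
  obtain ⟨r, hr, hrR, hr0⟩ :=
    (hev.and ((eventually_ge_atTop R).and (eventually_gt_atTop 0))).exists
  intro htop
  have h1 : ∫⁻ z in ball (0 : CSpace m) r \ f.S, ENNReal.ofReal (h.energy f.toFun z) = ⊤ := by
    refine top_le_iff.1 (htop ▸ lintegral_mono_set ?_)
    exact sdiff_subset_sdiff_left (ball_subset_ball hrR)
  have hpos : 0 < 1 / 2 ^ m * (1 / Real.pi) ^ m * (1 / (2 * r) ^ (2 * m - 1) * r) := by positivity
  rw [h1, ENNReal.mul_top (by simpa using hpos)] at hr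
  exact ENNReal.ofReal_ne_top (top_le_iff.1 hr)

end Order

/-! ### Restriction of a meromorphic map to the lines through a point -/

section Lines

variable {n m : ℕ} {X : Type*} [TopologicalSpace X] [ChartedSpace (CSpace n) X]
  [IsManifold 𝓘(ℂ, CSpace n) ω X]

theorem HermitianMetric.continuousOn_energy (h : HermitianMetric n X) {F : CSpace m → X}
    {Ω : Set (CSpace m)} (hΩ : IsOpen Ω)
    (hF : MDifferentiableOn 𝓘(ℂ, CSpace m) 𝓘(ℂ, CSpace n) F Ω) :
    ContinuousOn (h.energy F) Ω :=
  continuousOn_finsetSum _ fun _ _ => h.continuousOn_normSq_mfderiv hΩ hF _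

/-- Almost all lines through `a` carry locally finite energy away from `a`. -/
theorem ae_lintegral_line_lt_top {G : CSpace m → ℝ≥0∞} (hG : Measurable G)
    (hfin : ∀ R, ∫⁻ x in ball (0 : CSpace m) R, G x ≠ ⊤) (a : CSpace m) :
    ∀ᵐ z : CSpace m, ∀ k : ℕ, ‖z‖ < k →
      ∫⁻ w in {w : ℂ | 1 / (k : ℝ) < ‖w‖ ∧ ‖w‖ < k}, G (a + w • z) < ⊤ := by
  refine ae_all_iff.2 fun k => ?_
  -- For fixed `w` the substitution z ↦ a + w • z costs the factor ‖w‖^{-2m}, which is bounded only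
  -- away from w = 0.
  set B : Set ℂ := {w : ℂ | 1 / (k : ℝ) < ‖w‖ ∧ ‖w‖ < k} with hB
  have hBm : MeasurableSet B :=
    ((isOpen_lt continuous_const continuous_norm).inter
      (isOpen_lt continuous_norm continuous_const)).measurableSet
  have hBfin : volume B ≠ ⊤ := by
    refine ((measure_mono (t := ball (0 : ℂ) k) fun w hw => ?_).trans_lt measure_ball_lt_top).ne
    exact mem_ball_zero_iff.2 hw.2
  set R : ℝ := ‖a‖ + k * k with hR
  set GR : CSpace m → ℝ≥0∞ := (ball (0 : CSpace m) R).indicator G with hGR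
  have hGRm : Measurable GR := hG.indicator measurableSet_ball
  have hline : Measurable fun q : CSpace m × ℂ => a + q.2 • q.1 := by
    have : Continuous fun q : CSpace m × ℂ => a + q.2 • q.1 := by fun_prop
    exact this.measurable
  have hjm : Measurable fun q : CSpace m × ℂ => GR (a + q.2 • q.1) := hGRm.comp hline
  have hint : ∫⁻ z : CSpace m, ∫⁻ w in B, GR (a + w • z) ≠ ⊤ := by
    rw [lintegral_lintegral_swap (f := fun z w => GR (a + w • z)) hjm.aemeasurable]
    have hbound : ∀ w ∈ B, ∫⁻ z : CSpace m, GR (a + w • z) ≤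
        ENNReal.ofReal ((k : ℝ) ^ Module.finrank ℝ (CSpace m)) *
          ∫⁻ x in ball (0 : CSpace m) R, G x := by
      intro w hw
      have hk : 0 < (k : ℝ) := (norm_nonneg w).trans_lt hw.2
      have hw0 : 0 < ‖w‖ := lt_trans (by positivity) hw.1
      rw [lintegral_comp_complex_smul (G := fun z => GR (a + z)) (norm_pos_iff.1 hw0)
        (hGRm.comp (measurable_const_add a)), lintegral_add_left_eq_self GR a,
        lintegral_indicator measurableSet_ball]
      gcongr
      rw [abs_of_nonneg (by positivity), ← inv_pow]
      gcongr
      rw [inv_le_comm₀ hw0 hk, inv_eq_one_div]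
      exact hw.1.le
    refine ((setLIntegral_mono' hBm hbound).trans_lt ?_).ne
    rw [setLIntegral_const]
    exact ENNReal.mul_lt_top (ENNReal.mul_lt_top ENNReal.ofReal_lt_top (hfin R).lt_top) hBfin.lt_top
  have hae := ae_lt_top (Measurable.lintegral_prod_right' hjm) hint
  filter_upwards [hae] with z hz hzk
  refine lt_of_le_of_lt (setLIntegral_mono' hBm fun w hw => ?_) hz
  have hmem : a + w • z ∈ ball (0 : CSpace m) R := by
    rw [mem_ball_zero_iff]
    calc ‖a + w • z‖ ≤ ‖a‖ + ‖w • z‖ := norm_add_le _ _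
      _ = ‖a‖ + ‖w‖ * ‖z‖ := by rw [norm_smul]
      _ < R := by
        have := mul_lt_mul'' hw.2 hzk (norm_nonneg w) (norm_nonneg z)
        linarith
  simp only [hGR, indicator_of_mem hmem, le_refl]

theorem mfderiv_comp_line {F : CSpace m → X} {a z : CSpace m} {w : ℂ}
    (hF : MDifferentiableAt 𝓘(ℂ, CSpace m) 𝓘(ℂ, CSpace n) F (a + w • z)) :
    MDifferentiableAt 𝓘(ℂ, ℂ) 𝓘(ℂ, CSpace n) (fun w : ℂ => F (a + w • z)) w ∧
    mfderiv 𝓘(ℂ, ℂ) 𝓘(ℂ, CSpace n) (fun w : ℂ => F (a + w • z)) w (1 : ℂ) =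
      mfderiv 𝓘(ℂ, CSpace m) 𝓘(ℂ, CSpace n) F (a + w • z) z := by
  have hd : HasDerivAt (fun w : ℂ => a + w • z) z w := by
    simpa using ((hasDerivAt_id w).smul_const z).const_add a
  have hl : MDifferentiableAt 𝓘(ℂ, ℂ) 𝓘(ℂ, CSpace m) (fun w : ℂ => a + w • z) w :=
    hd.differentiableAt.mdifferentiableAt
  refine ⟨hF.comp w hl, ?_⟩
  have h1 := mfderiv_comp_apply (I := 𝓘(ℂ, ℂ)) (I' := 𝓘(ℂ, CSpace m)) (I'' := 𝓘(ℂ, CSpace n)) w hF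
    hl (1 : ℂ)
  refine h1.trans ?_
  congr 1
  rw [mfderiv_eq_fderiv]
  exact hd.deriv

/-- A meromorphic map of finite energy has limits along almost all lines through `a`. -/
theorem MeromorphicMap.ae_exists_tendsto_line [T2Space X] [CompactSpace X]
    (f : MeromorphicMap n X m) (h : HermitianMetric n X) (hm : 0 < m) (hρ : f.order h < 2)
    {a : CSpace m} (ha : a ∉ f.S) :
    ∀ᵐ z : CSpace m, ∀ w₀ : ℂ, ∃ p, Tendsto (fun w => f.toFun (a + w • z)) (𝓝[≠] w₀) (𝓝 p) := by
  have hΩ : IsOpen (f.Sᶜ) := f.analytic_S.isClosed.isOpen_compl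
  set G : CSpace m → ℝ≥0∞ := (f.Sᶜ).indicator fun z => ENNReal.ofReal (h.energy f.toFun z) with hG
  have hGm : Measurable G :=
    (h.continuousOn_energy hΩ f.holomorphic).measurable_indicator_ofReal hΩ.measurableSet
  have hGfin : ∀ R, ∫⁻ x in ball (0 : CSpace m) R, G x ≠ ⊤ := by
    intro R
    rw [hG, setLIntegral_indicator hΩ.measurableSet, inter_comm, ← Set.sdiff_eq]
    exact f.lintegral_energy_ne_top h hm hρ R
  filter_upwards [ae_lintegral_line_lt_top hGm hGfin a] with z hz w₀
  have hlc : Continuous fun w : ℂ => a + w • z := by fun_prop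
  by_cases hw₀ : w₀ = 0
  · subst hw₀
    have h1 : ContinuousAt f.toFun (a + (0 : ℂ) • z) := by
      rw [zero_smul, add_zero]
      exact f.holomorphic.continuousOn.continuousAt (hΩ.mem_nhds ha)
    have h2 := ContinuousAt.comp (f := fun w : ℂ => a + w • z) (x := (0 : ℂ)) h1 hlc.continuousAt
    exact ⟨_, h2.tendsto.mono_left nhdsWithin_le_nhds⟩
  have hn : 0 < ‖w₀‖ := norm_pos_iff.2 hw₀
  obtain ⟨k, hk⟩ := exists_nat_gt (max ‖z‖ (max (‖w₀‖ + 1) (2 / ‖w₀‖)))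
  obtain ⟨hk1, hk2, hk3⟩ : ‖z‖ < k ∧ ‖w₀‖ + 1 < k ∧ 2 / ‖w₀‖ < k :=
    ⟨(le_max_left _ _).trans_lt hk, ((le_max_left _ _).trans (le_max_right _ _)).trans_lt hk,
      ((le_max_right _ _).trans (le_max_right _ _)).trans_lt hk⟩
  have hk0 : 0 < (k : ℝ) := (norm_nonneg z).trans_lt hk1
  have hnotS := f.analytic_S.eventually_line_notMem ha z w₀
  obtain ⟨ρ₁, hρ₁, hball⟩ := Metric.eventually_nhds_iff.1 (eventually_nhdsWithin_iff.1 hnotS)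
  -- The three bounds keep the punctured disc away from `S`, inside ‖w‖ < k, and outside ‖w‖ ≤ 1/k.
  set ρ := min ρ₁ (min 1 (‖w₀‖ / 2)) with hρdef
  have hρpos : 0 < ρ := by positivity
  have hmem : ∀ w ∈ ball w₀ ρ \ {w₀}, a + w • z ∈ f.Sᶜ ∧ 1 / (k : ℝ) < ‖w‖ ∧ ‖w‖ < k := by
    intro w hw
    have hd : ‖w - w₀‖ < ρ := mem_ball_iff_norm.1 hw.1
    have h1 : ρ ≤ 1 := (min_le_right _ _).trans (min_le_left _ _)
    have h2 : ρ ≤ ‖w₀‖ / 2 := (min_le_right _ _).trans (min_le_right _ _)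
    have h3 : ‖w₀‖ ≤ ‖w‖ + ‖w - w₀‖ := by
      calc ‖w₀‖ = ‖w - (w - w₀)‖ := by congr 1; abel
        _ ≤ _ := norm_sub_le _ _
    have h4 : ‖w‖ ≤ ‖w - w₀‖ + ‖w₀‖ := by
      calc ‖w‖ = ‖(w - w₀) + w₀‖ := by congr 1; abel
        _ ≤ _ := norm_add_le _ _
    refine ⟨hball (lt_of_lt_of_le hw.1 (min_le_left _ _)) hw.2, ?_, by linarith⟩
    have h5 : 1 / (k : ℝ) < ‖w₀‖ / 2 := by
      rw [div_lt_iff₀ hn] at hk3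
      rw [div_lt_div_iff₀ hk0 two_pos]
      linarith
    linarith
  have hmd : ∀ w ∈ ball w₀ ρ \ {w₀},
      MDifferentiableAt 𝓘(ℂ, CSpace m) 𝓘(ℂ, CSpace n) f.toFun (a + w • z) :=
    fun w hw => f.holomorphic.mdifferentiableAt (hΩ.mem_nhds (hmem w hw).1)
  refine exists_tendsto_of_finite_area h hρpos
    (fun w hw => (mfderiv_comp_line (hmd w hw)).1.mdifferentiableWithinAt) ?_
  have hms : MeasurableSet (ball w₀ ρ \ {w₀}) :=
    (isOpen_ball.sdiff isClosed_singleton).measurableSet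
  refine ne_of_lt ?_
  calc _ ≤ ∫⁻ w in ball w₀ ρ \ {w₀}, ENNReal.ofReal (2 ^ m * ‖z‖ ^ 2) * G (a + w • z) := by
        refine setLIntegral_mono' hms fun w hw => ?_
        rw [hG, indicator_of_mem (hmem w hw).1, ← ENNReal.ofReal_mul (by positivity),
          (mfderiv_comp_line (hmd w hw)).2]
        exact ENNReal.ofReal_le_ofReal (h.normSq_mfderiv_le_energy f.toFun (a + w • z) z)
    _ ≤ ∫⁻ w in {w : ℂ | 1 / (k : ℝ) < ‖w‖ ∧ ‖w‖ < k},
          ENNReal.ofReal (2 ^ m * ‖z‖ ^ 2) * G (a + w • z) :=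
        lintegral_mono_set fun w hw => (hmem w hw).2
    _ = ENNReal.ofReal (2 ^ m * ‖z‖ ^ 2) *
          ∫⁻ w in {w : ℂ | 1 / (k : ℝ) < ‖w‖ ∧ ‖w‖ < k}, G (a + w • z) :=
        lintegral_const_mul _ (hGm.comp hlc.measurable)
    _ < ⊤ := ENNReal.mul_lt_top ENNReal.ofReal_lt_top (hz k hk1)

end Lines

/-! ### Sub-mean value inequality for the pull-back and comparison of growth -/

section Growth

/-- Take the punctured limit as the value at every point, exceptional or not. It agrees with `k`
wherever `k` is continuous, and Riemann's theorem makes it holomorphic at the remaining points. -/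
theorem exists_entire_extension {k : ℂ → ℂ} (hd : ∀ w₀, ∀ᶠ w in 𝓝[≠] w₀, DifferentiableAt ℂ k w)
    (hlim : ∀ w₀, ∃ L, Tendsto k (𝓝[≠] w₀) (𝓝 L)) :
    ∃ g : ℂ → ℂ, Differentiable ℂ g ∧ ∀ w, ContinuousAt k w → g w = k w := by
  choose g hg using hlim
  have heq : ∀ w, ContinuousAt k w → g w = k w := fun w hw =>
    tendsto_nhds_unique (hg w) (hw.tendsto.mono_left nhdsWithin_le_nhds)
  refine ⟨g, fun w₀ => ?_, heq⟩
  have hev : ∀ᶠ w in 𝓝[≠] w₀, g =ᶠ[𝓝 w] k ∧ DifferentiableAt ℂ k w := by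
    have h1 := eventually_eventually_nhdsWithin.2 (hd w₀)
    filter_upwards [h1, hd w₀, self_mem_nhdsWithin] with w hw hkw hne
    rw [isOpen_compl_singleton.nhdsWithin_eq hne] at hw
    exact ⟨hw.mono fun v hv => heq v hv.continuousAt, hkw⟩
  refine (Complex.analyticAt_of_differentiable_on_punctured_nhds_of_continuousAt
    (hev.mono fun w hw => hw.2.congr_of_eventuallyEq hw.1) ?_).differentiableAt
  rw [continuousAt_iff_punctured_nhds]
  exact (hg w₀).congr' (hev.mono fun w hw => hw.1.self_of_nhds.symm)

variable {m : ℕ}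

/-- Sub-mean value inequality on balls, deduced from the one on circles. -/
theorem mul_volume_ball_le_lintegral {H : CSpace m → ℝ≥0∞} (hH : Measurable H) {a : CSpace m}
    {A : ℝ≥0∞} (hA : ∀ᵐ z : CSpace m, ENNReal.ofReal (2 * Real.pi) * A ≤
      ∫⁻ θ in Ioc 0 (2 * Real.pi), H (a + circleMap 0 1 θ • z)) (r : ℝ) :
    A * volume (ball (0 : CSpace m) r) ≤ ∫⁻ z in ball (0 : CSpace m) r, H (a + z) := by
  have hline : Measurable fun q : CSpace m × ℝ => a + circleMap 0 1 q.2 • q.1 := by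
    have : Continuous fun q : CSpace m × ℝ => a + circleMap 0 1 q.2 • q.1 := by fun_prop
    exact this.measurable
  have hjm : Measurable fun q : CSpace m × ℝ => H (a + circleMap 0 1 q.2 • q.1) := hH.comp hline
  -- Multiplication by a unit scalar preserves the ball and its volume. So after Tonelli the inner
  -- integral does not depend on the angle, and integrating the circle inequality over directions
  -- gives the one on balls.
  have hrot : ∀ θ : ℝ, ∫⁻ z in ball (0 : CSpace m) r, H (a + circleMap 0 1 θ • z) =
      ∫⁻ z in ball (0 : CSpace m) r, H (a + z) := by
    intro θ
    have hu : ‖circleMap 0 1 θ‖ = 1 := by simp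
    have hpre : (fun z : CSpace m => circleMap 0 1 θ • z) ⁻¹' ball (0 : CSpace m) r =
        ball (0 : CSpace m) r := by
      ext z
      simp [norm_smul]
    have := (measurePreserving_unit_smul (m := m) hu).setLIntegral_comp_preimage
      (measurableSet_ball (x := (0 : CSpace m)) (ε := r)) (hH.comp (measurable_const_add a))
    rw [hpre] at this
    exact this
  have h1 : ENNReal.ofReal (2 * Real.pi) * A * volume (ball (0 : CSpace m) r) ≤
      ENNReal.ofReal (2 * Real.pi) * ∫⁻ z in ball (0 : CSpace m) r, H (a + z) := by
    calc ENNReal.ofReal (2 * Real.pi) * A * volume (ball (0 : CSpace m) r)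
        = ∫⁻ _ in ball (0 : CSpace m) r, ENNReal.ofReal (2 * Real.pi) * A := by
          rw [setLIntegral_const]
      _ ≤ ∫⁻ z in ball (0 : CSpace m) r,
            ∫⁻ θ in Ioc 0 (2 * Real.pi), H (a + circleMap 0 1 θ • z) :=
          lintegral_mono_ae (ae_restrict_of_ae hA)
      _ = ∫⁻ θ in Ioc 0 (2 * Real.pi),
            ∫⁻ z in ball (0 : CSpace m) r, H (a + circleMap 0 1 θ • z) :=
          lintegral_lintegral_swap (f := fun z θ => H (a + circleMap 0 1 θ • z)) hjm.aemeasurable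
      _ = ENNReal.ofReal (2 * Real.pi) * ∫⁻ z in ball (0 : CSpace m) r, H (a + z) := by
          simp only [hrot]
          rw [setLIntegral_const, Real.volume_Ioc, sub_zero, mul_comm]
  rw [mul_assoc] at h1
  exact (ENNReal.mul_le_mul_iff_right (by simpa using Real.pi_pos) ENNReal.ofReal_ne_top).1 h1

variable {n : ℕ} {X : Type*} [TopologicalSpace X] [ChartedSpace (CSpace n) X]
  [IsManifold 𝓘(ℂ, CSpace n) ω X] {l : Fin n → ℕ}
  {τ : ∀ x : X, symAltTensors n l (TangentSpace 𝓘(ℂ, CSpace n) x)}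

/-- Sub-mean value inequality for the pull-back of a holomorphic tensor. -/
theorem MeromorphicMap.norm_pullback_mul_volume_le [T2Space X] [CompactSpace X]
    (f : MeromorphicMap n X m) (h : HermitianMetric n X) (hm : 0 < m) (hρ : f.order h < 2)
    (hτ : τ ∈ globalSections n X l) {a : CSpace m} (ha : a ∉ f.S) (u : TensorIndex n l → CSpace m)
    {p : ℝ} (hp : 0 < p) (r : ℝ) :
    ENNReal.ofReal (‖tensorEval τ (f.toFun a) (fun q => mfderiv 𝓘(ℂ, CSpace m) 𝓘(ℂ, CSpace n)
      f.toFun a (u q))‖ ^ p) * volume (ball (0 : CSpace m) r) ≤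
      ∫⁻ x in ball (0 : CSpace m) (‖a‖ + r) \ f.S, ENNReal.ofReal (‖tensorEval τ (f.toFun x)
        (fun q => mfderiv 𝓘(ℂ, CSpace m) 𝓘(ℂ, CSpace n) f.toFun x (u q))‖ ^ p) := by
  have hΩ : IsOpen (f.Sᶜ) := f.analytic_S.isClosed.isOpen_compl
  have hline := fun z w₀ => f.analytic_S.eventually_line_notMem ha z w₀
  have hξd := differentiableOn_tensorEval_mfderiv hτ hΩ f.holomorphic u
  have hext := ae_exists_tendsto_pullback hτ hΩ f.holomorphic ha hline
    (f.ae_exists_tendsto_line h hm hρ ha) u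
  set ξ : CSpace m → ℂ := fun x => tensorEval τ (f.toFun x)
    (fun q => mfderiv 𝓘(ℂ, CSpace m) 𝓘(ℂ, CSpace n) f.toFun x (u q)) with hξ
  set H : CSpace m → ℝ≥0∞ := (f.Sᶜ).indicator fun x => ENNReal.ofReal (‖ξ x‖ ^ p) with hH
  have hHm : Measurable H :=
    (hξd.continuousOn.norm.rpow_const fun _ _ => Or.inr hp.le).measurable_indicator_ofReal
      hΩ.measurableSet
  have hA : ∀ᵐ z : CSpace m, ENNReal.ofReal (2 * Real.pi) * ENNReal.ofReal (‖ξ a‖ ^ p) ≤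
      ∫⁻ θ in Ioc 0 (2 * Real.pi), H (a + circleMap 0 1 θ • z) := by
    -- On such a line ξ continues to an entire function with value `ξ a` at 0, and the unit circle
    -- of the line meets `S` only in a null set of angles.
    filter_upwards [hext] with z hz
    have hdiff : ∀ w : ℂ, a + w • z ∉ f.S → DifferentiableAt ℂ (fun w : ℂ => ξ (a + w • z)) w :=
      fun w hw => DifferentiableAt.comp (g := ξ) w (hξd.differentiableAt (hΩ.mem_nhds hw))
        (by fun_prop : DifferentiableAt ℂ (fun w : ℂ => a + w • z) w)
    obtain ⟨g, hgd, hg⟩ := exists_entire_extension (k := fun w => ξ (a + w • z))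
      (fun w₀ => (hline z w₀).mono hdiff) hz
    have hg0 : g 0 = ξ a := by
      rw [hg 0 (hdiff 0 (by simpa using ha)).continuousAt]
      simp
    have h1 := norm_rpow_le_lintegral_circleMap hgd hp
    rw [hg0] at h1
    refine h1.trans (le_of_eq (lintegral_congr_ae (ae_restrict_of_ae ?_)))
    filter_upwards [ae_circleMap_of_eventually_punctured (hline z)] with θ hθ
    rw [hH, indicator_of_mem (show a + circleMap 0 1 θ • z ∈ f.Sᶜ from hθ),
      hg _ (hdiff _ hθ).continuousAt]
  refine (mul_volume_ball_le_lintegral hHm hA r).trans ?_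
  have hsub : ball (0 : CSpace m) r ⊆ (fun z => a + z) ⁻¹' ball (0 : CSpace m) (‖a‖ + r) := by
    intro z hz
    have : ‖z‖ < r := mem_ball_zero_iff.1 hz
    exact mem_ball_zero_iff.2 ((norm_add_le a z).trans_lt (by linarith))
  calc ∫⁻ z in ball (0 : CSpace m) r, H (a + z)
      ≤ ∫⁻ z in (fun z => a + z) ⁻¹' ball (0 : CSpace m) (‖a‖ + r), H (a + z) :=
        lintegral_mono_set hsub
    _ = ∫⁻ x in ball (0 : CSpace m) (‖a‖ + r), H x :=
        (measurePreserving_add_left volume a).setLIntegral_comp_preimage measurableSet_ball hHm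
    _ = _ := by
        rw [hH, setLIntegral_indicator hΩ.measurableSet, inter_comm, ← Set.sdiff_eq]

theorem not_eventually_mul_sq_le {c C q : ℝ} (hc : 0 < c) (hq : q < 2) :
    ¬ ∀ᶠ r : ℝ in atTop, c * r ^ 2 ≤ C * r ^ q := by
  intro hev
  have ht := (tendsto_rpow_atTop (sub_pos.2 hq)).eventually (eventually_gt_atTop (C / c))
  obtain ⟨r, h1, h2, hr⟩ := (hev.and (ht.and (eventually_gt_atTop 0))).exists
  rw [div_lt_iff₀ hc] at h2
  have h3 : r ^ (2 - q) * r ^ q = r ^ 2 := by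
    rw [← Real.rpow_add hr, sub_add_cancel, Real.rpow_two]
  have h4 := mul_lt_mul_of_pos_right h2 (Real.rpow_pos_of_pos hr q)
  have h5 : r ^ (2 - q) * c * r ^ q = c * r ^ 2 := by rw [← h3]; ring
  linarith

end Growth

/-! ### Conclusion: comparison of the two growth rates -/

theorem mainTheorem2 {n m : ℕ} (hmn : n ≤ m)
    {X : Type*} [TopologicalSpace X] [T2Space X] [CompactSpace X] [ConnectedSpace X]
    [ChartedSpace (CSpace n) X] [IsManifold 𝓘(ℂ, CSpace n) ω X]
    (h : HermitianMetric n X) (f : MeromorphicMap n X m)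
    (hf : f.DifferentiablyNondegenerate) (hρ : f.order h < 2)
    (l : Fin n → ℕ) (hl : 0 < ∑ k, l k) :
    globalSections n X l = ⊥ := by
  obtain ⟨k₀, -, hk₀⟩ := Finset.exists_ne_zero_of_sum_ne_zero hl.ne'
  have hm : 0 < m := (Nat.zero_le _).trans_lt (k₀.2.trans_le hmn)
  have hN : 0 < Fintype.card (TensorIndex n l) :=
    Fintype.card_pos_iff.2 ⟨⟨k₀, ⟨0, Nat.pos_of_ne_zero hk₀⟩, 0⟩⟩
  rw [Submodule.eq_bot_iff]
  intro τ hτ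
  by_contra hτ0
  obtain ⟨a, ha, J, hJ⟩ := exists_pullback_ne_zero hmn f hf hτ hτ0
  obtain ⟨C, hC, hbound⟩ := exists_norm_pullback_rpow_le_energy (m := m) h hτ hN
  obtain ⟨q, hq, hgrowth⟩ := f.exists_lintegral_energy_le h hm hρ
  set p : ℝ := 2 / (Fintype.card (TensorIndex n l) : ℝ) with hpdef
  have hp : 0 < p := by
    have : (0 : ℝ) < Fintype.card (TensorIndex n l) := by exact_mod_cast hN
    positivity
  set s : ℝ := ‖tensorEval τ (f.toFun a) (fun p => mfderiv 𝓘(ℂ, CSpace m) 𝓘(ℂ, CSpace n) f.toFun a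
    (EuclideanSpace.single (J p) 1))‖ ^ p with hs
  have hspos : 0 < s := Real.rpow_pos_of_pos (norm_pos_iff.2 hJ) p
  set V : ℝ := (volume (ball (0 : CSpace m) 1)).toReal with hV
  have hVpos : 0 < V := ENNReal.toReal_pos (measure_ball_pos _ _ one_pos).ne' measure_ball_lt_top.ne
  set K : ℝ := 1 / 2 ^ m * (1 / Real.pi) ^ m with hK
  have hKpos : 0 < K := by positivity
  -- The constant collects the weight R (2R)^{1-2m} and the volume (R/2)^{2m} V of the ball of
  -- radius R/2; their product is a multiple of R².
  refine not_eventually_mul_sq_le (c := K * (1 / 2 ^ (2 * m - 1)) * (s * V / 2 ^ (2 * m)))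
    (C := C * 2 ^ q) (by positivity) hq ?_
  -- With R > 2‖a‖ the ball of radius ‖a‖ + R/2 lies in the ball of radius R.
  filter_upwards [hgrowth, eventually_gt_atTop (2 * ‖a‖), eventually_gt_atTop 0] with R hR hRa hR0
  have h1 := f.norm_pullback_mul_volume_le h hm hρ hτ ha
    (fun p => EuclideanSpace.single (J p) 1) hp (R / 2)
  have hvol : volume (ball (0 : CSpace m) (R / 2)) = ENNReal.ofReal ((R / 2) ^ (2 * m) * V) := by
    rw [Measure.addHaar_ball_of_pos _ _ (by positivity), ENNReal.ofReal_mul (by positivity), hV,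
      ENNReal.ofReal_toReal measure_ball_lt_top.ne, finrank_real_of_complex,
      finrank_euclideanSpace_fin]
  have h2 : ∫⁻ x in ball (0 : CSpace m) (‖a‖ + R / 2) \ f.S, ENNReal.ofReal (‖tensorEval τ
      (f.toFun x) (fun q => mfderiv 𝓘(ℂ, CSpace m) 𝓘(ℂ, CSpace n) f.toFun x
        (EuclideanSpace.single (J q) 1))‖ ^ p) ≤ ENNReal.ofReal C *
      ∫⁻ x in ball (0 : CSpace m) R \ f.S, ENNReal.ofReal (h.energy f.toFun x) := by
    rw [← lintegral_const_mul' _ _ ENNReal.ofReal_ne_top]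
    refine (lintegral_mono_set (sdiff_subset_sdiff_left (ball_subset_ball
      (show ‖a‖ + R / 2 ≤ R by linarith)))).trans (lintegral_mono fun x => ?_)
    rw [← ENNReal.ofReal_mul hC]
    exact ENNReal.ofReal_le_ofReal (hbound f.toFun x J)
  set T := ENNReal.ofReal (K * (1 / (2 * R) ^ (2 * m - 1) * R)) with hT
  have h3 : T * (ENNReal.ofReal s * ENNReal.ofReal ((R / 2) ^ (2 * m) * V)) ≤
      ENNReal.ofReal C * ENNReal.ofReal ((2 * R) ^ q) := by
    rw [← hvol]
    calc _ ≤ T * (ENNReal.ofReal C *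
          ∫⁻ x in ball (0 : CSpace m) R \ f.S, ENNReal.ofReal (h.energy f.toFun x)) := by
          exact mul_le_mul_right (h1.trans h2) T
      _ = ENNReal.ofReal C * (T *
          ∫⁻ x in ball (0 : CSpace m) R \ f.S, ENNReal.ofReal (h.energy f.toFun x)) := by ring
      _ ≤ _ := by gcongr
  rw [hT, ← ENNReal.ofReal_mul hspos.le, ← ENNReal.ofReal_mul (by positivity),
    ← ENNReal.ofReal_mul hC, ENNReal.ofReal_le_ofReal_iff (by positivity),
    Real.mul_rpow two_pos.le hR0.le] at h3
  refine le_trans (le_of_eq ?_) (h3.trans (le_of_eq (by ring)))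
  obtain ⟨k, rfl⟩ : ∃ k, m = k + 1 := ⟨m - 1, by omega⟩
  rw [show 2 * (k + 1) - 1 = 2 * k + 1 by omega, show 2 * (k + 1) = 2 * k + 1 + 1 by ring, mul_pow,
    div_pow]
  field_simp
  ring
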